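/- **Setting.** Let $d\ge 1$ and let $F(x,y)=(T(x),G(x,y))$ be a skew product on $[-1,1]^{d+1}=[-1,1]\times[-1,1]^d$, where $T:[-1,1]\to[-1,1]$ and $G:[-1,1]\times[-1,1]^d\to[-1,1]^d$ satisfy the following. * $T$ is $C^1$ in the interior of each element of a finite partition of $[-1,1]$ into disjoint intervals; $\{T'=0\}$ is finite; $T_*\mathrm{Leb}\ll\mathrm{Leb}$ on $[-1,1]$; and $\log|T'|\in L^1([-1,1],dx)$. * $G$ is measurable and is $C^1$ in the interior of each element of a finite partition of $[-1,1]^{d+1}$ into disjoint measurable sets with nonempty interior and Lebesgue-null boundary; $\log^+\|DG\|\in L^1([-1,1]^{d+1})$ (for instance, $DG$ is bounded); and for Lebesgue-almost every $x\in[-1,1]$ the map $G(x,\cdot)$ is a ($C^1$) local diffeomorphism on the open cube $(-1,1)^d$. * (Fiber contraction) There is $c\in(0,1)$ such that for every $x\in[-1,1]$ the map $G(x,\cdot):[-1,1]^d\to[-1,1]^d$ is Lipschitz with constant $c$. Let $\rho:\mathbb R\to[0,\infty)$ be a probability density of bounded variation with $\operatorname{supp}\rho=[-1,1]$ and $\rho>0$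 almost everywhere on $[-1,1]$, and for $\xi>0$ put $\rho^\xi(x)=\xi^{-1}\rho(x/\xi)$. For $r\in\mathbb R$ let $r \bmod 2$ be its representative in $(-1,1]$. For $\omega\in\mathbb R^{d+1}$ put $F_\omega(z)=F(z)+\omega \bmod 2$ (componentwise), and for $\eta\in\mathbb R$ put $T_\eta(x)=T(x)+\eta\bmod 2$. Let $\mathbb P_\xi$ be the law of an i.i.d. sequence $\underline\omega=(\omega_1,\omega_2,\dots)$ in $\mathbb R^{d+1}$ whose components are independent with density $\rho^\xi$, and put $F^n_{\underline\omega}=F_{\omega_n}\circ\cdots\circ F_{\omega_1}$. Write $\sigma_1(A)\ge\dots\ge\sigma_{d+1}(A)$ for the singular values of a $(d+1)\times(d+1)$ matrix $A$, and $\log 0=-\infty$. **Statement.** Let $\xi>0$, and assume that the Markov chain $X_n=T_{\eta_n}(X_{n-1})$ on $[-1,1]$, with $\eta_1,\eta_2,\dots$ i.i.d. of density $\rho^\xi$, has a unique stationary probability measure $\mu_\xi$. Then the Markov chain $(X_n,Y_n)=F_{\omega_n}(X_{n-1},Y_{n-1})$ on $[-1,1]^{d+1}$ has a unique stationary probability measure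 $\nu_\xi$, and there are constants $\chi_1(\xi),\dots,\chi_{d+1}(\xi)\in[-\infty,\infty)$ such that: 1. for $\nu_\xi$-almost every $(x,y)$ and $\mathbb P_\xi$-almost every $\underline\omega$, $$\lim_{n\to\infty}\frac1n\log\sigma_i\big(D_{(x,y)}F^n_{\underline\omega}\big)=\chi_i(\xi)\qquad\text{for all }1\le i\le d+1;$$ 2. for Lebesgue-almost every $(x,y)\in[-1,1]^{d+1}$ and $\mathbb P_\xi$-almost every $\underline\omega$, $$\lim_{n\to\infty}\frac1n\log\sigma_1\big(D_{(x,y)}F^n_{\underline\omega}\big)=\lambda(\xi):=\chi_1(\xi).$$ -/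

import Mathlib

open Set Filter Topology MeasureTheory
open scoped NNReal ENNReal Manifold

noncomputable section

namespace NoisySkew

/-- The cube `[-1,1]^m` in Euclidean space `ℝ^m`. -/
def cube (m : ℕ) : Set (EuclideanSpace ℝ (Fin m)) := {z | ∀ j, z j ∈ Icc (-1 : ℝ) 1}

/-- The base coordinate `x` of `z = (x, y) ∈ ℝ × ℝ^d = ℝ^(d+1)`. -/
def baseCoord {d : ℕ} (z : EuclideanSpace ℝ (Fin (d + 1))) : ℝ := z 0

/-- The fiber coordinate `y` of `z = (x, y) ∈ ℝ × ℝ^d = ℝ^(d+1)`. -/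
def fiberCoord {d : ℕ} (z : EuclideanSpace ℝ (Fin (d + 1))) : EuclideanSpace ℝ (Fin d) :=
  WithLp.toLp 2 fun j => z j.succ

/-- The fiber dynamics `(x, y) ↦ G(x, y)`, as a function of the joint variable `z = (x, y)`. -/
def fiberFun {d : ℕ} (G : ℝ → EuclideanSpace ℝ (Fin d) → EuclideanSpace ℝ (Fin d))
    (z : EuclideanSpace ℝ (Fin (d + 1))) : EuclideanSpace ℝ (Fin d) :=
  G (baseCoord z) (fiberCoord z)

/-- The skew product `F(x, y) = (T(x), G(x, y))` on `ℝ^(d+1)`. -/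
def skewMap {d : ℕ} (T : ℝ → ℝ)
    (G : ℝ → EuclideanSpace ℝ (Fin d) → EuclideanSpace ℝ (Fin d))
    (z : EuclideanSpace ℝ (Fin (d + 1))) : EuclideanSpace ℝ (Fin (d + 1)) :=
  WithLp.toLp 2 (Fin.cons (T (baseCoord z)) (fun j => fiberFun G z j) : Fin (d + 1) → ℝ)

/-- Standing assumptions on the base dynamics `T : [-1,1] → [-1,1]`: it is piecewise `C^1` with
respect to a finite partition of `[-1,1]` into disjoint intervals, it has finitely many critical
points, it is nonsingular with respect to Lebesgue measure, and `log |T'|` is Lebesgue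
integrable. -/
structure IsBaseMap (T : ℝ → ℝ) : Prop where
  mapsTo : MapsTo T (Icc (-1) 1) (Icc (-1) 1)
  piecewise_smooth : ∃ (k : ℕ) (I : Fin k → Set ℝ),
    (∀ i, (I i).OrdConnected) ∧ Pairwise (fun i j => Disjoint (I i) (I j)) ∧
    (⋃ i, I i) = Icc (-1) 1 ∧ ∀ i, ContDiffOn ℝ 1 T (interior (I i))
  finite_critical : {x ∈ Icc (-1 : ℝ) 1 | deriv T x = 0}.Finite
  nonsingular : (volume.restrict (Icc (-1 : ℝ) 1)).map T ≪ volume.restrict (Icc (-1 : ℝ) 1)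
  integrable_log : IntegrableOn (fun x => Real.log |deriv T x|) (Icc (-1 : ℝ) 1) volume

/-- Standing assumptions on the fiber dynamics `G : [-1,1] × [-1,1]^d → [-1,1]^d`: it is
measurable, piecewise `C^1` with respect to a finite partition of `[-1,1]^(d+1)` into disjoint
measurable sets with nonempty interior and Lebesgue-null boundary, `log⁺ ‖DG‖` is Lebesgue
integrable, and `G(x, ·)` is a local diffeomorphism on the open cube for almost every `x`. -/
structure IsFiberMap {d : ℕ}
    (G : ℝ → EuclideanSpace ℝ (Fin d) → EuclideanSpace ℝ (Fin d)) : Prop where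
  mapsTo : ∀ x ∈ Icc (-1 : ℝ) 1, MapsTo (G x) (cube d) (cube d)
  measurable : Measurable ((cube (d + 1)).domRestrict (fiberFun G))
  piecewise_smooth : ∃ (k : ℕ) (A : Fin k → Set (EuclideanSpace ℝ (Fin (d + 1)))),
    (∀ i, MeasurableSet (A i) ∧ (interior (A i)).Nonempty ∧ volume (frontier (A i)) = 0) ∧
    Pairwise (fun i j => Disjoint (A i) (A j)) ∧
    (⋃ i, A i) = cube (d + 1) ∧ ∀ i, ContDiffOn ℝ 1 (fiberFun G) (interior (A i))
  integrable_posLog :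
    IntegrableOn (fun z => Real.posLog ‖fderiv ℝ (fiberFun G) z‖) (cube (d + 1)) volume
  local_diffeo : ∀ᵐ x ∂(volume.restrict (Icc (-1 : ℝ) 1)),
    IsLocalDiffeomorphOn 𝓘(ℝ, EuclideanSpace ℝ (Fin d)) 𝓘(ℝ, EuclideanSpace ℝ (Fin d)) 1
      (G x) (interior (cube d))

/-- Uniform fiber contraction: `Lip (G(x, ·)) ≤ c < 1` on `[-1,1]^d`, for every `x ∈ [-1,1]`. -/
def FiberContraction {d : ℕ}
    (G : ℝ → EuclideanSpace ℝ (Fin d) → EuclideanSpace ℝ (Fin d)) : Prop :=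
  ∃ c : ℝ≥0, 0 < c ∧ c < 1 ∧ ∀ x ∈ Icc (-1 : ℝ) 1, LipschitzOnWith c (G x) (cube d)

/-- A mother kernel: a probability density of bounded variation on `ℝ` whose support is `[-1,1]`
and which is positive almost everywhere there. -/
structure IsMotherKernel (ρ : ℝ → ℝ) : Prop where
  nonneg : ∀ x, 0 ≤ ρ x
  integrable : Integrable ρ volume
  integral_eq_one : ∫ x, ρ x = 1
  boundedVariation : BoundedVariationOn ρ univ
  support_eq : tsupport ρ = Icc (-1) 1
  pos_ae : ∀ᵐ x ∂(volume.restrict (Icc (-1 : ℝ) 1)), 0 < ρ x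

/-- The law on `ℝ` with density `ρ^ξ(x) = ρ(x / ξ) / ξ`. -/
def noiseLaw (ρ : ℝ → ℝ) (ξ : ℝ) : Measure ℝ :=
  volume.withDensity fun x => ENNReal.ofReal (1 / ξ * ρ (x / ξ))

theorem isProbabilityMeasure_noiseLaw {ρ : ℝ → ℝ} (hρ : IsMotherKernel ρ) {ξ : ℝ} (hξ : 0 < ξ) :
    IsProbabilityMeasure (noiseLaw ρ ξ) := by
  constructor
  have hi : Integrable (fun x => 1 / ξ * ρ (x / ξ)) volume :=
    (hρ.integrable.comp_div hξ.ne').const_mul _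
  have h0 : ∀ x, 0 ≤ 1 / ξ * ρ (x / ξ) := fun x => mul_nonneg (by positivity) (hρ.nonneg _)
  rw [noiseLaw, withDensity_apply _ MeasurableSet.univ, Measure.restrict_univ,
    ← ofReal_integral_eq_lintegral_ofReal hi (Eventually.of_forall h0), integral_const_mul,
    Measure.integral_comp_div, hρ.integral_eq_one, abs_of_pos hξ]
  simp [hξ.ne']

/-- The law on `ℝ^m` with independent components, each with law `noiseLaw ρ ξ`. -/
def noiseLawVec (m : ℕ) (ρ : ℝ → ℝ) (ξ : ℝ) : Measure (Fin m → ℝ) :=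
  Measure.pi fun _ => noiseLaw ρ ξ

/-- The law `ℙ_ξ` of an i.i.d. sequence with marginal law `noiseLawVec m ρ ξ`. -/
def noiseSeqLaw (m : ℕ) (ρ : ℝ → ℝ) (ξ : ℝ) : Measure (ℕ → Fin m → ℝ) :=
  Measure.infinitePi fun _ => noiseLawVec m ρ ξ

/-- The representative of `r` modulo `2` in `(-1, 1]`. -/
def mod2 (r : ℝ) : ℝ := toIocMod (two_pos : (0 : ℝ) < 2) (-1) r

/-- The noisy base map `T_η(x) = T(x) + η mod 2`. -/
def noisyBase (T : ℝ → ℝ) (η : ℝ) (x : ℝ) : ℝ := mod2 (T x + η)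

/-- The noisy skew product `F_ω(z) = F(z) + ω mod 2` (componentwise). -/
def noisySkew {d : ℕ} (T : ℝ → ℝ)
    (G : ℝ → EuclideanSpace ℝ (Fin d) → EuclideanSpace ℝ (Fin d))
    (ω : Fin (d + 1) → ℝ) (z : EuclideanSpace ℝ (Fin (d + 1))) :
    EuclideanSpace ℝ (Fin (d + 1)) :=
  WithLp.toLp 2 fun j => mod2 (skewMap T G z j + ω j)

/-- The random composition `F^n_ω = F_{ω_n} ∘ ⋯ ∘ F_{ω_1}`; the sequence `ω_1, ω_2, …` is
indexed from `0`. -/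
def randomIterate {d : ℕ} (T : ℝ → ℝ)
    (G : ℝ → EuclideanSpace ℝ (Fin d) → EuclideanSpace ℝ (Fin d))
    (ω : ℕ → Fin (d + 1) → ℝ) :
    ℕ → EuclideanSpace ℝ (Fin (d + 1)) → EuclideanSpace ℝ (Fin (d + 1))
  | 0 => id
  | n + 1 => noisySkew T G (ω n) ∘ randomIterate T G ω n

/-- `μ` is a stationary probability measure, on the state space `K`, of the Markov chain
`X_n = f_{w_n}(X_{n-1})` with `w_1, w_2, …` i.i.d. of law `P`: if `X_0` has law `μ` and `w` is
independent of `X_0` and has law `P`, then `f_w(X_0)` has law `μ`. -/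
structure IsStationary {W S : Type*} [MeasurableSpace W] [MeasurableSpace S]
    (f : W → S → S) (P : Measure W) (K : Set S) (μ : Measure S) : Prop where
  isProbabilityMeasure : IsProbabilityMeasure μ
  concentrated : μ Kᶜ = 0
  map_eq : (μ.prod P).map (fun p => f p.2 p.1) = μ

/-- `(1/n) log σ_{i+1}(D_z F^n_ω) ∈ [-∞, ∞]`, where `σ_1 ≥ σ_2 ≥ ⋯` are the singular values
(which Mathlib indexes from `0`) and `log 0 = -∞`. -/
def lyapQuotient {d : ℕ} (T : ℝ → ℝ)
    (G : ℝ → EuclideanSpace ℝ (Fin d) → EuclideanSpace ℝ (Fin d))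
    (i : Fin (d + 1)) (z : EuclideanSpace ℝ (Fin (d + 1))) (ω : ℕ → Fin (d + 1) → ℝ) (n : ℕ) :
    EReal :=
  ((1 / (n : ℝ) : ℝ) : EReal) * ENNReal.log (ENNReal.ofReal
    ((fderiv ℝ (randomIterate T G ω n) z).toLinearMap.singularValues (i : ℕ)))

end NoisySkew

end

noncomputable section

namespace NoisySkew

section Birkhoff

variable {X : Type*}

/-- The maximum of `0` and of the first `n` Birkhoff sums. -/
def maxBirkhoff (Θ : X → X) (f : X → ℝ) : ℕ → X → ℝ
  | 0, _ => 0
  | n + 1, x => max 0 (f x + maxBirkhoff Θ f n (Θ x))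

theorem maxBirkhoff_nonneg (Θ : X → X) (f : X → ℝ) (n : ℕ) (x : X) :
    0 ≤ maxBirkhoff Θ f n x := by
  cases n with
  | zero => exact le_rfl
  | succ n => exact le_max_left _ _

theorem maxBirkhoff_le_succ (Θ : X → X) (f : X → ℝ) (n : ℕ) (x : X) :
    maxBirkhoff Θ f n x ≤ maxBirkhoff Θ f (n + 1) x := by
  induction n generalizing x with
  | zero => exact maxBirkhoff_nonneg Θ f 1 x
  | succ n ih =>
    rw [maxBirkhoff, maxBirkhoff]
    gcongr
    exact ih _

theorem birkhoffSum_le_maxBirkhoff (Θ : X → X) (f : X → ℝ) (n : ℕ) (x : X) :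
    birkhoffSum Θ f n x ≤ maxBirkhoff Θ f n x := by
  induction n generalizing x with
  | zero => simp [maxBirkhoff]
  | succ n ih =>
    rw [birkhoffSum_succ', maxBirkhoff]
    exact le_max_of_le_right (by gcongr; exact ih _)

variable [MeasurableSpace X] {μ : Measure X} [IsProbabilityMeasure μ] {Θ : X → X} {f : X → ℝ}

theorem measurable_maxBirkhoff (hΘ : Measurable Θ) (hf : Measurable f) (n : ℕ) :
    Measurable (maxBirkhoff Θ f n) := by
  induction n with
  | zero => exact measurable_const
  | succ n ih => exact measurable_const.max (hf.add (ih.comp hΘ))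

theorem integrable_maxBirkhoff (hΘ : MeasurePreserving Θ μ μ) (hfi : Integrable f μ) (n : ℕ) :
    Integrable (maxBirkhoff Θ f n) μ := by
  induction n with
  | zero => exact integrable_zero _ _ _
  | succ n ih =>
    exact (integrable_zero _ _ _).sup (hfi.add (hΘ.integrable_comp_of_integrable ih))

theorem ae_exists_maxBirkhoff_le (hΘ : Ergodic Θ μ) (hf : Measurable f) (hfi : Integrable f μ)
    (hneg : ∫ x, f x ∂μ < 0) : ∀ᵐ x ∂μ, ∃ C : ℕ, ∀ n, maxBirkhoff Θ f n x ≤ C := by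
  set U : Set X := {x | ∃ C : ℕ, ∀ n, maxBirkhoff Θ f n x ≤ C} with hU
  have hUm : MeasurableSet U := by
    have : U = ⋃ C : ℕ, ⋂ n, {x | maxBirkhoff Θ f n x ≤ C} := by ext; simp [hU]
    rw [this]
    exact MeasurableSet.iUnion fun C => MeasurableSet.iInter fun n =>
      measurableSet_le (measurable_maxBirkhoff hΘ.measurable hf n) measurable_const
  have hinv : Θ ⁻¹' U = U := by
    ext x
    constructor
    · rintro ⟨C, hC⟩
      obtain ⟨D, hD⟩ := exists_nat_ge (max 0 (f x + C))
      refine ⟨D, fun n => ?_⟩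
      refine (maxBirkhoff_le_succ Θ f n x).trans (le_trans ?_ hD)
      rw [maxBirkhoff]
      gcongr
      exact hC n
    · rintro ⟨C, hC⟩
      obtain ⟨D, hD⟩ := exists_nat_ge (C - f x)
      refine ⟨D, fun n => ?_⟩
      have := (le_max_right _ _).trans (hC (n + 1))
      linarith
  rcases hΘ.ae_mem_or_ae_notMem hUm hinv with h | h
  · exact h
  exfalso
  have hlim : Tendsto (fun n => ∫ x, (maxBirkhoff Θ f (n + 1) x - maxBirkhoff Θ f n (Θ x)) ∂μ)
      atTop (𝓝 (∫ x, f x ∂μ)) := by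
    refine tendsto_integral_of_dominated_convergence (fun x => |f x|) ?_ hfi.abs ?_ ?_
    · intro n
      exact ((measurable_maxBirkhoff hΘ.measurable hf _).sub
        ((measurable_maxBirkhoff hΘ.measurable hf _).comp hΘ.measurable)).aestronglyMeasurable
    · refine fun n => Eventually.of_forall fun x => ?_
      have h0 := maxBirkhoff_nonneg Θ f n (Θ x)
      rw [maxBirkhoff, Real.norm_eq_abs, abs_le]
      constructor
      · have := le_max_right 0 (f x + maxBirkhoff Θ f n (Θ x))
        have := neg_abs_le (f x)
        linarith
      · have : max 0 (f x + maxBirkhoff Θ f n (Θ x)) ≤ |f x| + maxBirkhoff Θ f n (Θ x) :=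
          max_le (by positivity) (by gcongr; exact le_abs_self _)
        linarith
    · filter_upwards [h] with x hx
      have hx' : Θ x ∉ U := fun h' => hx (by rw [← hinv]; exact h')
      have hmono : Monotone fun n => maxBirkhoff Θ f n (Θ x) :=
        monotone_nat_of_le_succ fun n => maxBirkhoff_le_succ Θ f n _
      have hev : ∀ᶠ n in atTop, -f x ≤ maxBirkhoff Θ f n (Θ x) := by
        by_contra hcon
        rw [not_eventually] at hcon
        obtain ⟨D, hD⟩ := exists_nat_ge (-f x)
        refine hx' ⟨D, fun n => ?_⟩
        obtain ⟨m, hm, hm'⟩ := (frequently_atTop.1 hcon) n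
        exact (hmono hm).trans ((not_le.1 hm').le.trans hD)
      refine tendsto_const_nhds.congr' ?_
      filter_upwards [hev] with n hn
      rw [maxBirkhoff, max_eq_right (by linarith)]
      ring
  have hge : ∀ n, 0 ≤ ∫ x, (maxBirkhoff Θ f (n + 1) x - maxBirkhoff Θ f n (Θ x)) ∂μ := by
    intro n
    have hi := integrable_maxBirkhoff hΘ.toMeasurePreserving hfi
    have hc : Integrable (fun x => maxBirkhoff Θ f n (Θ x)) μ :=
      hΘ.toMeasurePreserving.integrable_comp_of_integrable (hi n)
    rw [integral_sub (hi (n + 1)) hc]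
    have : ∫ x, maxBirkhoff Θ f n (Θ x) ∂μ = ∫ x, maxBirkhoff Θ f n x ∂μ := by
      conv_rhs => rw [← hΘ.map_eq]
      rw [integral_map hΘ.measurable.aemeasurable
        (measurable_maxBirkhoff hΘ.measurable hf n).aestronglyMeasurable]
    rw [this, sub_nonneg]
    exact integral_mono (hi n) (hi (n + 1)) fun x => maxBirkhoff_le_succ Θ f n x
  exact absurd (ge_of_tendsto' hlim hge) (not_le.2 hneg)

theorem ae_eventually_birkhoffSum_le (hΘ : Ergodic Θ μ) (hf : Measurable f)
    (hfi : Integrable f μ) :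
    ∀ᵐ x ∂μ, ∀ ε > 0, ∀ᶠ n : ℕ in atTop, birkhoffSum Θ f n x ≤ n * (∫ x, f x ∂μ + ε) := by
  have key : ∀ j : ℕ, ∀ᵐ x ∂μ, ∃ C : ℕ, ∀ n,
      maxBirkhoff Θ (fun x => f x - (∫ x, f x ∂μ + 1 / (j + 1))) n x ≤ C := by
    intro j
    refine ae_exists_maxBirkhoff_le hΘ (hf.sub_const _) (hfi.sub (integrable_const _)) ?_
    rw [integral_sub hfi (integrable_const _)]
    simp only [integral_const, probReal_univ, smul_eq_mul, one_mul]
    have : (0 : ℝ) < 1 / (j + 1) := by positivity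
    linarith
  filter_upwards [ae_all_iff.2 key] with x hx ε hε
  obtain ⟨j, hj⟩ := exists_nat_one_div_lt (half_pos hε)
  obtain ⟨C, hC⟩ := hx j
  have hev : ∀ᶠ n : ℕ in atTop, (C : ℝ) ≤ n * (ε / 2) := by
    have := (tendsto_natCast_atTop_atTop (R := ℝ)).atTop_mul_const (half_pos hε)
    exact this.eventually_ge_atTop _
  filter_upwards [hev] with n hn
  have h1 := (birkhoffSum_le_maxBirkhoff Θ _ n x).trans (hC n)
  have h2 : birkhoffSum Θ (fun x => f x - (∫ x, f x ∂μ + 1 / (j + 1))) n x =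
      birkhoffSum Θ f n x - n * (∫ x, f x ∂μ + 1 / (j + 1)) := by
    simp only [birkhoffSum, Finset.sum_sub_distrib, Finset.sum_const, Finset.card_range,
      nsmul_eq_mul]
  rw [h2] at h1
  have : (n : ℝ) * (1 / (j + 1)) ≤ n * (ε / 2) := by gcongr
  linarith

/-- Birkhoff's ergodic theorem for ergodic transformations of a probability space. -/
theorem tendsto_birkhoffSum_div (hΘ : Ergodic Θ μ) (hf : Measurable f) (hfi : Integrable f μ) :
    ∀ᵐ x ∂μ, Tendsto (fun n : ℕ => birkhoffSum Θ f n x / n) atTop (𝓝 (∫ x, f x ∂μ)) := by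
  filter_upwards [ae_eventually_birkhoffSum_le hΘ hf hfi,
    ae_eventually_birkhoffSum_le hΘ hf.neg hfi.neg] with x hx hx'
  rw [Metric.tendsto_atTop']
  intro ε hε
  have hev := (hx (ε / 2) (half_pos hε)).and ((hx' (ε / 2) (half_pos hε)).and
    (eventually_gt_atTop 0))
  obtain ⟨N, hN⟩ := eventually_atTop.1 hev
  refine ⟨N, fun n hn => ?_⟩
  obtain ⟨h1, h2, h3⟩ := hN n hn.le
  have h3' : (0 : ℝ) < n := by exact_mod_cast h3
  have h4 : birkhoffSum Θ (-f) n x = -birkhoffSum Θ f n x := by simp [birkhoffSum]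
  simp only [Pi.neg_apply, integral_neg] at h2
  rw [h4] at h2
  rw [Real.dist_eq, abs_lt]
  constructor
  · have : ∫ x, f x ∂μ - ε / 2 ≤ birkhoffSum Θ f n x / n := by
      rw [le_div_iff₀ h3']; nlinarith
    linarith
  · have : birkhoffSum Θ f n x / n ≤ ∫ x, f x ∂μ + ε / 2 := by
      rw [div_le_iff₀ h3']; nlinarith
    linarith

end Birkhoff

section Kingman

variable {X : Type*}

/-- Decomposition of an orbit segment into blocks on which a nonpositive subadditive sequence is
small, up to visits of the set `B` where no short block is available. -/
theorem subadditive_le_of_blocks {Θ : X → X} {h : ℕ → X → ℝ} {a : ℝ} (ha : a < 0) {N : ℕ}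
    {B : Set X} {x : X}
    (hsub : ∀ i m n, 0 < m → 0 < n →
      h (m + n) (Θ^[i] x) ≤ h m (Θ^[i] x) + h n (Θ^[i + m] x))
    (hneg : ∀ i n, 0 < n → h n (Θ^[i] x) ≤ 0)
    (hB : ∀ i, Θ^[i] x ∉ B → ∃ n, 0 < n ∧ n ≤ N ∧ h n (Θ^[i] x) ≤ a * n) (K i : ℕ)
    (hK : 0 < K) :
    h K (Θ^[i] x) ≤ a * (K - N - ∑ j ∈ Finset.range K, B.indicator 1 (Θ^[i + j] x)) := by
  induction K using Nat.strong_induction_on generalizing i with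
  | _ K ih =>
  have hind : ∀ y, (0 : ℝ) ≤ B.indicator 1 y := fun y => indicator_nonneg (fun _ _ => zero_le_one) y
  have hsum : ∀ (s : Finset ℕ), 0 ≤ ∑ j ∈ s, B.indicator (1 : X → ℝ) (Θ^[i + j] x) :=
    fun s => Finset.sum_nonneg fun j _ => hind _
  rcases le_or_gt K N with hKN | hKN
  · refine (hneg i K hK).trans (mul_nonneg_of_nonpos_of_nonpos ha.le ?_)
    have : (K : ℝ) ≤ N := by exact_mod_cast hKN
    linarith [hsum (Finset.range K)]
  have split : ∀ n, n < K → ∑ j ∈ Finset.range K, B.indicator (1 : X → ℝ) (Θ^[i + j] x) =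
      ∑ j ∈ Finset.range n, B.indicator (1 : X → ℝ) (Θ^[i + j] x) +
      ∑ j ∈ Finset.range (K - n), B.indicator (1 : X → ℝ) (Θ^[i + n + j] x) := by
    intro n hn
    conv_lhs => rw [← Nat.add_sub_cancel' hn.le, Finset.sum_range_add]
    simp only [add_assoc]
  by_cases hx : Θ^[i] x ∈ B
  · rcases Nat.lt_or_ge 1 K with h1 | h1
    · have e1 := hsub i 1 (K - 1) one_pos (by omega)
      rw [Nat.add_sub_cancel' hK] at e1
      have e2 := ih (K - 1) (by omega) (i + 1) (by omega)
      have e3 := hneg i 1 one_pos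
      rw [split 1 h1]
      simp only [Finset.range_one, Finset.sum_singleton, add_zero, indicator_of_mem hx,
        Pi.one_apply]
      rw [Nat.cast_sub hK, Nat.cast_one] at e2
      calc _ ≤ _ := e1
        _ ≤ 0 + _ := add_le_add e3 e2
        _ = _ := by ring
    · obtain rfl : K = 1 := by omega
      refine (hneg i 1 one_pos).trans (mul_nonneg_of_nonpos_of_nonpos ha.le ?_)
      simp [indicator_of_mem hx]
  · obtain ⟨n, hn0, hnN, hn⟩ := hB i hx
    have e1 := hsub i n (K - n) hn0 (by omega)
    rw [Nat.add_sub_cancel' (by omega)] at e1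
    have e2 := ih (K - n) (by omega) (i + n) (by omega)
    rw [split n (by omega)]
    rw [Nat.cast_sub (by omega)] at e2
    have e3 := mul_nonneg_of_nonpos_of_nonpos ha.le (neg_nonpos.2 (hsum (Finset.range n)))
    calc _ ≤ _ := e1
      _ ≤ _ := add_le_add hn e2
      _ ≤ _ := by linarith

variable [MeasurableSpace X] {μ : Measure X} [IsProbabilityMeasure μ] {Θ : X → X}

theorem ae_eventually_le_of_ae_exists_le (hΘ : Ergodic Θ μ) {h : ℕ → X → ℝ}
    (hm : ∀ n, Measurable (h n))
    (hsub : ∀ᵐ x ∂μ, ∀ m n, 0 < m → 0 < n → h (m + n) x ≤ h m x + h n (Θ^[m] x))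
    (hneg : ∀ᵐ x ∂μ, ∀ n, 0 < n → h n x ≤ 0) {a : ℝ} (ha : a < 0)
    (hex : ∀ᵐ x ∂μ, ∃ n, 0 < n ∧ h n x ≤ a * n) :
    ∀ᵐ x ∂μ, ∀ b > a, ∀ᶠ n : ℕ in atTop, h n x ≤ b * n := by
  set B : ℕ → Set X := fun N => {x | ∀ n, 0 < n → n ≤ N → a * n < h n x} with hBdef
  have hBm : ∀ N, MeasurableSet (B N) := by
    intro N
    simp only [hBdef, ofPred_forall]
    exact MeasurableSet.iInter fun n => MeasurableSet.iInter fun _ => MeasurableSet.iInter fun _ =>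
      measurableSet_lt measurable_const (hm n)
  have hBanti : Antitone B := fun N M hNM x hx n hn hnN => hx n hn (hnN.trans hNM)
  have hB0 : Tendsto (fun N => μ.real (B N)) atTop (𝓝 0) := by
    have h0 : μ (⋂ N, B N) = 0 := by
      refine measure_mono_null ?_ (ae_iff.1 hex)
      intro x hx
      simp only [mem_iInter, hBdef, mem_ofPred_eq] at hx
      simp only [mem_ofPred_eq, not_exists, not_and, not_le]
      exact fun n hn => hx n n hn le_rfl
    have := tendsto_measure_iInter_atTop (μ := μ) (fun N => (hBm N).nullMeasurableSet) hBanti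
      ⟨0, measure_ne_top _ _⟩
    rw [h0] at this
    exact (ENNReal.tendsto_toReal ENNReal.zero_ne_top).comp this
  have hiter : ∀ {p : X → Prop}, (∀ᵐ x ∂μ, p x) → ∀ᵐ x ∂μ, ∀ i, p (Θ^[i] x) := fun hp =>
    ae_all_iff.2 fun i => (hΘ.toMeasurePreserving.iterate i).quasiMeasurePreserving.ae hp
  have hbirk : ∀ᵐ x ∂μ, ∀ N, Tendsto (fun n : ℕ =>
      birkhoffSum Θ ((B N).indicator (1 : X → ℝ)) n x / n) atTop (𝓝 (μ.real (B N))) := by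
    refine ae_all_iff.2 fun N => ?_
    have := tendsto_birkhoffSum_div hΘ (f := (B N).indicator (1 : X → ℝ))
      (measurable_one.indicator (hBm N)) ((integrable_const 1).indicator (hBm N))
    rwa [integral_indicator_one (hBm N)] at this
  filter_upwards [hiter hsub, hiter hneg, hbirk] with x h1 h2 h3 b hb
  have hlim : ∀ᶠ N in atTop, a * (1 - μ.real (B N)) < b := by
    have : Tendsto (fun N => a * (1 - μ.real (B N))) atTop (𝓝 (a * (1 - 0))) :=
      (hB0.const_sub 1).const_mul a
    rw [sub_zero, mul_one] at this
    exact this.eventually_lt_const hb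
  obtain ⟨N, hN⟩ := hlim.exists
  have hlim2 : Tendsto (fun n : ℕ => a * (1 - N * (1 / (n : ℝ)) -
      birkhoffSum Θ ((B N).indicator (1 : X → ℝ)) n x / n)) atTop
      (𝓝 (a * (1 - N * 0 - μ.real (B N)))) :=
    ((tendsto_const_nhds.sub (tendsto_one_div_atTop_nhds_zero_nat.const_mul _)).sub
      (h3 N)).const_mul a
  rw [mul_zero, sub_zero] at hlim2
  filter_upwards [hlim2.eventually_lt_const hN, eventually_gt_atTop 0] with n hn hn0
  have hn0' : (0 : ℝ) < n := by exact_mod_cast hn0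
  have key := subadditive_le_of_blocks (Θ := Θ) (h := h) ha (N := N) (B := B N) (x := x)
    (fun i m n hm hn => by
      have := h1 i m n hm hn
      rwa [← Function.iterate_add_apply, add_comm m i] at this) h2
    (fun i hi => by simpa [hBdef] using hi) n 0 hn0
  simp only [Function.iterate_zero, id, zero_add] at key
  refine key.trans ?_
  have : a * (n - N - ∑ j ∈ Finset.range n, (B N).indicator 1 (Θ^[j] x)) =
      (a * (1 - N * (1 / (n : ℝ)) -
      birkhoffSum Θ ((B N).indicator (1 : X → ℝ)) n x / n)) * n := by
    rw [birkhoffSum]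
    field_simp
  rw [this]
  gcongr

theorem exists_tendsto_of_subadditive_nonpos (hΘ : Ergodic Θ μ) {h : ℕ → X → ℝ}
    (hm : ∀ n, Measurable (h n))
    (hsub : ∀ᵐ x ∂μ, ∀ m n, 0 < m → 0 < n → h (m + n) x ≤ h m x + h n (Θ^[m] x))
    (hneg : ∀ᵐ x ∂μ, ∀ n, 0 < n → h n x ≤ 0) :
    ∃ γ : EReal, γ ≤ 0 ∧
      ∀ᵐ x ∂μ, Tendsto (fun n : ℕ => ((h n x / n : ℝ) : EReal)) atTop (𝓝 γ) := by
  set L : X → EReal := fun x => liminf (fun n : ℕ => ((h n x / n : ℝ) : EReal)) atTop with hL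
  have hLm : Measurable L := Measurable.liminf fun n =>
    ((hm n).div_const _).coe_real_ereal
  have hL0 : ∀ᵐ x ∂μ, L x ≤ 0 := by
    filter_upwards [hneg] with x hx
    refine liminf_le_of_frequently_le' (Eventually.frequently ?_)
    filter_upwards [eventually_gt_atTop 0] with n hn
    exact_mod_cast div_nonpos_of_nonpos_of_nonneg (hx n hn) n.cast_nonneg
  have hneg' : ∀ᵐ x ∂μ, ∀ n, 0 < n → h n (Θ x) ≤ 0 := hΘ.quasiMeasurePreserving.ae hneg
  have hle : ∀ᵐ x ∂μ, ∀ a : ℝ, L (Θ x) < a → L x ≤ a := by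
    filter_upwards [hsub, hneg, hneg'] with x h1 h2 h3 a ha
    rcases le_or_gt 0 a with ha0 | ha0
    · refine liminf_le_of_frequently_le' (Eventually.frequently ?_)
      filter_upwards [eventually_gt_atTop 0] with n hn
      exact_mod_cast (div_nonpos_of_nonpos_of_nonneg (h2 n hn) n.cast_nonneg).trans ha0
    refine le_of_forall_gt_imp_ge_of_dense fun c hc => ?_
    obtain ⟨c', hc1, hc2⟩ := EReal.lt_iff_exists_real_btwn.1 hc
    refine le_trans ?_ hc2.le
    have hc1' : a < c' := by exact_mod_cast hc1
    have hf : ∃ᶠ n : ℕ in atTop, ((h n (Θ x) / n : ℝ) : EReal) < a :=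
      frequently_lt_of_liminf_lt (by isBoundedDefault) ha
    have hev : ∀ᶠ n : ℕ in atTop, a * n ≤ c' * (n + 1) := by
      have : Tendsto (fun n : ℕ => (n : ℝ) * (c' - a)) atTop atTop :=
        tendsto_natCast_atTop_atTop.atTop_mul_const (sub_pos.2 hc1')
      filter_upwards [this.eventually_ge_atTop (-c')] with n hn
      linarith
    refine liminf_le_of_frequently_le' ?_
    have h4 : ∃ᶠ n : ℕ in atTop, ((h (n + 1) x / ((n + 1 : ℕ) : ℝ) : ℝ) : EReal) ≤ c' := by
      refine (hf.and_eventually (hev.and (eventually_gt_atTop 0))).mono ?_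
      rintro n ⟨hn1, hn2, hn3⟩
      have hn1' : h n (Θ x) / n < a := by exact_mod_cast hn1
      rw [div_lt_iff₀ (by exact_mod_cast hn3)] at hn1'
      have h5 := h1 1 n one_pos hn3
      have h6 := h2 1 one_pos
      rw [Function.iterate_one] at h5
      rw [add_comm 1 n] at h5
      rw [EReal.coe_le_coe_iff, div_le_iff₀ (by positivity)]
      push_cast
      linarith
    rw [frequently_atTop] at h4 ⊢
    intro N
    obtain ⟨n, hn, hn'⟩ := h4 N
    exact ⟨n + 1, by omega, hn'⟩
  have hle' : ∀ᵐ x ∂μ, L x ≤ L (Θ x) := by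
    filter_upwards [hle] with x hx
    refine le_of_forall_gt_imp_ge_of_dense fun c hc => ?_
    obtain ⟨c', hc1, hc2⟩ := EReal.lt_iff_exists_real_btwn.1 hc
    exact (hx c' hc1).trans hc2.le
  have h01 : ∀ a : EReal, (∀ᵐ x ∂μ, L x ≤ a) ∨ (∀ᵐ x ∂μ, a < L x) := by
    intro a
    have hS : MeasurableSet {x | a < L x} := measurableSet_lt measurable_const hLm
    have := hΘ.ae_empty_or_univ_of_ae_le_preimage hS.nullMeasurableSet
      (by filter_upwards [hle'] with x hx hx'; exact lt_of_lt_of_le hx' hx)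
    rcases this with h' | h'
    · left
      filter_upwards [h'] with x hx
      by_contra hcon
      exact (show x ∈ (∅ : Set X) from hx.mp (not_le.1 hcon)).elim
    · right
      filter_upwards [h'] with x hx
      exact hx.mpr trivial
  set γ : EReal := sInf {a | ∀ᵐ x ∂μ, L x ≤ a} with hγ
  have hγ0 : γ ≤ 0 := sInf_le hL0
  refine ⟨γ, hγ0, ?_⟩
  have hlow : ∀ᵐ x ∂μ, γ ≤ L x := by
    have : ∀ᵐ x ∂μ, ∀ q : ℚ, ((q : ℝ) : EReal) < γ → ((q : ℝ) : EReal) < L x := by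
      refine ae_all_iff.2 fun q => ?_
      by_cases hq : ((q : ℝ) : EReal) < γ
      · rcases h01 ((q : ℝ) : EReal) with h' | h'
        · exact absurd (show γ ≤ _ from sInf_le (show _ ∈ {a | ∀ᵐ x ∂μ, L x ≤ a} from h')) (not_le.2 hq)
        · filter_upwards [h'] with x hx _ using hx
      · exact Eventually.of_forall fun x h' => absurd h' hq
    filter_upwards [this] with x hx
    refine le_of_forall_lt_imp_le_of_dense fun c hc => ?_
    obtain ⟨q, hq1, hq2⟩ := EReal.lt_iff_exists_rat_btwn.1 hc
    exact (hq1.trans (hx q hq2)).le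
  have hup : ∀ᵐ x ∂μ, limsup (fun n : ℕ => ((h n x / n : ℝ) : EReal)) atTop ≤ γ := by
    have hq : ∀ᵐ x ∂μ, ∀ q : ℚ, (q : ℝ) < 0 → γ < ((q : ℝ) : EReal) →
        ∀ b > (q : ℝ), ∀ᶠ n : ℕ in atTop, h n x ≤ b * n := by
      refine ae_all_iff.2 fun q => ?_
      by_cases hq0 : (q : ℝ) < 0
      swap
      · exact Eventually.of_forall fun x h' => absurd h' hq0
      by_cases hqγ : γ < ((q : ℝ) : EReal)
      swap
      · exact Eventually.of_forall fun x _ h' => absurd h' hqγ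
      have : ∀ᵐ x ∂μ, L x < ((q : ℝ) : EReal) := by
        obtain ⟨a, ha, haq⟩ := sInf_lt_iff.1 hqγ
        filter_upwards [ha] with x hx
        exact lt_of_le_of_lt hx haq
      have hex : ∀ᵐ x ∂μ, ∃ n, 0 < n ∧ h n x ≤ q * n := by
        filter_upwards [this] with x hx
        have hf : ∃ᶠ n : ℕ in atTop, ((h n x / n : ℝ) : EReal) < (q : ℝ) :=
          frequently_lt_of_liminf_lt (by isBoundedDefault) hx
        obtain ⟨n, hn1, hn2⟩ := (hf.and_eventually (eventually_gt_atTop 0)).exists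
        refine ⟨n, hn2, ?_⟩
        have : h n x / n < q := by exact_mod_cast hn1
        rw [div_lt_iff₀ (by exact_mod_cast hn2)] at this
        exact this.le
      filter_upwards [ae_eventually_le_of_ae_exists_le hΘ hm hsub hneg hq0 hex] with x hx _ _
      exact hx
    filter_upwards [hq, hneg] with x hx hx0
    refine le_of_forall_gt_imp_ge_of_dense fun c hc => ?_
    rcases le_or_gt 0 c with hc0 | hc0
    · refine limsup_le_of_le (by isBoundedDefault) ?_
      filter_upwards [eventually_gt_atTop 0] with n hn
      refine le_trans ?_ hc0
      exact_mod_cast div_nonpos_of_nonpos_of_nonneg (hx0 n hn) n.cast_nonneg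
    · obtain ⟨b, hb1, hb2⟩ := EReal.lt_iff_exists_real_btwn.1 hc
      obtain ⟨q, hq1, hq2⟩ := EReal.lt_iff_exists_rat_btwn.1 hb1
      have hqb : (q : ℝ) < b := by exact_mod_cast hq2
      have hb0 : b < 0 := by exact_mod_cast hb2.trans hc0
      refine le_trans (limsup_le_of_le (by isBoundedDefault) ?_) hb2.le
      filter_upwards [hx q (hqb.trans hb0) hq1 b hqb, eventually_gt_atTop 0] with n hn hn0
      rw [EReal.coe_le_coe_iff, div_le_iff₀ (by exact_mod_cast hn0)]
      exact hn
  filter_upwards [hlow, hup] with x h1 h2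
  exact tendsto_of_le_liminf_of_limsup_le h1 h2

/-- Kingman's subadditive ergodic theorem for ergodic transformations of a probability space. -/
theorem exists_tendsto_of_subadditive (hΘ : Ergodic Θ μ) {g : ℕ → X → ℝ}
    (hm : ∀ n, Measurable (g n))
    (hsub : ∀ᵐ x ∂μ, ∀ m n, 0 < m → 0 < n → g (m + n) x ≤ g m x + g n (Θ^[m] x))
    {f : X → ℝ} (hf : Measurable f) (hfi : Integrable f μ) (hgf : ∀ᵐ x ∂μ, g 1 x ≤ f x) :
    ∃ γ : EReal, γ < ⊤ ∧
      ∀ᵐ x ∂μ, Tendsto (fun n : ℕ => ((g n x / n : ℝ) : EReal)) atTop (𝓝 γ) := by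
  set h : ℕ → X → ℝ := fun n x => g n x - birkhoffSum Θ f n x with hh
  have hbm : ∀ n, Measurable (birkhoffSum Θ f n) := fun n =>
    Finset.measurable_sum _ fun i _ => hf.comp (hΘ.measurable.iterate i)
  have hsub' : ∀ᵐ x ∂μ, ∀ m n, 0 < m → 0 < n → h (m + n) x ≤ h m x + h n (Θ^[m] x) := by
    filter_upwards [hsub] with x hx m n hm hn
    have := hx m n hm hn
    simp only [hh, birkhoffSum_add]
    linarith
  have hneg : ∀ᵐ x ∂μ, ∀ n, 0 < n → h n x ≤ 0 := by
    have hiter : ∀ᵐ x ∂μ, ∀ i, g 1 (Θ^[i] x) ≤ f (Θ^[i] x) :=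
      ae_all_iff.2 fun i => (hΘ.toMeasurePreserving.iterate i).quasiMeasurePreserving.ae hgf
    filter_upwards [hsub, hiter] with x h1 h2 n hn
    induction n, hn using Nat.le_induction with
    | base => simpa [hh] using h2 0
    | succ n hn ih =>
      have := h1 n 1 hn one_pos
      have := h2 n
      simp only [hh, birkhoffSum_succ] at ih ⊢
      linarith
  obtain ⟨γ, hγ, hlim⟩ := exists_tendsto_of_subadditive_nonpos hΘ
    (fun n => (hm n).sub (hbm n)) hsub' hneg
  have hγt : γ ≠ ⊤ := (lt_of_le_of_lt hγ EReal.zero_lt_top).ne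
  refine ⟨γ + (∫ x, f x ∂μ : ℝ), EReal.add_lt_top hγt (EReal.coe_ne_top _), ?_⟩
  filter_upwards [hlim, tendsto_birkhoffSum_div hΘ hf hfi] with x h1 h2
  have h3 : Tendsto (fun n : ℕ => ((birkhoffSum Θ f n x / n : ℝ) : EReal)) atTop
      (𝓝 ((∫ x, f x ∂μ : ℝ) : EReal)) := (continuous_coe_real_ereal.tendsto _).comp h2
  have h4 := (EReal.continuousAt_add (p := (γ, ((∫ x, f x ∂μ : ℝ) : EReal)))
    (Or.inr (EReal.coe_ne_bot _)) (Or.inr (EReal.coe_ne_top _))).tendsto.comp (h1.prodMk_nhds h3)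
  refine h4.congr fun n => ?_
  simp only [Function.comp_apply, Pi.sub_apply]
  rw [← EReal.coe_add]
  congr 1
  ring

end Kingman

section UltrafilterLimit

variable {Z : Type*} [MeasurableSpace Z]

/-- A setwise limit along an ultrafilter of measures dominated by a common finite measure is a
measure. -/
theorem exists_measure_tendsto_of_le {ι : Type*} (U : Ultrafilter ι) {μ : ι → Measure Z}
    {m : Measure Z} [IsFiniteMeasure m] (hμ : ∀ n, μ n ≤ m) :
    ∃ ν : Measure Z, ν ≤ m ∧
      ∀ A, MeasurableSet A → Tendsto (fun n => μ n A) U (𝓝 (ν A)) := by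
  have hlim : ∀ A, ∃ a, Tendsto (fun n => μ n A) U (𝓝 a) := fun A =>
    ⟨(U.map fun n => μ n A).lim, (U.map fun n => μ n A).le_nhds_lim⟩
  choose L hL using hlim
  have hLm : ∀ A, L A ≤ m A := fun A => le_of_tendsto' (hL A) fun n => hμ n A
  have hadd : ∀ A B, MeasurableSet B → Disjoint A B → L (A ∪ B) = L A + L B := by
    intro A B hB hAB
    refine tendsto_nhds_unique (hL _) (((hL A).add (hL B)).congr fun n => ?_)
    rw [measure_union hAB hB]
  have hL0 : L ∅ = 0 := le_antisymm ((hLm ∅).trans (by simp)) zero_le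
  have hiU : ∀ ⦃A : ℕ → Set Z⦄ (_ : ∀ i, MeasurableSet (A i)),
      Pairwise (Function.onFun Disjoint A) → L (⋃ i, A i) = ∑' i, L (A i) := by
    intro A hA hd
    set R : ℕ → Set Z := fun k => ⋃ i, A (i + k) with hR
    have hRm : ∀ k, MeasurableSet (R k) := fun k => MeasurableSet.iUnion fun i => hA _
    have hRsucc : ∀ k, R k = A k ∪ R (k + 1) := by
      intro k
      ext z
      simp only [hR, mem_iUnion, mem_union]
      constructor
      · rintro ⟨i, hi⟩
        rcases i with _ | i
        · left; simpa using hi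
        · right; exact ⟨i, by convert hi using 2; omega⟩
      · rintro (h | ⟨i, hi⟩)
        · exact ⟨0, by simpa using h⟩
        · exact ⟨i + 1, by convert hi using 2; omega⟩
    have hRd : ∀ k, Disjoint (A k) (R (k + 1)) := by
      intro k
      rw [disjoint_iUnion_right]
      intro i
      exact hd (by omega)
    have hpart : ∀ k, L (R 0) = ∑ i ∈ Finset.range k, L (A i) + L (R k) := by
      intro k
      induction k with
      | zero => simp
      | succ k ih =>
        rw [ih, Finset.sum_range_succ, hRsucc k, hadd _ _ (hRm _) (hRd k), add_assoc]
    have hRempty : ⋂ k, R k = ∅ := by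
      refine eq_empty_of_forall_notMem fun z hz => ?_
      rw [mem_iInter] at hz
      obtain ⟨i, hi⟩ := mem_iUnion.1 (hz 0)
      obtain ⟨j, hj⟩ := mem_iUnion.1 (hz (i + 1))
      exact (Set.disjoint_left.1 (hd (show i + 0 ≠ j + (i + 1) by omega)) hi) hj
    have hRanti : Antitone R := antitone_nat_of_succ_le fun k => by
      rw [hRsucc k]; exact subset_union_right
    have hm0 : Tendsto (fun k => m (R k)) atTop (𝓝 0) := by
      have := tendsto_measure_iInter_atTop (μ := m) (fun k => (hRm k).nullMeasurableSet) hRanti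
        ⟨0, measure_ne_top _ _⟩
      rwa [hRempty, measure_empty] at this
    have hR0 : Tendsto (fun k => L (R k)) atTop (𝓝 0) :=
      tendsto_of_tendsto_of_tendsto_of_le_of_le tendsto_const_nhds hm0 (fun _ => zero_le)
        fun k => hLm _
    have h1 := (ENNReal.summable (f := fun i => L (A i))).hasSum.tendsto_sum_nat.add hR0
    rw [add_zero] at h1
    have h2 : (⋃ i, A i) = R 0 := by simp [hR]
    rw [h2]
    exact tendsto_nhds_unique (tendsto_const_nhds.congr hpart) h1
  refine ⟨Measure.ofMeasurable (fun A _ => L A) hL0 fun A hA hd => hiU hA hd, ?_, ?_⟩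
  · refine Measure.le_iff.2 fun A hA => ?_
    rw [Measure.ofMeasurable_apply A hA]
    exact hLm A
  · intro A hA
    rw [Measure.ofMeasurable_apply A hA]
    exact hL A

theorem lintegral_le_of_tendsto_measure {ι : Type*} {l : Filter ι} [l.NeBot]
    {μ : ι → Measure Z} {ν : Measure Z}
    (h : ∀ A, MeasurableSet A → Tendsto (fun n => μ n A) l (𝓝 (ν A)))
    {φ : Z → ℝ≥0∞} {c : ℝ≥0∞} (hc : ∀ᶠ n in l, ∫⁻ z, φ z ∂(μ n) ≤ c) :
    ∫⁻ z, φ z ∂ν ≤ c := by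
  rw [lintegral_eq_nnreal]
  refine iSup₂_le fun s hs => ?_
  have hlim : Tendsto (fun n => (s.map ((↑) : ℝ≥0 → ℝ≥0∞)).lintegral (μ n)) l
      (𝓝 ((s.map ((↑) : ℝ≥0 → ℝ≥0∞)).lintegral ν)) := by
    simp only [SimpleFunc.map_lintegral]
    refine tendsto_finsetSum _ fun x _ => ?_
    exact ENNReal.Tendsto.const_mul (h _ (s.measurableSet_fiber x)) (Or.inr ENNReal.coe_ne_top)
  refine le_of_tendsto hlim ?_
  filter_upwards [hc] with n hn
  refine le_trans ?_ hn
  rw [← SimpleFunc.lintegral_eq_lintegral]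
  exact lintegral_mono fun z => hs z

end UltrafilterLimit

section Chain

variable {Z W : Type*} [MeasurableSpace Z] [MeasurableSpace W]

/-- The law of `f_w(X)` where `X` has law `μ` and `w`, independent of `X`, has law `P`. -/
def stepLaw (f : W → Z → Z) (P : Measure W) (μ : Measure Z) : Measure Z :=
  (μ.prod P).map fun p => f p.2 p.1

variable {f : W → Z → Z} {P : Measure W} [IsProbabilityMeasure P]

theorem lintegral_stepLaw (hf : Measurable fun p : Z × W => f p.2 p.1) (μ : Measure Z)
    {φ : Z → ℝ≥0∞} (hφ : Measurable φ) :
    ∫⁻ z, φ z ∂(stepLaw f P μ) = ∫⁻ z, ∫⁻ w, φ (f w z) ∂P ∂μ := by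
  rw [stepLaw, lintegral_map hφ hf,
    lintegral_prod (fun p : Z × W => φ (f p.2 p.1)) (hφ.comp hf).aemeasurable]

theorem stepLaw_apply (hf : Measurable fun p : Z × W => f p.2 p.1) (μ : Measure Z)
    {A : Set Z} (hA : MeasurableSet A) :
    stepLaw f P μ A = ∫⁻ z, P.map (fun w => f w z) A ∂μ := by
  have h := lintegral_stepLaw (P := P) hf μ (measurable_one.indicator hA)
  rw [lintegral_indicator_one hA] at h
  rw [h]
  refine lintegral_congr fun z => ?_
  have hfz : Measurable fun w => f w z := hf.comp measurable_prodMk_left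
  rw [← lintegral_indicator_one hA, lintegral_map (measurable_one.indicator hA) hfz]

theorem isProbabilityMeasure_stepLaw (hf : Measurable fun p : Z × W => f p.2 p.1)
    (μ : Measure Z) [IsProbabilityMeasure μ] : IsProbabilityMeasure (stepLaw f P μ) :=
  Measure.isProbabilityMeasure_map hf.aemeasurable

theorem stepLaw_le (hf : Measurable fun p : Z × W => f p.2 p.1) {m : Measure Z}
    (hm : ∀ z, P.map (fun w => f w z) ≤ m) (μ : Measure Z) [IsProbabilityMeasure μ] :
    stepLaw f P μ ≤ m := by
  refine Measure.le_iff.2 fun A hA => ?_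
  rw [stepLaw_apply hf μ hA]
  calc _ ≤ ∫⁻ _, m A ∂μ := lintegral_mono fun z => hm z A
    _ = m A := by simp

/-- Starting from any point, the Cesàro averages of the laws of a Markov chain with uniformly
dominated transition probabilities accumulate at a stationary measure. -/
theorem exists_stationary_lintegral_eq (hf : Measurable fun p : Z × W => f p.2 p.1)
    {m : Measure Z} [IsFiniteMeasure m] (hm : ∀ z, P.map (fun w => f w z) ≤ m) (z₀ : Z) :
    ∃ ν : Measure Z, IsProbabilityMeasure ν ∧ stepLaw f P ν = ν ∧
      ∀ h : Z → ℝ≥0∞, Measurable h → (∀ z, h z ≤ 1) → (∀ z, ∫⁻ w, h (f w z) ∂P = h z) →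
        ∫⁻ z, h z ∂ν = h z₀ := by
  set law : ℕ → Measure Z := fun n => (stepLaw f P)^[n] (Measure.dirac z₀) with hlaw
  have hlaw_succ : ∀ n, law (n + 1) = stepLaw f P (law n) := fun n =>
    Function.iterate_succ_apply' _ _ _
  have hprob : ∀ n, IsProbabilityMeasure (law n) := by
    intro n
    induction n with
    | zero => simp only [hlaw, Function.iterate_zero, id]; infer_instance
    | succ n ih => rw [hlaw_succ]; exact isProbabilityMeasure_stepLaw hf _
  have hlm : ∀ n, law (n + 1) ≤ m := fun n => by
    rw [hlaw_succ]; exact stepLaw_le hf hm _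
  set c : ℕ → ℝ≥0∞ := fun n => ((n : ℝ≥0∞) + 1)⁻¹ with hc
  have hcn : ∀ n, c n * ((n : ℝ≥0∞) + 1) = 1 := fun n =>
    ENNReal.inv_mul_cancel (by positivity) (by simp)
  set μ : ℕ → Measure Z := fun n => c n • ∑ k ∈ Finset.range (n + 1), law (k + 1) with hμ
  have hμi : ∀ n (φ : Z → ℝ≥0∞), ∫⁻ z, φ z ∂(μ n) =
      c n * ∑ k ∈ Finset.range (n + 1), ∫⁻ z, φ z ∂(law (k + 1)) := by
    intro n φ
    rw [hμ, lintegral_smul_measure, lintegral_finsetSum_measure, smul_eq_mul]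
  have hμA : ∀ n A, μ n A = c n * ∑ k ∈ Finset.range (n + 1), law (k + 1) A := by
    intro n A
    simp [hμ]
  have hμle : ∀ n, μ n ≤ m := by
    intro n
    refine Measure.le_iff.2 fun A _ => ?_
    rw [hμA]
    calc _ ≤ c n * ∑ k ∈ Finset.range (n + 1), m A := by gcongr; exact hlm _
      _ = m A := by
        rw [Finset.sum_const, Finset.card_range, nsmul_eq_mul, ← mul_assoc]
        push_cast
        rw [hcn, one_mul]
  have hμp : ∀ n, μ n univ = 1 := by
    intro n
    rw [hμA]
    have : ∀ k, law (k + 1) univ = 1 := fun k => (hprob _).measure_univ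
    simp only [this, Finset.sum_const, Finset.card_range, nsmul_eq_mul, mul_one]
    push_cast
    exact hcn n
  obtain ⟨ν, -, hν⟩ := exists_measure_tendsto_of_le (hyperfilter ℕ) hμle
  have hle : ((hyperfilter ℕ : Ultrafilter ℕ) : Filter ℕ) ≤ atTop := Nat.hyperfilter_le_atTop
  have hνp : IsProbabilityMeasure ν :=
    ⟨tendsto_nhds_unique (hν univ MeasurableSet.univ) (by simp only [hμp]; exact tendsto_const_nhds)⟩
  have hc0 : Tendsto c (hyperfilter ℕ : Filter ℕ) (𝓝 0) := by
    refine Tendsto.mono_left ?_ hle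
    have := (ENNReal.tendsto_inv_nat_nhds_zero).comp (tendsto_add_atTop_nat 1)
    refine this.congr fun n => ?_
    simp [hc]
  refine ⟨ν, hνp, ?_, ?_⟩
  · have hp : IsProbabilityMeasure (stepLaw f P ν) := isProbabilityMeasure_stepLaw hf ν
    refine Measure.eq_of_le_of_isProbabilityMeasure (Measure.le_iff.2 fun A hA => ?_)
    rw [stepLaw_apply hf ν hA]
    have hlim : Tendsto (fun n => μ n A + c n) (hyperfilter ℕ : Filter ℕ) (𝓝 (ν A + 0)) :=
      (hν A hA).add hc0
    rw [add_zero] at hlim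
    refine le_of_forall_gt_imp_ge_of_dense fun b hb => ?_
    refine lintegral_le_of_tendsto_measure hν ?_
    filter_upwards [hlim.eventually_lt_const hb] with n hn
    refine le_trans ?_ hn.le
    rw [hμi, hμA]
    have : ∀ k, ∫⁻ z, P.map (fun w => f w z) A ∂(law (k + 1)) = law (k + 1 + 1) A := fun k => by
      rw [hlaw_succ (k + 1), stepLaw_apply hf _ hA]
    simp only [this]
    rw [Finset.sum_range_succ]
    calc _ ≤ c n * ((∑ k ∈ Finset.range (n + 1), law (k + 1) A) + 1) := by
          gcongr
          · rw [Finset.sum_range_succ']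
            exact le_self_add
          · exact prob_le_one
      _ = _ := by rw [mul_add, mul_one]
  · intro h hh hh1 hharm
    have hconst : ∀ n (φ : Z → ℝ≥0∞), Measurable φ → (∀ z, ∫⁻ w, φ (f w z) ∂P = φ z) →
        ∫⁻ z, φ z ∂(law n) = φ z₀ := by
      intro n φ hφ hφh
      induction n with
      | zero => simp only [hlaw, Function.iterate_zero, id]; exact lintegral_dirac' _ hφ
      | succ n ih =>
        rw [hlaw_succ, lintegral_stepLaw hf _ hφ]
        simp only [hφh]
        exact ih
    have hup : ∀ φ : Z → ℝ≥0∞, Measurable φ → (∀ z, ∫⁻ w, φ (f w z) ∂P = φ z) →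
        ∫⁻ z, φ z ∂ν ≤ φ z₀ := by
      intro φ hφ hφh
      refine lintegral_le_of_tendsto_measure hν (Eventually.of_forall fun n => ?_)
      rw [hμi]
      simp only [hconst _ φ hφ hφh, Finset.sum_const, Finset.card_range, nsmul_eq_mul]
      rw [← mul_assoc]
      push_cast
      rw [hcn, one_mul]
    have h1 := hup h hh hharm
    have h2 := hup (fun z => 1 - h z) (measurable_const.sub hh) (fun z => by
      have hm' : Measurable fun w => h (f w z) := hh.comp (hf.comp measurable_prodMk_left)
      rw [lintegral_sub hm' (by rw [hharm]; exact ne_top_of_le_ne_top ENNReal.one_ne_top (hh1 z))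
        (Eventually.of_forall fun w => hh1 _), hharm]
      simp)
    have hfin : ∫⁻ z, h z ∂ν ≠ ⊤ :=
      ne_top_of_le_ne_top ENNReal.one_ne_top (h1.trans (hh1 z₀))
    rw [lintegral_sub hh hfin (Eventually.of_forall fun w => hh1 _)] at h2
    simp only [lintegral_const, measure_univ, mul_one] at h2
    refine le_antisymm h1 ?_
    have h3 : ∫⁻ z, h z ∂ν ≤ 1 := h1.trans (hh1 z₀)
    have h4 := tsub_le_iff_right.1 h2
    have h5 : h z₀ + (1 - h z₀) = 1 := add_tsub_cancel_of_le (hh1 z₀)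
    have h6 : 1 - h z₀ ≠ ⊤ := by simp
    rw [← ENNReal.add_le_add_iff_left h6, add_comm, h5]
    exact h4

end Chain

section Shift

variable {W : Type*}

/-- The sequence with first term `w` followed by the terms of `ω`. -/
def consSeq (w : W) (ω : ℕ → W) : ℕ → W
  | 0 => w
  | n + 1 => ω n

variable [MeasurableSpace W]

theorem measurable_consSeq : Measurable fun p : W × (ℕ → W) => consSeq p.1 p.2 := by
  refine measurable_pi_lambda _ fun n => ?_
  cases n with
  | zero => exact measurable_fst
  | succ n => exact (measurable_pi_apply n).comp measurable_snd

variable (P : Measure W) [IsProbabilityMeasure P]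

theorem eq_infinitePi_of_range {ν : Measure (ℕ → W)}
    (h : ∀ (n : ℕ) (t : ℕ → Set W), (∀ i, MeasurableSet (t i)) →
      ν {ω | ∀ i < n, ω i ∈ t i} = ∏ i ∈ Finset.range n, P (t i)) :
    ν = Measure.infinitePi fun _ => P := by
  classical
  refine Measure.eq_infinitePi _ fun s t ht => ?_
  obtain ⟨n, hn⟩ := s.bddAbove
  have hs : s ⊆ Finset.range (n + 1) := fun i hi => by
    have := hn hi
    simp only [Finset.mem_range]
    omega
  have h1 := h (n + 1) (fun i => if i ∈ s then t i else univ) (fun i => by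
    split_ifs
    · exact ht i
    · exact MeasurableSet.univ)
  have h2 : {ω : ℕ → W | ∀ i < n + 1, ω i ∈ if i ∈ s then t i else univ} = Set.pi s t := by
    ext ω
    simp only [mem_ofPred_eq, Set.mem_pi, Finset.mem_coe]
    constructor
    · intro h i hi
      have := h i (Finset.mem_range.1 (hs hi))
      rwa [if_pos hi] at this
    · intro h i _
      split_ifs with hi
      · exact h i hi
      · trivial
  rw [h2] at h1
  rw [h1, ← Finset.prod_subset hs]
  · exact Finset.prod_congr rfl fun i hi => by rw [if_pos hi]
  · intro i _ hi
    rw [if_neg hi, measure_univ]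

theorem infinitePi_box (n : ℕ) (t : ℕ → Set W) (ht : ∀ i, MeasurableSet (t i)) :
    (Measure.infinitePi fun _ : ℕ => P) {ω | ∀ i < n, ω i ∈ t i} =
      ∏ i ∈ Finset.range n, P (t i) := by
  rw [← Measure.infinitePi_pi (μ := fun _ : ℕ => P) (s := Finset.range n) (t := t)
    fun i _ => ht i]
  congr 1
  ext ω
  simp [Set.mem_pi]

theorem map_consSeq_infinitePi :
    (P.prod (Measure.infinitePi fun _ : ℕ => P)).map (fun p => consSeq p.1 p.2) =
      Measure.infinitePi fun _ : ℕ => P := by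
  refine eq_infinitePi_of_range P fun n t ht => ?_
  have hm : MeasurableSet {ω : ℕ → W | ∀ i < n, ω i ∈ t i} := by
    simp only [ofPred_forall]
    exact MeasurableSet.iInter fun i => MeasurableSet.iInter fun _ =>
      (ht i).preimage (measurable_pi_apply i)
  rw [Measure.map_apply measurable_consSeq hm]
  cases n with
  | zero => simp
  | succ n =>
    have : (fun p : W × (ℕ → W) => consSeq p.1 p.2) ⁻¹' {ω | ∀ i < n + 1, ω i ∈ t i} =
        t 0 ×ˢ {ω | ∀ i < n, ω i ∈ t (i + 1)} := by
      ext ⟨w, ω⟩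
      simp only [mem_preimage, mem_ofPred_eq, mem_prod]
      constructor
      · intro h
        exact ⟨h 0 (by omega), fun i hi => h (i + 1) (by omega)⟩
      · rintro ⟨h0, h⟩ i hi
        cases i with
        | zero => exact h0
        | succ i => exact h i (by omega)
    rw [this, Measure.prod_prod, infinitePi_box P n (fun i => t (i + 1)) fun i => ht _,
      Finset.prod_range_succ', mul_comm]

theorem infinitePi_apply_eq_lintegral {B : Set (ℕ → W)} (hB : MeasurableSet B) :
    (Measure.infinitePi fun _ : ℕ => P) B =
      ∫⁻ w, (Measure.infinitePi fun _ : ℕ => P) {ω | consSeq w ω ∈ B} ∂P := by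
  conv_lhs => rw [← map_consSeq_infinitePi P]
  rw [Measure.map_apply measurable_consSeq hB, Measure.prod_apply (measurable_consSeq hB)]
  rfl

end Shift

section SkewShift

variable {Z W : Type*}

/-- The skew product over the shift associated with a random dynamical system. -/
def skewShift (f : W → Z → Z) (p : Z × (ℕ → W)) : Z × (ℕ → W) :=
  (f (p.2 0) p.1, fun n => p.2 (n + 1))

/-- The random orbit of `z` driven by the sequence `ω`. -/
def orbit (f : W → Z → Z) (z : Z) (ω : ℕ → W) : ℕ → Z
  | 0 => z
  | n + 1 => f (ω n) (orbit f z ω n)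

theorem skewShift_iterate (f : W → Z → Z) (n : ℕ) (z : Z) (ω : ℕ → W) :
    (skewShift f)^[n] (z, ω) = (orbit f z ω n, fun k => ω (k + n)) := by
  induction n with
  | zero => rfl
  | succ n ih =>
    rw [Function.iterate_succ_apply', ih, skewShift, orbit]
    simp only [zero_add, Prod.mk.injEq, true_and]
    funext k
    congr 1
    omega

variable [MeasurableSpace Z] [MeasurableSpace W] {f : W → Z → Z} {P : Measure W}
  [IsProbabilityMeasure P]

theorem measurable_skewShift (hf : Measurable fun p : Z × W => f p.2 p.1) :
    Measurable (skewShift f) := by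
  refine Measurable.prodMk ?_ ?_
  · exact hf.comp (measurable_fst.prodMk ((measurable_pi_apply 0).comp measurable_snd))
  · exact measurable_pi_lambda _ fun n => (measurable_pi_apply _).comp measurable_snd

theorem measurable_orbit (hf : Measurable fun p : Z × W => f p.2 p.1) (n : ℕ) :
    Measurable fun p : Z × (ℕ → W) => orbit f p.1 p.2 n := by
  have h : (fun p : Z × (ℕ → W) => orbit f p.1 p.2 n) = fun p => ((skewShift f)^[n] p).1 := by
    funext p
    rw [skewShift_iterate]
  rw [h]
  exact ((measurable_skewShift hf).iterate n).fst

/-- A strictly invariant set of the skew product over the shift is almost sure from every initial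
point, or is negligible from every initial point, when the stationary measure is unique. -/
theorem forall_ae_mem_or_forall_ae_notMem (hf : Measurable fun p : Z × W => f p.2 p.1)
    {m : Measure Z} [IsFiniteMeasure m] (hm : ∀ z, P.map (fun w => f w z) ≤ m)
    {ν : Measure Z}
    (huniq : ∀ ν' : Measure Z, IsProbabilityMeasure ν' → stepLaw f P ν' = ν' → ν' = ν)
    {B : Set (Z × (ℕ → W))} (hB : MeasurableSet B) (hinv : skewShift f ⁻¹' B = B) :
    (∀ z, ∀ᵐ ω ∂(Measure.infinitePi fun _ : ℕ => P), (z, ω) ∈ B) ∨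
      (∀ z, ∀ᵐ ω ∂(Measure.infinitePi fun _ : ℕ => P), (z, ω) ∉ B) := by
  set Q := Measure.infinitePi fun _ : ℕ => P with hQ
  have hsec : ∀ z, MeasurableSet {ω | (z, ω) ∈ B} := fun z => measurable_prodMk_left hB
  set h : Z → ℝ≥0∞ := fun z => Q {ω | (z, ω) ∈ B} with hh
  have hhm : Measurable h := measurable_measure_prodMk_left hB
  have hcons : ∀ z w ω, (z, consSeq w ω) ∈ B ↔ (f w z, ω) ∈ B := by
    intro z w ω
    conv_lhs => rw [← hinv]
    rfl
  have hharm : ∀ z, ∫⁻ w, h (f w z) ∂P = h z := by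
    intro z
    rw [hh, hQ]
    beta_reduce
    rw [infinitePi_apply_eq_lintegral P (hsec z)]
    refine lintegral_congr fun w => ?_
    simp only [mem_ofPred_eq, hcons]
  have hconst : ∀ z, h z = ∫⁻ z, h z ∂ν := by
    intro z
    obtain ⟨ν', h1, h2, h3⟩ := exists_stationary_lintegral_eq hf hm z
    rw [← huniq ν' h1 h2, h3 h hhm (fun z => prob_le_one) hharm]
  set p := ∫⁻ z, h z ∂ν with hp
  have hbox : ∀ (n : ℕ) (t : ℕ → Set W), (∀ i, MeasurableSet (t i)) → ∀ z,
      Q ({ω | (z, ω) ∈ B} ∩ {ω | ∀ i < n, ω i ∈ t i}) = p * ∏ i ∈ Finset.range n, P (t i) := by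
    intro n
    induction n with
    | zero =>
      intro t _ z
      simpa using hconst z
    | succ n ih =>
      intro t ht z
      have hboxm : MeasurableSet {ω : ℕ → W | ∀ i < n + 1, ω i ∈ t i} := by
        simp only [ofPred_forall]
        exact MeasurableSet.iInter fun i => MeasurableSet.iInter fun _ =>
          (ht i).preimage (measurable_pi_apply i)
      rw [hQ, infinitePi_apply_eq_lintegral P ((hsec z).inter hboxm), ← hQ]
      have h1 : ∀ w, Q {ω | consSeq w ω ∈ {ω | (z, ω) ∈ B} ∩ {ω | ∀ i < n + 1, ω i ∈ t i}} =
          (t 0).indicator (fun _ => p * ∏ i ∈ Finset.range n, P (t (i + 1))) w := by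
        intro w
        by_cases hw : w ∈ t 0
        · rw [indicator_of_mem hw, ← ih (fun i => t (i + 1)) (fun i => ht _) (f w z)]
          congr 1
          ext ω
          simp only [mem_ofPred_eq, mem_inter_iff, hcons]
          refine and_congr_right fun _ => ⟨fun H i hi => H (i + 1) (by omega), fun H i hi => ?_⟩
          cases i with
          | zero => exact hw
          | succ i => exact H i (by omega)
        · rw [indicator_of_notMem hw]
          convert measure_empty (μ := Q)
          refine eq_empty_of_forall_notMem fun ω hω => hw ?_
          exact hω.2 0 (by omega)
      simp only [h1]
      rw [lintegral_indicator_const (ht 0), Finset.prod_range_succ', mul_assoc]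
  rcases eq_or_ne p 0 with hp0 | hp0
  · right
    intro z
    have := hconst z
    rw [hp0] at this
    rw [ae_iff]
    simpa [hh] using this
  · left
    intro z
    have hp1 : p ≠ ⊤ := by
      rw [← hconst z]
      exact measure_ne_top _ _
    have heq : p⁻¹ • Q.restrict {ω | (z, ω) ∈ B} = Q := by
      refine eq_infinitePi_of_range P fun n t ht => ?_
      have hboxm : MeasurableSet {ω : ℕ → W | ∀ i < n, ω i ∈ t i} := by
        simp only [ofPred_forall]
        exact MeasurableSet.iInter fun i => MeasurableSet.iInter fun _ =>
          (ht i).preimage (measurable_pi_apply i)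
      rw [Measure.smul_apply, Measure.restrict_apply hboxm, inter_comm, hbox n t ht z,
        smul_eq_mul, ← mul_assoc, ENNReal.inv_mul_cancel hp0 hp1, one_mul]
    rw [ae_iff]
    have : {ω | ¬(z, ω) ∈ B} = {ω | (z, ω) ∈ B}ᶜ := rfl
    rw [this]
    conv_lhs => rw [← heq]
    rw [Measure.smul_apply, Measure.restrict_apply (hsec z).compl, compl_inter_self]
    simp

theorem measurePreserving_skewShift (hf : Measurable fun p : Z × W => f p.2 p.1)
    {ν : Measure Z} [IsProbabilityMeasure ν] (hν : stepLaw f P ν = ν) :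
    MeasurePreserving (skewShift f) (ν.prod (Measure.infinitePi fun _ : ℕ => P))
      (ν.prod (Measure.infinitePi fun _ : ℕ => P)) := by
  refine ⟨measurable_skewShift hf, ?_⟩
  refine Measure.ext_of_lintegral _ fun φ hφ => ?_
  have hφ' := hφ.comp (measurable_skewShift hf)
  rw [lintegral_map hφ (measurable_skewShift hf),
    lintegral_prod (fun x => φ (skewShift f x)) hφ'.aemeasurable,
    lintegral_prod _ hφ.aemeasurable]
  have h1 : ∀ z, ∫⁻ ω, φ (skewShift f (z, ω)) ∂(Measure.infinitePi fun _ : ℕ => P) =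
      ∫⁻ w, ∫⁻ ω, φ (f w z, ω) ∂(Measure.infinitePi fun _ : ℕ => P) ∂P := by
    intro z
    conv_lhs => rw [← map_consSeq_infinitePi P]
    have hφz : Measurable fun ω => φ (skewShift f (z, ω)) := hφ'.comp measurable_prodMk_left
    rw [lintegral_map hφz measurable_consSeq,
      lintegral_prod (fun p : W × (ℕ → W) => φ (skewShift f (z, consSeq p.1 p.2)))
        (hφz.comp measurable_consSeq).aemeasurable]
    rfl
  simp only [h1]
  have h2 : Measurable fun z => ∫⁻ ω, φ (z, ω) ∂(Measure.infinitePi fun _ : ℕ => P) :=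
    hφ.lintegral_prod_right'
  rw [← lintegral_stepLaw hf ν h2, hν]

theorem ergodic_skewShift (hf : Measurable fun p : Z × W => f p.2 p.1)
    {m : Measure Z} [IsFiniteMeasure m] (hm : ∀ z, P.map (fun w => f w z) ≤ m)
    {ν : Measure Z} [IsProbabilityMeasure ν] (hν : stepLaw f P ν = ν)
    (huniq : ∀ ν' : Measure Z, IsProbabilityMeasure ν' → stepLaw f P ν' = ν' → ν' = ν) :
    Ergodic (skewShift f) (ν.prod (Measure.infinitePi fun _ : ℕ => P)) := by
  refine ⟨measurePreserving_skewShift hf hν, ⟨fun B hB hinv => ?_⟩⟩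
  rw [eventuallyConst_set']
  rcases forall_ae_mem_or_forall_ae_notMem hf hm huniq hB hinv with h | h
  · right
    rw [eventuallyEq_univ]
    exact Measure.ae_prod_mem_iff_ae_ae_mem hB |>.2 (Eventually.of_forall h)
  · left
    rw [eventuallyEq_empty]
    exact Measure.ae_prod_mem_iff_ae_ae_mem hB.compl |>.2 (Eventually.of_forall h)

/-- A property that holds almost surely for the stationary process eventually holds along almost
every orbit from every initial point. -/
theorem forall_ae_eventually_iterate (hf : Measurable fun p : Z × W => f p.2 p.1)
    {m : Measure Z} [IsFiniteMeasure m] (hm : ∀ z, P.map (fun w => f w z) ≤ m)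
    {ν : Measure Z} [IsProbabilityMeasure ν] (hν : stepLaw f P ν = ν)
    (huniq : ∀ ν' : Measure Z, IsProbabilityMeasure ν' → stepLaw f P ν' = ν' → ν' = ν)
    {p : Z × (ℕ → W) → Prop} (hp : ∀ᵐ x ∂(ν.prod (Measure.infinitePi fun _ : ℕ => P)), p x)
    (z : Z) :
    ∀ᵐ ω ∂(Measure.infinitePi fun _ : ℕ => P),
      ∀ᶠ n in atTop, p ((skewShift f)^[n] (z, ω)) := by
  obtain ⟨C, hCp, hCm, hC0⟩ : ∃ C : Set (Z × (ℕ → W)), (∀ x ∈ C, p x) ∧ MeasurableSet C ∧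
      ∀ᵐ x ∂(ν.prod (Measure.infinitePi fun _ : ℕ => P)), x ∈ C := by
    obtain ⟨D, hD, hDm, hD0⟩ := exists_measurable_superset_of_null (ae_iff.1 hp)
    exact ⟨Dᶜ, fun x hx => by by_contra h; exact hx (hD h), hDm.compl, by
      rw [ae_iff]; simpa using hD0⟩
  set B : Set (Z × (ℕ → W)) := {x | ∀ᶠ n in atTop, (skewShift f)^[n] x ∈ C} with hBdef
  have hBm : MeasurableSet B := by
    have : B = ⋃ N : ℕ, ⋂ n ≥ N, (skewShift f)^[n] ⁻¹' C := by
      ext x; simp [hBdef, eventually_atTop]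
    rw [this]
    exact MeasurableSet.iUnion fun N => MeasurableSet.iInter fun n => MeasurableSet.iInter fun _ =>
      hCm.preimage ((measurable_skewShift hf).iterate n)
  have hBinv : skewShift f ⁻¹' B = B := by
    ext x
    simp only [hBdef, mem_preimage, mem_ofPred_eq, ← Function.iterate_succ_apply]
    conv_rhs => rw [← map_add_atTop_eq_nat 1]
    exact Iff.rfl
  rcases forall_ae_mem_or_forall_ae_notMem hf hm huniq hBm hBinv with h | h
  · filter_upwards [h z] with ω hω
    exact hω.mono fun n hn => hCp _ hn
  · exfalso
    have hall : ∀ᵐ x ∂(ν.prod (Measure.infinitePi fun _ : ℕ => P)), x ∈ B := by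
      have := ae_all_iff.2 fun i : ℕ =>
        ((measurePreserving_skewShift hf hν).iterate i).quasiMeasurePreserving.ae hC0
      filter_upwards [this] with x hx
      exact Eventually.of_forall hx
    have hnone : ∀ᵐ x ∂(ν.prod (Measure.infinitePi fun _ : ℕ => P)), x ∉ B :=
      Measure.ae_prod_mem_iff_ae_ae_mem hBm.compl |>.2 (Eventually.of_forall h)
    obtain ⟨x, hx1, hx2⟩ := (hall.and hnone).exists
    exact hx2 hx1

/-- From every initial point, almost every orbit stays in a set of full measure after time `0`. -/
theorem forall_ae_orbit_succ_mem (hf : Measurable fun p : Z × W => f p.2 p.1)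
    {m : Measure Z} (hm : ∀ z, P.map (fun w => f w z) ≤ m)
    {G : Set Z} (hG : ∀ᵐ z ∂m, z ∈ G) (z : Z) :
    ∀ᵐ ω ∂(Measure.infinitePi fun _ : ℕ => P), ∀ n, orbit f z ω (n + 1) ∈ G := by
  obtain ⟨D, hD, hDm, hD0⟩ := exists_measurable_superset_of_null (ae_iff.1 hG)
  have hstep : ∀ z, ∀ᵐ w ∂P, f w z ∉ D := by
    intro z
    have hfz : Measurable fun w => f w z := hf.comp measurable_prodMk_left
    have h1 : P.map (fun w => f w z) D = 0 := le_antisymm ((hm z D).trans hD0.le) zero_le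
    rw [Measure.map_apply hfz hDm] at h1
    rw [ae_iff]
    simp only [not_not]
    exact h1
  have key : ∀ n z, ∀ᵐ ω ∂(Measure.infinitePi fun _ : ℕ => P), orbit f z ω (n + 1) ∉ D := by
    have hmeas : ∀ n z, MeasurableSet {ω : ℕ → W | orbit f z ω (n + 1) ∈ D} := fun n z =>
      hDm.preimage ((measurable_orbit hf (n + 1)).comp measurable_prodMk_left)
    have horb : ∀ n z w ω, orbit f z (consSeq w ω) (n + 1) = orbit f (f w z) ω n := by
      intro n z w ω
      induction n with
      | zero => rfl
      | succ n ih => rw [orbit, ih]; rfl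
    intro n
    induction n with
    | zero =>
      intro z
      rw [ae_iff]
      simp only [not_not]
      rw [infinitePi_apply_eq_lintegral P (hmeas 0 z), lintegral_eq_zero_iff' (by
        exact (measurable_measure_prodMk_left (measurable_consSeq (hmeas 0 z))).aemeasurable)]
      filter_upwards [hstep z] with w hw
      have : {ω : ℕ → W | orbit f z (consSeq w ω) (0 + 1) ∈ D} = ∅ :=
        eq_empty_of_forall_notMem fun ω hω => hw hω
      rw [this, measure_empty, Pi.zero_apply]
    | succ n ih =>
      intro z
      rw [ae_iff]
      simp only [not_not]
      rw [infinitePi_apply_eq_lintegral P (hmeas (n + 1) z)]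
      rw [lintegral_eq_zero_iff' (by
        exact (measurable_measure_prodMk_left (measurable_consSeq (hmeas (n + 1) z))).aemeasurable)]
      refine Eventually.of_forall fun w => ?_
      have := ae_iff.1 (ih (f w z))
      simp only [not_not] at this
      simp only [mem_ofPred_eq, horb]
      exact this
  filter_upwards [ae_all_iff.2 fun n => key n z] with ω hω n
  by_contra h
  exact hω n (hD h)

end SkewShift

section Compound

variable {ι : Type*} [Fintype ι]

/-- The sum of the squares of all `k × k` minors. -/
def minorSq (k : ℕ) (X : Matrix ι ι ℝ) : ℝ :=
  ∑ I : Fin k → ι, ∑ J : Fin k → ι, (X.submatrix I J).det ^ 2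

theorem minorSq_le_of_entries (k : ℕ) {X : Matrix ι ι ℝ} {a : ℝ} (h : ∀ i j, |X i j| ≤ a) :
    minorSq k X ≤
      (Fintype.card (Fin k → ι) : ℝ) * Fintype.card (Fin k → ι) * (k.factorial * a ^ k) ^ 2 := by
  have h1 : ∀ I J : Fin k → ι, (X.submatrix I J).det ^ 2 ≤ (k.factorial * a ^ k) ^ 2 := by
    intro I J
    have := Matrix.det_le (abv := AbsoluteValue.abs) (A := X.submatrix I J) (x := a)
      fun i j => h _ _
    rw [nsmul_eq_mul, Fintype.card_fin] at this
    exact sq_le_sq' (by linarith [neg_abs_le (X.submatrix I J).det, show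
      |(X.submatrix I J).det| ≤ _ from this]) ((le_abs_self _).trans this)
  calc _ ≤ ∑ I : Fin k → ι, ∑ J : Fin k → ι, ((k.factorial * a ^ k) ^ 2 : ℝ) :=
        Finset.sum_le_sum fun I _ => Finset.sum_le_sum fun J _ => h1 I J
    _ = _ := by
        simp only [Finset.sum_const, Finset.card_univ, nsmul_eq_mul]
        ring

variable [DecidableEq ι]

/-- The Cauchy–Binet formula, with the sum taken over all tuples of indices. -/
theorem factorial_mul_det_submatrix_mul {k : ℕ} (X Y : Matrix ι ι ℝ) (I J : Fin k → ι) :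
    (k.factorial : ℝ) * ((X * Y).submatrix I J).det =
      ∑ K : Fin k → ι, (X.submatrix I K).det * (Y.submatrix K J).det := by
  have h1 : ((X * Y).submatrix I J).det =
      ∑ K : Fin k → ι, (∏ i, X (I i) (K i)) * (Y.submatrix K J).det := by
    have : ((X * Y).submatrix I J) = fun i => ∑ l, X (I i) l •
        fun j => Y l (J j) := by
      ext i j
      simp [Matrix.mul_apply, Finset.sum_apply]
    rw [this]
    refine (Matrix.detRowAlternating.toMultilinearMap.map_sum _).trans ?_
    refine Finset.sum_congr rfl fun K _ => ?_
    exact Matrix.detRowAlternating.toMultilinearMap.map_smul_univ _ _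
  have h2 : ∀ τ : Equiv.Perm (Fin k), ∑ K : Fin k → ι,
      (((Equiv.Perm.sign τ : ℤ) : ℝ) * ∏ i, X (I i) (K (τ i))) *
        (Y.submatrix K J).det = ((X * Y).submatrix I J).det := by
    intro τ
    rw [h1]
    refine Fintype.sum_equiv (Equiv.arrowCongr τ.symm (Equiv.refl ι)) _ _ fun K => ?_
    have e : (Equiv.arrowCongr τ.symm (Equiv.refl ι)) K = K ∘ τ := by
      ext i; simp [Equiv.arrowCongr]
    rw [e]
    have : (Y.submatrix (K ∘ τ) J).det =
        ((Equiv.Perm.sign τ : ℤ) : ℝ) * (Y.submatrix K J).det := by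
      rw [← Matrix.det_permute, Matrix.submatrix_submatrix]
      rfl
    rw [this]
    simp only [Function.comp_apply]
    ring
  have h3 : ∀ K : Fin k → ι, (X.submatrix I K).det =
      ∑ τ : Equiv.Perm (Fin k), ((Equiv.Perm.sign τ : ℤ) : ℝ) * ∏ i, X (I i) (K (τ i)) := by
    intro K
    rw [← Matrix.det_transpose, Matrix.det_apply']
    rfl
  simp only [h3, Finset.sum_mul]
  rw [Finset.sum_comm]
  simp only [h2, Finset.sum_const, Finset.card_univ, Fintype.card_perm, Fintype.card_fin,
    nsmul_eq_mul]

/-- The sum of all principal `k × k` minors, over tuples of indices. -/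
def principalMinorSum (k : ℕ) (X : Matrix ι ι ℝ) : ℝ :=
  ∑ J : Fin k → ι, (X.submatrix J J).det

theorem minorSq_mul_le (k : ℕ) (X Y : Matrix ι ι ℝ) :
    minorSq k (X * Y) ≤ minorSq k X * minorSq k Y := by
  have hk : (1 : ℝ) ≤ k.factorial := by exact_mod_cast Nat.one_le_iff_ne_zero.2 k.factorial_ne_zero
  have h1 : ∀ I J : Fin k → ι, ((X * Y).submatrix I J).det ^ 2 ≤
      (∑ K, (X.submatrix I K).det ^ 2) * ∑ K, (Y.submatrix K J).det ^ 2 := by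
    intro I J
    calc ((X * Y).submatrix I J).det ^ 2
        ≤ ((k.factorial : ℝ) * ((X * Y).submatrix I J).det) ^ 2 := by
          rw [mul_pow]
          exact le_mul_of_one_le_left (sq_nonneg _) (one_le_pow₀ hk)
      _ ≤ _ := by
          rw [factorial_mul_det_submatrix_mul]
          exact Finset.sum_mul_sq_le_sq_mul_sq _ _ _
  calc minorSq k (X * Y) ≤ ∑ I : Fin k → ι, ∑ J : Fin k → ι,
        (∑ K, (X.submatrix I K).det ^ 2) * ∑ K, (Y.submatrix K J).det ^ 2 :=
        Finset.sum_le_sum fun I _ => Finset.sum_le_sum fun J _ => h1 I J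
    _ = _ := by
        simp only [← Finset.mul_sum, ← Finset.sum_mul]
        rw [minorSq, minorSq, Finset.sum_comm (f := fun I J => (Y.submatrix I J).det ^ 2)]

theorem principalMinorSum_mul_comm (k : ℕ) (X Y : Matrix ι ι ℝ) :
    principalMinorSum k (X * Y) = principalMinorSum k (Y * X) := by
  have hk : (k.factorial : ℝ) ≠ 0 := by exact_mod_cast k.factorial_ne_zero
  refine mul_left_cancel₀ hk ?_
  simp only [principalMinorSum, Finset.mul_sum, factorial_mul_det_submatrix_mul]
  rw [Finset.sum_comm]
  simp only [mul_comm]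

theorem minorSq_eq (k : ℕ) (X : Matrix ι ι ℝ) :
    minorSq k X = k.factorial * principalMinorSum k (X.transpose * X) := by
  simp only [principalMinorSum, Finset.mul_sum, factorial_mul_det_submatrix_mul, minorSq]
  rw [Finset.sum_comm]
  refine Finset.sum_congr rfl fun J _ => Finset.sum_congr rfl fun K _ => ?_
  rw [← Matrix.transpose_submatrix, Matrix.det_transpose, sq]

theorem principalMinorSum_diagonal (k : ℕ) (e : ι → ℝ) :
    principalMinorSum k (Matrix.diagonal e) =
      ∑ J : Fin k → ι, open Classical in if Function.Injective J then ∏ i, e (J i) else 0 := by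
  refine Finset.sum_congr rfl fun J _ => ?_
  split_ifs with hJ
  · rw [Matrix.submatrix_diagonal _ _ hJ, Matrix.det_diagonal]
    rfl
  · simp only [Function.Injective, not_forall] at hJ
    obtain ⟨a, b, hab, hne⟩ := hJ
    refine Matrix.det_zero_of_row_eq hne ?_
    ext j
    simp [hab]

end Compound

section Singular

theorem prod_le_prod_range_card {e : ℕ → ℝ} (he : Antitone e) (he0 : ∀ i, 0 ≤ e i)
    (s : Finset ℕ) : ∏ i ∈ s, e i ≤ ∏ i ∈ Finset.range s.card, e i := by
  induction s using Finset.induction_on_max with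
  | empty => simp
  | insert a s has ih =>
    have ha : a ∉ s := fun h => lt_irrefl _ (has a h)
    rw [Finset.prod_insert ha, Finset.card_insert_of_notMem ha, Finset.prod_range_succ, mul_comm]
    have hcard : s.card ≤ a := by
      have : s ⊆ Finset.range a := fun i hi => Finset.mem_range.2 (has i hi)
      simpa using Finset.card_le_card this
    exact mul_le_mul ih (he hcard) (he0 _) (Finset.prod_nonneg fun _ _ => he0 _)

theorem prod_comp_le_prod_range {e : ℕ → ℝ} (he : Antitone e) (he0 : ∀ i, 0 ≤ e i)
    {k : ℕ} {J : Fin k → ℕ} (hJ : Function.Injective J) :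
    ∏ i, e (J i) ≤ ∏ i ∈ Finset.range k, e i := by
  have h := prod_le_prod_range_card he he0 (Finset.univ.map ⟨J, hJ⟩)
  rw [Finset.prod_map, Finset.card_map, Finset.card_univ, Fintype.card_fin] at h
  exact h

variable {m : ℕ}

/-- The matrix of a linear endomorphism in the standard basis. -/
def stdMatrix (A : EuclideanSpace ℝ (Fin m) →ₗ[ℝ] EuclideanSpace ℝ (Fin m)) :
    Matrix (Fin m) (Fin m) ℝ :=
  LinearMap.toMatrixOrthonormal (EuclideanSpace.basisFun (Fin m) ℝ) A

theorem stdMatrix_comp (A B : EuclideanSpace ℝ (Fin m) →ₗ[ℝ] EuclideanSpace ℝ (Fin m)) :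
    stdMatrix (A ∘ₗ B) = stdMatrix A * stdMatrix B :=
  map_mul (LinearMap.toMatrixOrthonormal (EuclideanSpace.basisFun (Fin m) ℝ)) A B

theorem stdMatrix_apply (A : EuclideanSpace ℝ (Fin m) →ₗ[ℝ] EuclideanSpace ℝ (Fin m))
    (i j : Fin m) : stdMatrix A i j = A (EuclideanSpace.basisFun (Fin m) ℝ j) i := by
  rw [stdMatrix, LinearMap.toMatrixOrthonormal_apply_apply, ← OrthonormalBasis.repr_apply_apply]
  rfl

theorem minorSq_stdMatrix (k : ℕ)
    (A : EuclideanSpace ℝ (Fin m) →ₗ[ℝ] EuclideanSpace ℝ (Fin m)) :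
    minorSq k (stdMatrix A) = k.factorial * ∑ J : Fin k → Fin m,
      open Classical in if Function.Injective J then ∏ i, A.singularValues (J i) ^ 2 else 0 := by
  have hn : Module.finrank ℝ (EuclideanSpace ℝ (Fin m)) = m := by simp
  have h1 : (stdMatrix A).transpose * stdMatrix A = stdMatrix (LinearMap.adjoint A ∘ₗ A) := by
    rw [stdMatrix_comp]
    congr 1
    have := map_star (LinearMap.toMatrixOrthonormal (EuclideanSpace.basisFun (Fin m) ℝ)) A
    rw [LinearMap.star_eq_adjoint] at this
    rw [stdMatrix, stdMatrix, this, Matrix.star_eq_conjTranspose,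
      Matrix.conjTranspose_eq_transpose_of_trivial]
  set S := LinearMap.adjoint A ∘ₗ A with hS
  have hsymm : S.IsSymmetric := A.isSymmetric_adjoint_comp_self
  set b := (hsymm.eigenvectorBasis hn).toBasis with hb
  set b₀ := (EuclideanSpace.basisFun (Fin m) ℝ).toBasis with hb₀
  have h2 : stdMatrix S = b₀.toMatrix b * LinearMap.toMatrix b b S * b.toMatrix b₀ := by
    rw [basis_toMatrix_mul_linearMap_toMatrix_mul_basis_toMatrix]
    rfl
  rw [minorSq_eq, h1, h2, principalMinorSum_mul_comm, ← Matrix.mul_assoc,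
    Module.Basis.toMatrix_mul_toMatrix_flip, Matrix.one_mul, hsymm.toMatrix_eigenvectorBasis hn,
    principalMinorSum_diagonal]
  congr 1
  refine Finset.sum_congr rfl fun J _ => ?_
  split_ifs with hJ
  · refine Finset.prod_congr rfl fun i _ => ?_
    rw [A.sq_singularValues_fin hn]
    rfl
  · rfl

theorem prod_singularValues_sq_le_minorSq {k : ℕ} (hk : k ≤ m)
    (A : EuclideanSpace ℝ (Fin m) →ₗ[ℝ] EuclideanSpace ℝ (Fin m)) :
    ∏ i ∈ Finset.range k, A.singularValues i ^ 2 ≤ minorSq k (stdMatrix A) := by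
  classical
  have hf : (1 : ℝ) ≤ k.factorial := by exact_mod_cast Nat.one_le_iff_ne_zero.2 k.factorial_ne_zero
  have hnn : ∀ J : Fin k → Fin m,
      0 ≤ if Function.Injective J then ∏ i, A.singularValues (J i) ^ 2 else 0 := by
    intro J
    split_ifs
    · exact Finset.prod_nonneg fun _ _ => sq_nonneg _
    · exact le_rfl
  have h1 := Finset.single_le_sum (f := fun J : Fin k → Fin m =>
    if Function.Injective J then ∏ i, A.singularValues (J i) ^ 2 else 0)
    (fun J _ => hnn J) (Finset.mem_univ (Fin.castLE hk))
  simp only [Fin.castLE_injective, if_true, Fin.val_castLE] at h1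
  rw [minorSq_stdMatrix, Finset.prod_range]
  refine h1.trans ?_
  convert le_mul_of_one_le_left (Finset.sum_nonneg fun J _ => hnn J) hf

theorem minorSq_le_prod_singularValues_sq {k : ℕ}
    (A : EuclideanSpace ℝ (Fin m) →ₗ[ℝ] EuclideanSpace ℝ (Fin m)) :
    minorSq k (stdMatrix A) ≤
      k.factorial * (m ^ k : ℝ) * ∏ i ∈ Finset.range k, A.singularValues i ^ 2 := by
  classical
  have hanti : Antitone fun i => A.singularValues i ^ 2 := fun i j hij =>
    pow_le_pow_left₀ (A.singularValues_nonneg _) (A.singularValues_antitone hij) 2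
  rw [minorSq_stdMatrix, mul_assoc]
  gcongr
  calc _ ≤ ∑ J : Fin k → Fin m, ∏ i ∈ Finset.range k, A.singularValues i ^ 2 := by
        refine Finset.sum_le_sum fun J _ => ?_
        split_ifs with hJ
        · exact prod_comp_le_prod_range hanti (fun _ => sq_nonneg _)
            (J := fun i => (J i : ℕ)) (Fin.val_injective.comp hJ)
        · exact Finset.prod_nonneg fun _ _ => sq_nonneg _
    _ = _ := by
        simp

theorem singularValues_pos_of_injective
    {A : EuclideanSpace ℝ (Fin m) →ₗ[ℝ] EuclideanSpace ℝ (Fin m)} (hA : Function.Injective A)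
    {i : ℕ} (hi : i < m) : 0 < A.singularValues i :=
  A.injective_iff_forall_lt_finrank_singularValues_pos.1 hA i (by simpa using hi)

theorem minorSq_stdMatrix_pos {k : ℕ} (hk : k ≤ m)
    {A : EuclideanSpace ℝ (Fin m) →ₗ[ℝ] EuclideanSpace ℝ (Fin m)} (hA : Function.Injective A) :
    0 < minorSq k (stdMatrix A) := by
  refine lt_of_lt_of_le (Finset.prod_pos fun i hi => ?_) (prod_singularValues_sq_le_minorSq hk A)
  exact pow_pos (singularValues_pos_of_injective hA ((Finset.mem_range.1 hi).trans_le hk)) 2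

theorem abs_stdMatrix_le (A : EuclideanSpace ℝ (Fin m) →L[ℝ] EuclideanSpace ℝ (Fin m))
    (i j : Fin m) : |stdMatrix A.toLinearMap i j| ≤ ‖A‖ := by
  rw [stdMatrix_apply, ← Real.norm_eq_abs]
  refine (PiLp.norm_apply_le _ i).trans ((A.le_opNorm _).trans ?_)
  simp

theorem exists_log_minorSq_le (k : ℕ) : ∃ C : ℝ, 0 ≤ C ∧
    ∀ A : EuclideanSpace ℝ (Fin m) →L[ℝ] EuclideanSpace ℝ (Fin m),
      0 < minorSq k (stdMatrix A.toLinearMap) →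
      Real.log (minorSq k (stdMatrix A.toLinearMap)) ≤ C + 2 * k * Real.posLog ‖A‖ := by
  set D : ℝ := (Fintype.card (Fin k → Fin m) : ℝ) * Fintype.card (Fin k → Fin m) *
    (k.factorial : ℝ) ^ 2 with hD
  refine ⟨|Real.log D|, abs_nonneg _, fun A hA => ?_⟩
  have h1 := minorSq_le_of_entries k (abs_stdMatrix_le A)
  have h2 : (Fintype.card (Fin k → Fin m) : ℝ) * Fintype.card (Fin k → Fin m) *
      (k.factorial * ‖A‖ ^ k) ^ 2 = D * ‖A‖ ^ (2 * k) := by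
    rw [hD]; ring
  rw [h2] at h1
  have h3 : 0 < D * ‖A‖ ^ (2 * k) := hA.trans_le h1
  have hDp : D ≠ 0 := fun h => by rw [h, zero_mul] at h3; exact lt_irrefl _ h3
  have hAp : ‖A‖ ^ (2 * k) ≠ 0 := fun h => by rw [h, mul_zero] at h3; exact lt_irrefl _ h3
  refine (Real.log_le_log hA h1).trans ?_
  rw [Real.log_mul hDp hAp, Real.log_pow]
  push_cast
  gcongr
  · exact le_abs_self _
  · exact le_max_right _ _

end Singular

section ERealLimits

/-- Growth rates are not affected by a shift of time and a bounded perturbation. -/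
theorem tendsto_coe_div_of_abs_sub_le {a b : ℕ → ℝ} {K : ℝ} {n₀ : ℕ}
    (hab : ∀ j, |b (j + n₀) - a j| ≤ K) {γ : EReal} (hγ : γ < ⊤)
    (ha : Tendsto (fun n : ℕ => ((a n / n : ℝ) : EReal)) atTop (𝓝 γ)) :
    Tendsto (fun n : ℕ => ((b n / n : ℝ) : EReal)) atTop (𝓝 γ) := by
  rw [← tendsto_add_atTop_iff_nat n₀]
  induction γ with
  | top => exact absurd hγ (lt_irrefl _)
  | bot =>
    rw [EReal.tendsto_nhds_bot_iff_real] at ha ⊢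
    intro c
    filter_upwards [ha (c - 1), eventually_gt_atTop 0,
      tendsto_natCast_atTop_atTop.eventually_gt_atTop (K - c * n₀)] with j h1 h2 h3
    have h2' : (0 : ℝ) < j := by exact_mod_cast h2
    have h1' : a j / j < c - 1 := by exact_mod_cast h1
    rw [div_lt_iff₀ h2'] at h1'
    rw [EReal.coe_lt_coe_iff, div_lt_iff₀ (by push_cast; positivity)]
    have := (abs_le.1 (hab j)).2
    push_cast
    linarith
  | coe g =>
    rw [EReal.tendsto_coe] at ha ⊢
    have h1 : Tendsto (fun j : ℕ => (j : ℝ) / ((j : ℝ) + n₀)) atTop (𝓝 1) :=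
      tendsto_natCast_div_add_atTop (n₀ : ℝ)
    have h2 : Tendsto (fun j : ℕ => (b (j + n₀) - a j) / ((j + n₀ : ℕ) : ℝ)) atTop (𝓝 0) := by
      have h3 : Tendsto (fun j : ℕ => K / ((j + n₀ : ℕ) : ℝ)) atTop (𝓝 0) :=
        (tendsto_const_div_atTop_nhds_zero_nat K).comp (tendsto_add_atTop_nat n₀)
      refine squeeze_zero_norm (fun j => ?_) h3
      rw [Real.norm_eq_abs, abs_div, Nat.abs_cast]
      gcongr
      exact hab j
    have h4 := (ha.mul h1).add h2
    rw [mul_one, add_zero] at h4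
    refine h4.congr' ?_
    filter_upwards [eventually_gt_atTop 0] with j hj
    have hj' : (0 : ℝ) < j := by exact_mod_cast hj
    push_cast
    field_simp
    ring

/-- The exponents determined by the growth rates of the partial products. -/
def exponentOfSums (Γ : ℕ → EReal) (i : ℕ) : EReal :=
  open Classical in if Γ i = ⊥ then ⊥ else Γ (i + 1) - Γ i

theorem exponentOfSums_lt_top {Γ : ℕ → EReal} {i : ℕ} (h : Γ (i + 1) < ⊤) :
    exponentOfSums Γ i < ⊤ := by
  rw [exponentOfSums]
  split_ifs with h'
  · exact bot_lt_top
  · rw [sub_eq_add_neg]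
    refine EReal.add_lt_top h.ne ?_
    rwa [Ne, EReal.neg_eq_top_iff]

theorem tendsto_exponentOfSums {m : ℕ} {s : ℕ → ℕ → ℝ} {Γ : ℕ → EReal}
    (hs : ∀ n i j, i ≤ j → j < m → s j n ≤ s i n)
    (hΓt : ∀ k ≤ m, Γ k < ⊤)
    (hΓ : ∀ k ≤ m, Tendsto (fun n => ((∑ i ∈ Finset.range k, s i n : ℝ) : EReal)) atTop (𝓝 (Γ k)))
    {i : ℕ} (hi : i < m) :
    Tendsto (fun n => ((s i n : ℝ) : EReal)) atTop (𝓝 (exponentOfSums Γ i)) := by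
  rw [exponentOfSums]
  split_ifs with h
  · have h0 := hΓ i hi.le
    rw [h, EReal.tendsto_nhds_bot_iff_real] at h0
    rw [EReal.tendsto_nhds_bot_iff_real]
    intro c
    have hi0 : 0 < i := by
      rcases Nat.eq_zero_or_pos i with rfl | hi0
      · have h1 := hΓ 0 (Nat.zero_le _)
        simp only [Finset.range_zero, Finset.sum_empty] at h1
        have := tendsto_nhds_unique h1 tendsto_const_nhds
        rw [h] at this
        exact absurd this EReal.bot_ne_zero
      · exact hi0
    filter_upwards [h0 (i * c)] with n hn
    have hn' : ∑ j ∈ Finset.range i, s j n < i * c := by exact_mod_cast hn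
    have h2 : (i : ℝ) * s i n ≤ ∑ j ∈ Finset.range i, s j n := by
      have := Finset.card_nsmul_le_sum (Finset.range i) (fun j => s j n) (s i n)
        fun j hj => hs n j i (Finset.mem_range.1 hj).le hi
      rwa [Finset.card_range, nsmul_eq_mul] at this
    rw [EReal.coe_lt_coe_iff]
    have hi' : (0 : ℝ) < i := by exact_mod_cast hi0
    exact lt_of_mul_lt_mul_left (h2.trans_lt hn') hi'.le
  · have h1 := hΓ (i + 1) hi
    have h2 := hΓ i hi.le
    have hr : Γ i = ((Γ i).toReal : EReal) := (EReal.coe_toReal (hΓt i hi.le).ne h).symm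
    have h3 : Tendsto (fun n => ((-∑ j ∈ Finset.range i, s j n : ℝ) : EReal)) atTop
        (𝓝 (-Γ i)) := by
      simp only [EReal.coe_neg]
      exact (continuous_neg.tendsto _).comp h2
    have h4 := (EReal.continuousAt_add (p := (Γ (i + 1), -Γ i))
      (Or.inl (hΓt _ hi).ne)
      (Or.inr (by rw [Ne, EReal.neg_eq_top_iff]; exact h))).tendsto.comp (h1.prodMk_nhds h3)
    rw [sub_eq_add_neg]
    refine h4.congr fun n => ?_
    simp only [Function.comp_apply]
    rw [← EReal.coe_add, Finset.sum_range_succ]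
    congr 1
    ring

end ERealLimits

section Cocycle

variable {Z W : Type*} {m : ℕ} {f : W → Z → Z}
  {A : Z → EuclideanSpace ℝ (Fin m) →L[ℝ] EuclideanSpace ℝ (Fin m)}

/-- The product of the matrices `A` along a random orbit. -/
def cocycle (f : W → Z → Z) (A : Z → EuclideanSpace ℝ (Fin m) →L[ℝ] EuclideanSpace ℝ (Fin m))
    (p : Z × (ℕ → W)) : ℕ → EuclideanSpace ℝ (Fin m) →L[ℝ] EuclideanSpace ℝ (Fin m)
  | 0 => ContinuousLinearMap.id ℝ _
  | n + 1 => (A (orbit f p.1 p.2 n)).comp (cocycle f A p n)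

theorem cocycle_add (p : Z × (ℕ → W)) (n j : ℕ) :
    cocycle f A p (n + j) = (cocycle f A ((skewShift f)^[n] p) j).comp (cocycle f A p n) := by
  induction j with
  | zero => rfl
  | succ j ih =>
    rw [← add_assoc, cocycle, ih, cocycle, ContinuousLinearMap.comp_assoc]
    congr 2
    have h1 := skewShift_iterate f (n + j) p.1 p.2
    have h2 := skewShift_iterate f j ((skewShift f)^[n] p).1 ((skewShift f)^[n] p).2
    rw [Prod.mk.eta, add_comm, Function.iterate_add_apply] at h1
    rw [Prod.mk.eta, h1] at h2
    rw [add_comm n j]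
    exact (Prod.mk.inj h2).1

theorem injective_cocycle {p : Z × (ℕ → W)} (h : ∀ n, Function.Injective (A (orbit f p.1 p.2 n)))
    (n : ℕ) : Function.Injective (cocycle f A p n) := by
  induction n with
  | zero => exact fun x y hxy => hxy
  | succ n ih => exact (h n).comp ih

theorem injective_cocycle_iterate {p : Z × (ℕ → W)}
    (h : ∀ n, Function.Injective (A (orbit f p.1 p.2 n))) (i n : ℕ) :
    Function.Injective (cocycle f A ((skewShift f)^[i] p) n) := by
  have h1 := injective_cocycle h (i + n)
  have h2 := injective_cocycle h i
  rw [cocycle_add] at h1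
  have h3 : Function.Surjective (cocycle f A p i) :=
    (LinearMap.injective_iff_surjective (f := (cocycle f A p i).toLinearMap)).1 h2
  intro x y hxy
  obtain ⟨x', rfl⟩ := h3 x
  obtain ⟨y', rfl⟩ := h3 y
  exact congrArg _ (h1 hxy)

/-- The logarithm of the size of the `k`-th exterior power of the cocycle. -/
def logMinor (k : ℕ) (B : EuclideanSpace ℝ (Fin m) →L[ℝ] EuclideanSpace ℝ (Fin m)) : ℝ :=
  1 / 2 * Real.log (minorSq k (stdMatrix B.toLinearMap))

theorem logMinor_comp_le {k : ℕ} (hk : k ≤ m)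
    {B C : EuclideanSpace ℝ (Fin m) →L[ℝ] EuclideanSpace ℝ (Fin m)}
    (hB : Function.Injective B) (hC : Function.Injective C) :
    logMinor k (B.comp C) ≤ logMinor k B + logMinor k C := by
  have h0 : 0 < minorSq k (stdMatrix (B.comp C).toLinearMap) :=
    minorSq_stdMatrix_pos hk (hB.comp hC)
  have h1 : 0 < minorSq k (stdMatrix B.toLinearMap) := minorSq_stdMatrix_pos hk hB
  have h2 : 0 < minorSq k (stdMatrix C.toLinearMap) := minorSq_stdMatrix_pos hk hC
  have h3 : minorSq k (stdMatrix (B.comp C).toLinearMap) ≤ _ :=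
    (congrArg (minorSq k) (stdMatrix_comp B.toLinearMap C.toLinearMap)).trans_le
      (minorSq_mul_le k _ _)
  rw [logMinor, logMinor, logMinor, ← mul_add, ← Real.log_mul h1.ne' h2.ne']
  gcongr

theorem exists_abs_logMinor_comp_sub_le {k : ℕ} (hk : k ≤ m)
    {C : EuclideanSpace ℝ (Fin m) →L[ℝ] EuclideanSpace ℝ (Fin m)} (hC : Function.Injective C) :
    ∃ K : ℝ, ∀ B : EuclideanSpace ℝ (Fin m) →L[ℝ] EuclideanSpace ℝ (Fin m),
      Function.Injective B → |logMinor k (B.comp C) - logMinor k B| ≤ K := by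
  set e := LinearEquiv.ofInjectiveEndo C.toLinearMap hC with he
  set D := LinearMap.toContinuousLinearMap e.symm.toLinearMap with hD
  have hDi : Function.Injective D := e.symm.injective
  refine ⟨max (logMinor k C) (logMinor k D), fun B hB => ?_⟩
  have h1 := logMinor_comp_le hk hB hC
  have h2 := logMinor_comp_le hk (show Function.Injective (B.comp C) from hB.comp hC) hDi
  have h3 : (B.comp C).comp D = B := by
    ext1 v
    have : C (D v) = v := e.apply_symm_apply v
    simp [this]
  rw [h3] at h2
  rw [abs_le]
  constructor
  · linarith [le_max_right (logMinor k C) (logMinor k D)]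
  · linarith [le_max_left (logMinor k C) (logMinor k D)]

theorem exists_abs_sum_log_singularValues_sub_le {k : ℕ} (hk : k ≤ m) :
    ∃ K : ℝ, ∀ B : EuclideanSpace ℝ (Fin m) →L[ℝ] EuclideanSpace ℝ (Fin m),
      Function.Injective B →
      |∑ i ∈ Finset.range k, Real.log (B.toLinearMap.singularValues i) - logMinor k B| ≤ K := by
  refine ⟨|1 / 2 * Real.log (k.factorial * (m ^ k : ℝ))|, fun B hB => ?_⟩
  have hpos : ∀ i ∈ Finset.range k, 0 < B.toLinearMap.singularValues i := fun i hi =>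
    singularValues_pos_of_injective (show Function.Injective B.toLinearMap from hB)
      ((Finset.mem_range.1 hi).trans_le hk)
  set Q := ∏ i ∈ Finset.range k, B.toLinearMap.singularValues i ^ 2 with hQ
  have hQ0 : 0 < Q := Finset.prod_pos fun i hi => pow_pos (hpos i hi) 2
  have h1 : Q ≤ minorSq k (stdMatrix B.toLinearMap) := prod_singularValues_sq_le_minorSq hk _
  have h2 := minorSq_le_prod_singularValues_sq (k := k) B.toLinearMap
  rw [← hQ] at h2
  have hc : 0 < k.factorial * (m ^ k : ℝ) := pos_of_mul_pos_left (hQ0.trans_le (h1.trans h2)) hQ0.le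
  have h3 : ∑ i ∈ Finset.range k, Real.log (B.toLinearMap.singularValues i) =
      1 / 2 * Real.log Q := by
    rw [hQ, Real.log_prod fun i hi => (pow_pos (hpos i hi) 2).ne', Finset.mul_sum]
    refine Finset.sum_congr rfl fun i _ => ?_
    rw [Real.log_pow]
    push_cast
    ring
  have h4 := Real.log_le_log hQ0 h1
  have h5 := Real.log_le_log (hQ0.trans_le h1) h2
  rw [Real.log_mul hc.ne' hQ0.ne'] at h5
  rw [h3, logMinor, abs_le]
  have h6 := le_abs_self (1 / 2 * Real.log (k.factorial * (m ^ k : ℝ)))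
  have h7 := abs_nonneg (1 / 2 * Real.log (k.factorial * (m ^ k : ℝ)))
  constructor <;> linarith

variable [MeasurableSpace Z] [MeasurableSpace W]

theorem measurable_minorSq_of_entries {X : Type*} [MeasurableSpace X] (k : ℕ)
    {M : X → Matrix (Fin m) (Fin m) ℝ} (hM : ∀ i j, Measurable fun x => M x i j) :
    Measurable fun x => minorSq k (M x) := by
  refine Finset.measurable_sum _ fun I _ => Finset.measurable_sum _ fun J _ => ?_
  refine Measurable.pow_const ?_ 2
  simp only [Matrix.det_apply']
  refine Finset.measurable_sum _ fun σ _ => Measurable.const_mul ?_ _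
  exact Finset.measurable_prod _ fun i _ => hM _ _

theorem continuous_stdMatrix_apply (i j : Fin m) :
    Continuous fun B : EuclideanSpace ℝ (Fin m) →L[ℝ] EuclideanSpace ℝ (Fin m) =>
      stdMatrix B.toLinearMap i j := by
  simp only [stdMatrix_apply]
  exact (EuclideanSpace.proj (𝕜 := ℝ) i).continuous.comp
    (ContinuousLinearMap.apply ℝ _ (EuclideanSpace.basisFun (Fin m) ℝ j)).continuous

theorem measurable_stdMatrix_cocycle (hf : Measurable fun p : Z × W => f p.2 p.1)
    (hA : Measurable A) (n : ℕ) (i j : Fin m) :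
    Measurable fun p => stdMatrix (cocycle f A p n).toLinearMap i j := by
  induction n generalizing i j with
  | zero => exact measurable_const
  | succ n ih =>
    have h : ∀ p, stdMatrix (cocycle f A p (n + 1)).toLinearMap i j =
        ∑ l, stdMatrix (A (orbit f p.1 p.2 n)).toLinearMap i l *
          stdMatrix (cocycle f A p n).toLinearMap l j := by
      intro p
      have := stdMatrix_comp (A (orbit f p.1 p.2 n)).toLinearMap (cocycle f A p n).toLinearMap
      rw [← Matrix.mul_apply, ← this]
      rfl
    simp only [h]
    refine Finset.measurable_sum _ fun l _ => Measurable.mul ?_ (ih l j)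
    exact (continuous_stdMatrix_apply i l).measurable.comp (hA.comp (measurable_orbit hf n))

theorem measurable_logMinor_cocycle (hf : Measurable fun p : Z × W => f p.2 p.1)
    (hA : Measurable A) (k n : ℕ) :
    Measurable fun p => logMinor k (cocycle f A p n) :=
  ((measurable_minorSq_of_entries k (measurable_stdMatrix_cocycle hf hA n)).log).const_mul _

variable {P : Measure W} [IsProbabilityMeasure P]

theorem exists_tendsto_logMinor (hf : Measurable fun p : Z × W => f p.2 p.1)
    (hA : Measurable A) {μ : Measure Z} [IsFiniteMeasure μ]
    (hμ : ∀ z, P.map (fun w => f w z) ≤ μ)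
    {ν : Measure Z} [IsProbabilityMeasure ν] (hν : stepLaw f P ν = ν)
    (huniq : ∀ ν' : Measure Z, IsProbabilityMeasure ν' → stepLaw f P ν' = ν' → ν' = ν)
    (hinj : ∀ᵐ z ∂μ, Function.Injective (A z))
    (hint : Integrable (fun z => Real.posLog ‖A z‖) μ) {k : ℕ} (hk : k ≤ m) :
    ∃ γ : EReal, γ < ⊤ ∧ ∀ᵐ p ∂(ν.prod (Measure.infinitePi fun _ : ℕ => P)),
      Tendsto (fun n : ℕ => ((logMinor k (cocycle f A p n) / n : ℝ) : EReal)) atTop (𝓝 γ) := by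
  have hνμ : ν ≤ μ := by rw [← hν]; exact stepLaw_le hf hμ ν
  have hgood : ∀ᵐ p ∂(ν.prod (Measure.infinitePi fun _ : ℕ => P)),
      ∀ n, Function.Injective (A (orbit f p.1 p.2 n)) := by
    have h0 : ∀ᵐ z ∂ν, Function.Injective (A z) := Measure.absolutelyContinuous_of_le hνμ hinj
    have h1 : ∀ᵐ p ∂(ν.prod (Measure.infinitePi fun _ : ℕ => P)), Function.Injective (A p.1) :=
      Measure.quasiMeasurePreserving_fst.ae h0
    have h2 := ae_all_iff.2 fun n : ℕ =>
      ((measurePreserving_skewShift hf hν).iterate n).quasiMeasurePreserving.ae h1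
    filter_upwards [h2] with p hp n
    have := hp n
    rwa [← Prod.mk.eta (p := p), skewShift_iterate] at this
  obtain ⟨C, -, hC⟩ := exists_log_minorSq_le (m := m) k
  refine exists_tendsto_of_subadditive (ergodic_skewShift hf hμ hν huniq)
    (g := fun n p => logMinor k (cocycle f A p n))
    (fun n => measurable_logMinor_cocycle hf hA k n) ?_
    (f := fun p => 1 / 2 * C + k * Real.posLog ‖A p.1‖) ?_ ?_ ?_
  · filter_upwards [hgood] with p hp i j _ _
    rw [cocycle_add, add_comm]
    exact logMinor_comp_le hk (injective_cocycle_iterate hp i j) (injective_cocycle hp i)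
  · exact ((Real.continuous_posLog.measurable.comp (hA.comp measurable_fst).norm).const_mul _).const_add _
  · have h1 : Integrable (fun z => Real.posLog ‖A z‖) ν := hint.mono_measure hνμ
    exact (integrable_const _).add ((h1.comp_fst _).const_mul _)
  · filter_upwards [hgood] with p hp
    have h1 : cocycle f A p 1 = A p.1 := rfl
    rw [h1]
    have h2 := hC (A p.1) (minorSq_stdMatrix_pos hk (hp 0))
    rw [logMinor]
    linarith

/-- Furstenberg–Kesten theorem for a random dynamical system with dominated transition
probabilities and a unique stationary measure, from every initial point where the cocycle is
invertible. -/
theorem exists_lyapunov_exponents (hf : Measurable fun p : Z × W => f p.2 p.1)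
    (hA : Measurable A) {μ : Measure Z} [IsFiniteMeasure μ]
    (hμ : ∀ z, P.map (fun w => f w z) ≤ μ)
    {ν : Measure Z} [IsProbabilityMeasure ν] (hν : stepLaw f P ν = ν)
    (huniq : ∀ ν' : Measure Z, IsProbabilityMeasure ν' → stepLaw f P ν' = ν' → ν' = ν)
    (hinj : ∀ᵐ z ∂μ, Function.Injective (A z))
    (hint : Integrable (fun z => Real.posLog ‖A z‖) μ) :
    ∃ χ : Fin m → EReal, (∀ i, χ i < ⊤) ∧ ∀ z, Function.Injective (A z) →
      ∀ᵐ ω ∂(Measure.infinitePi fun _ : ℕ => P), ∀ i : Fin m,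
        Tendsto (fun n : ℕ => ((Real.log
          ((cocycle f A (z, ω) n).toLinearMap.singularValues i) / n : ℝ) : EReal))
          atTop (𝓝 (χ i)) := by
  have hex : ∀ k : ℕ, ∃ γ : EReal, γ < ⊤ ∧ (k ≤ m →
      ∀ᵐ p ∂(ν.prod (Measure.infinitePi fun _ : ℕ => P)),
      Tendsto (fun n : ℕ => ((logMinor k (cocycle f A p n) / n : ℝ) : EReal)) atTop (𝓝 γ)) := by
    intro k
    by_cases hk : k ≤ m
    · obtain ⟨γ, h1, h2⟩ := exists_tendsto_logMinor hf hA hμ hν huniq hinj hint hk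
      exact ⟨γ, h1, fun _ => h2⟩
    · exact ⟨0, EReal.zero_lt_top, fun h => absurd h hk⟩
  choose Γ hΓt hΓ using hex
  refine ⟨fun i => exponentOfSums Γ i, fun i => exponentOfSums_lt_top (hΓt _), fun z hz => ?_⟩
  have hall : ∀ᵐ p ∂(ν.prod (Measure.infinitePi fun _ : ℕ => P)), ∀ k ≤ m,
      Tendsto (fun n : ℕ => ((logMinor k (cocycle f A p n) / n : ℝ) : EReal)) atTop (𝓝 (Γ k)) := by
    rw [ae_all_iff]
    intro k
    by_cases hk : k ≤ m
    · filter_upwards [hΓ k hk] with p hp _ using hp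
    · exact Eventually.of_forall fun p h => absurd h hk
  filter_upwards [forall_ae_eventually_iterate hf hμ hν huniq hall z,
    forall_ae_orbit_succ_mem hf hμ hinj z] with ω h1 h2 i
  obtain ⟨n₀, hn₀⟩ := h1.exists
  have hgood : ∀ n, Function.Injective (A (orbit f (z, ω).1 (z, ω).2 n)) := by
    intro n
    cases n with
    | zero => exact hz
    | succ n => exact h2 n
  have hlim : ∀ k ≤ m, Tendsto (fun n : ℕ => ((∑ i ∈ Finset.range k, Real.log
      ((cocycle f A (z, ω) n).toLinearMap.singularValues i) / n : ℝ) : EReal)) atTop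
      (𝓝 (Γ k)) := by
    intro k hk
    obtain ⟨K₁, hK₁⟩ := exists_abs_sum_log_singularValues_sub_le hk (m := m)
    obtain ⟨K₂, hK₂⟩ := exists_abs_logMinor_comp_sub_le hk (injective_cocycle hgood n₀)
    have := tendsto_coe_div_of_abs_sub_le (n₀ := n₀) (K := K₁ + K₂)
      (b := fun n => ∑ i ∈ Finset.range k, Real.log
        ((cocycle f A (z, ω) n).toLinearMap.singularValues i)) (fun j => ?_) (hΓt k) (hn₀ k hk)
    · refine this.congr fun n => ?_
      rw [Finset.sum_div]
    · have e1 := hK₁ _ (injective_cocycle hgood (j + n₀))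
      have e2 := hK₂ _ (injective_cocycle_iterate hgood n₀ j)
      rw [← cocycle_add, add_comm n₀ j] at e2
      exact (abs_sub_le _ _ _).trans (add_le_add e1 e2)
  refine tendsto_exponentOfSums (m := m) (s := fun i n => Real.log
      ((cocycle f A (z, ω) n).toLinearMap.singularValues i) / n) ?_ (fun k _ => hΓt k) hlim i.2
  intro n i j hij hj
  refine div_le_div_of_nonneg_right ?_ n.cast_nonneg
  refine Real.log_le_log (singularValues_pos_of_injective ?_ hj)
    (LinearMap.singularValues_antitone _ hij)
  exact injective_cocycle hgood n

end Cocycle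

section ProductMeasures

variable {ι : Type*} [Fintype ι] {X : ι → Type*} [∀ i, MeasurableSpace (X i)]

theorem measure_pi_mono {μ ν : ∀ i, Measure (X i)} [∀ i, SigmaFinite (μ i)]
    [∀ i, SigmaFinite (ν i)] (h : ∀ i, μ i ≤ ν i) :
    Measure.pi μ ≤ Measure.pi ν := by
  refine Measure.le_iff.2 fun s hs => ?_
  simp only [Measure.pi_def]
  rw [toMeasure_apply _ _ hs, toMeasure_apply _ _ hs]
  have h1 : OuterMeasure.pi (fun i => (μ i).toOuterMeasure) ≤
      OuterMeasure.pi fun i => (ν i).toOuterMeasure := by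
    refine OuterMeasure.le_boundedBy.2 fun t => (OuterMeasure.boundedBy_le t).trans ?_
    exact Finset.prod_le_prod' fun i _ => h i _
  exact h1 s

theorem measure_pi_smul_const {Y : Type*} [MeasurableSpace Y] (C : ℝ≥0) (μ : Measure Y)
    [IsFiniteMeasure μ] :
    Measure.pi (fun _ : ι => C • μ) = C ^ Fintype.card ι • Measure.pi fun _ : ι => μ := by
  refine Measure.pi_eq (μ := fun _ : ι => C • μ) fun s _ => ?_
  rw [Measure.smul_apply, Measure.pi_pi]
  simp only [Measure.smul_apply, ENNReal.smul_def, smul_eq_mul, Finset.prod_mul_distrib,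
    Finset.prod_const, Finset.card_univ, ENNReal.coe_pow]

end ProductMeasures

section Cube

variable {m : ℕ}

theorem measurableSet_cube : MeasurableSet (cube m) := by
  simp only [cube, ofPred_forall]
  exact MeasurableSet.iInter fun j => measurableSet_Icc.preimage
    (EuclideanSpace.proj (𝕜 := ℝ) j).continuous.measurable

theorem measurableEmbedding_toLp :
    MeasurableEmbedding (WithLp.toLp 2 : (Fin m → ℝ) → EuclideanSpace ℝ (Fin m)) :=
  (MeasurableEquiv.toLp 2 (Fin m → ℝ)).measurableEmbedding

theorem restrict_cube_eq_map :
    volume.restrict (cube m) = (Measure.pi fun _ : Fin m => volume.restrict (Icc (-1 : ℝ) 1)).map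
      (WithLp.toLp 2) := by
  have h1 := (PiLp.volume_preserving_toLp (Fin m)).restrict_preimage (measurableSet_cube (m := m))
  have h2 : (WithLp.toLp 2 : (Fin m → ℝ) → EuclideanSpace ℝ (Fin m)) ⁻¹' cube m =
      univ.pi fun _ => Icc (-1 : ℝ) 1 := by
    ext v
    simp only [cube, mem_preimage, mem_ofPred_eq, Set.mem_pi, mem_univ, true_imp_iff]
  rw [h2, volume_pi, Measure.restrict_pi_pi] at h1
  exact h1.map_eq.symm

instance isFiniteMeasure_restrict_cube : IsFiniteMeasure (volume.restrict (cube m)) := by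
  rw [restrict_cube_eq_map]
  infer_instance

/-- A null set of values of a coordinate is negligible in the cube. -/
theorem ae_restrict_cube_of_ae {p : ℝ → Prop} (hp : ∀ᵐ x ∂(volume.restrict (Icc (-1 : ℝ) 1)), p x)
    (j : Fin m) : ∀ᵐ z ∂(volume.restrict (cube m)), p (z j) := by
  rw [restrict_cube_eq_map, measurableEmbedding_toLp.ae_map_iff]
  exact (Measure.quasiMeasurePreserving_eval _ j).ae hp

theorem integrable_comp_coord {g : ℝ → ℝ} (hg : IntegrableOn g (Icc (-1 : ℝ) 1) volume)
    (j : Fin m) : IntegrableOn (fun z : EuclideanSpace ℝ (Fin m) => g (z j)) (cube m) volume := by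
  rw [IntegrableOn, restrict_cube_eq_map, measurableEmbedding_toLp.integrable_map_iff]
  have h1 : Integrable g ((Measure.pi fun _ : Fin m => volume.restrict (Icc (-1 : ℝ) 1)).map
      (Function.eval j)) := by
    rw [Measure.pi_map_eval]
    exact Integrable.smul_measure hg (ENNReal.prod_ne_top fun _ _ => measure_ne_top _ _)
  exact h1.comp_measurable (measurable_pi_apply j)

end Cube

section Noise

theorem mod2_mem (r : ℝ) : mod2 r ∈ Ioc (-1 : ℝ) 1 := by
  have := toIocMod_mem_Ioc (two_pos : (0 : ℝ) < 2) (-1) r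
  norm_num at this
  exact this

theorem mod2_mem_Icc (r : ℝ) : mod2 r ∈ Icc (-1 : ℝ) 1 := Ioc_subset_Icc_self (mod2_mem r)

theorem measurable_mod2 : Measurable mod2 := by
  have : mod2 = fun r => (-1 : ℝ) + 2 - Int.fract ((-1 + 2 - r) / 2) * 2 := by
    funext r
    exact toIocMod_eq_sub_fract_mul _ _ _
  rw [this]
  fun_prop

theorem mod2_eq_of_sub_mem {r : ℝ} {k : ℤ} (h : r - 2 * k ∈ Ioc (-1 : ℝ) 1) :
    mod2 r = r - 2 * k := by
  rw [mod2, toIocMod_eq_iff]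
  refine ⟨⟨h.1, h.2.trans (by norm_num)⟩, k, ?_⟩
  simp only [zsmul_eq_mul]
  ring

theorem exists_mod2_eq (r : ℝ) : ∃ k : ℤ, mod2 r = r - 2 * k := by
  refine ⟨toIocDiv (two_pos : (0 : ℝ) < 2) (-1) r, ?_⟩
  have := toIocMod_add_toIocDiv_mul (two_pos : (0 : ℝ) < 2) (-1) r
  rw [mod2]
  linarith

variable {ρ : ℝ → ℝ} {ξ : ℝ}

theorem exists_noiseLaw_le (hρ : IsMotherKernel ρ) (hξ : 0 < ξ) :
    ∃ K : ℝ≥0, noiseLaw ρ ξ ≤ K • volume.restrict (Icc (-ξ) ξ) := by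
  set V := (eVariationOn ρ univ).toReal with hV
  have hbound : ∀ x, ρ x ≤ ρ 0 + V := by
    intro x
    have := eVariationOn.edist_le ρ (mem_univ x) (mem_univ (0 : ℝ))
    have h2 : dist (ρ x) (ρ 0) ≤ V := by
      rw [dist_edist]
      exact ENNReal.toReal_mono hρ.boundedVariation this
    rw [Real.dist_eq] at h2
    linarith [le_abs_self (ρ x - ρ 0)]
  refine ⟨Real.toNNReal (1 / ξ * (ρ 0 + V)), Measure.le_iff.2 fun s hs => ?_⟩
  rw [noiseLaw, withDensity_apply _ hs, Measure.smul_apply, Measure.restrict_apply hs]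
  calc ∫⁻ x in s, ENNReal.ofReal (1 / ξ * ρ (x / ξ))
      ≤ ∫⁻ x in s, (Icc (-ξ) ξ).indicator
          (fun _ => ((Real.toNNReal (1 / ξ * (ρ 0 + V)) : ℝ≥0) : ℝ≥0∞)) x := by
        refine lintegral_mono fun x => ?_
        by_cases hx : x ∈ Icc (-ξ) ξ
        · rw [indicator_of_mem hx]
          exact ENNReal.ofReal_le_ofReal (by gcongr; exact hbound _)
        · have h0 : ρ (x / ξ) = 0 := by
            refine image_eq_zero_of_notMem_tsupport ?_
            rw [hρ.support_eq]
            rintro ⟨h1, h2⟩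
            rw [le_div_iff₀ hξ] at h1
            rw [div_le_iff₀ hξ] at h2
            exact hx ⟨by linarith, by linarith⟩
          rw [h0]
          simp
    _ = _ := by
        rw [lintegral_indicator_const measurableSet_Icc,
          Measure.restrict_apply measurableSet_Icc, inter_comm]
        rfl

/-- The law of `b + η mod 2` is dominated by Lebesgue measure on `[-1,1]`, uniformly in `b`. -/
theorem exists_map_mod2_noiseLaw_le (hρ : IsMotherKernel ρ) (hξ : 0 < ξ) :
    ∃ C : ℝ≥0, ∀ b ∈ Icc (-1 : ℝ) 1,
      (noiseLaw ρ ξ).map (fun η => mod2 (b + η)) ≤ C • volume.restrict (Icc (-1 : ℝ) 1) := by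
  obtain ⟨K, hK⟩ := exists_noiseLaw_le hρ hξ
  obtain ⟨N, hN⟩ := exists_nat_ge (ξ + 2)
  set F : Finset ℤ := Finset.Icc (-(N : ℤ)) N with hF
  refine ⟨K * F.card, fun b hb => Measure.le_iff.2 fun s hs => ?_⟩
  have hmeas : Measurable fun η : ℝ => mod2 (b + η) := measurable_mod2.comp (measurable_const_add b)
  rw [Measure.map_apply hmeas hs]
  refine (hK _).trans ?_
  rw [Measure.smul_apply, Measure.restrict_apply (hmeas hs), Measure.smul_apply, mul_smul]
  rw [ENNReal.smul_def, ENNReal.smul_def, smul_eq_mul, smul_eq_mul]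
  refine mul_le_mul_right ?_ _
  have hsub : (fun η : ℝ => mod2 (b + η)) ⁻¹' s ∩ Icc (-ξ) ξ ⊆
      ⋃ k ∈ F, (fun η : ℝ => η + (b - 2 * (k : ℝ))) ⁻¹' (s ∩ Icc (-1 : ℝ) 1) := by
    rintro η ⟨h1, h2, h3⟩
    obtain ⟨k, hk⟩ := exists_mod2_eq (b + η)
    have h4 := mod2_mem_Icc (b + η)
    have h5 : mod2 (b + η) = η + (b - 2 * (k : ℝ)) := by rw [hk]; ring
    refine mem_iUnion₂.2 ⟨k, ?_, ?_⟩
    · rw [hk] at h4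
      obtain ⟨h6, h7⟩ := h4
      obtain ⟨h8, h9⟩ := hb
      rw [hF, Finset.mem_Icc]
      constructor
      · have : (-(N : ℝ)) ≤ k := by linarith
        exact_mod_cast this
      · have : (k : ℝ) ≤ N := by linarith
        exact_mod_cast this
    · rw [mem_preimage, ← h5]
      exact ⟨h1, mod2_mem_Icc _⟩
  refine (measure_mono hsub).trans ((measure_biUnion_finset_le _ _).trans ?_)
  simp only [measure_preimage_add_right]
  rw [Finset.sum_const, Measure.restrict_apply hs, nsmul_eq_mul, ENNReal.smul_def, smul_eq_mul]
  simp

/-- The law of `b + ω mod 2` is dominated by Lebesgue measure on the cube, uniformly in `b`. -/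
theorem exists_map_mod2_noiseLawVec_le (hρ : IsMotherKernel ρ) (hξ : 0 < ξ) (m : ℕ) :
    ∃ C : ℝ≥0, ∀ b : Fin m → ℝ, (∀ j, b j ∈ Icc (-1 : ℝ) 1) →
      (noiseLawVec m ρ ξ).map
          (fun ω => (WithLp.toLp 2 fun j => mod2 (b j + ω j) : EuclideanSpace ℝ (Fin m))) ≤
        C • volume.restrict (cube m) := by
  have := isProbabilityMeasure_noiseLaw hρ hξ
  obtain ⟨C, hC⟩ := exists_map_mod2_noiseLaw_le hρ hξ
  refine ⟨C ^ m, fun b hb => ?_⟩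
  have hmeas : ∀ j, Measurable fun η : ℝ => mod2 (b j + η) := fun j =>
    measurable_mod2.comp (measurable_const_add _)
  have hprob : ∀ j, IsProbabilityMeasure ((noiseLaw ρ ξ).map fun η : ℝ => mod2 (b j + η)) :=
    fun j => Measure.isProbabilityMeasure_map (hmeas j).aemeasurable
  have h1 := (measurePreserving_pi (fun _ : Fin m => noiseLaw ρ ξ)
    (fun j => (noiseLaw ρ ξ).map fun η : ℝ => mod2 (b j + η))
    (fun j => ⟨hmeas j, rfl⟩)).map_eq
  have h2 : (noiseLawVec m ρ ξ).map
      (fun ω => (WithLp.toLp 2 fun j => mod2 (b j + ω j) : EuclideanSpace ℝ (Fin m))) =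
      (Measure.pi fun j => (noiseLaw ρ ξ).map fun η : ℝ => mod2 (b j + η)).map
        (WithLp.toLp 2) := by
    rw [← h1, Measure.map_map measurableEmbedding_toLp.measurable
      (measurable_pi_lambda _ fun j => (by exact (hmeas j).comp (measurable_pi_apply j)))]
    rfl
  rw [h2, restrict_cube_eq_map, ← Measure.map_smul]
  refine Measure.map_mono ?_ measurableEmbedding_toLp.measurable
  have h3 := measure_pi_smul_const (ι := Fin m) C (volume.restrict (Icc (-1 : ℝ) 1))
  rw [Fintype.card_fin] at h3
  rw [← h3]
  exact measure_pi_mono fun j => hC _ (hb j)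

theorem isProbabilityMeasure_noiseLawVec (hρ : IsMotherKernel ρ) (hξ : 0 < ξ) (m : ℕ) :
    IsProbabilityMeasure (noiseLawVec m ρ ξ) := by
  have := isProbabilityMeasure_noiseLaw hρ hξ
  rw [noiseLawVec]
  infer_instance

theorem noiseLawVec_absolutelyContinuous (hρ : IsMotherKernel ρ) (hξ : 0 < ξ) (m : ℕ) :
    noiseLawVec m ρ ξ ≪ volume := by
  have := isProbabilityMeasure_noiseLaw hρ hξ
  obtain ⟨K, hK⟩ := exists_noiseLaw_le hρ hξ
  have h1 : noiseLawVec m ρ ξ ≤ K ^ m • (volume : Measure (Fin m → ℝ)).restrict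
      (univ.pi fun _ => Icc (-ξ) ξ) := by
    have h3 := measure_pi_smul_const (ι := Fin m) K (volume.restrict (Icc (-ξ) ξ))
    rw [Fintype.card_fin] at h3
    rw [volume_pi, Measure.restrict_pi_pi, ← h3]
    exact measure_pi_mono fun j => hK
  refine (Measure.absolutelyContinuous_of_le h1).trans ?_
  exact (Measure.smul_absolutelyContinuous).trans Measure.restrict_le_self.absolutelyContinuous

theorem noiseLaw_Ioo_pos (hρ : IsMotherKernel ρ) (hξ : 0 < ξ) {a b : ℝ} (hab : a < b)
    (ha : -ξ ≤ a) (hb : b ≤ ξ) : 0 < noiseLaw ρ ξ (Ioo a b) := by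
  rw [pos_iff_ne_zero, noiseLaw, withDensity_apply _ measurableSet_Ioo, Ne,
    lintegral_eq_zero_iff' (by
      exact ((hρ.integrable.comp_div hξ.ne').const_mul _).aemeasurable.ennreal_ofReal.restrict)]
  intro h
  have h1 : ∀ᵐ x ∂volume, x ∈ Icc (-1 : ℝ) 1 → 0 < ρ x :=
    (ae_restrict_iff' measurableSet_Icc).1 hρ.pos_ae
  have h2 : ∀ᵐ x ∂volume, x / ξ ∈ Icc (-1 : ℝ) 1 → 0 < ρ (x / ξ) := by
    have : Measure.QuasiMeasurePreserving (fun x : ℝ => x / ξ) volume volume := by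
      refine ⟨measurable_id.div_const ξ, ?_⟩
      simp only [div_eq_mul_inv]
      rw [Real.map_volume_mul_right (inv_ne_zero hξ.ne')]
      exact Measure.smul_absolutelyContinuous
    exact this.ae h1
  have h3 : ∀ᵐ x ∂(volume.restrict (Ioo a b)), False := by
    filter_upwards [h, ae_restrict_of_ae h2, ae_restrict_mem measurableSet_Ioo] with x hx1 hx2 hx3
    have h4 : 0 < ρ (x / ξ) := by
      refine hx2 ⟨?_, ?_⟩
      · rw [le_div_iff₀ hξ]; linarith [hx3.1]
      · rw [div_le_iff₀ hξ]; linarith [hx3.2]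
    simp only [Pi.zero_apply, ENNReal.ofReal_eq_zero] at hx1
    have : 0 < 1 / ξ * ρ (x / ξ) := by positivity
    linarith
  rw [ae_iff] at h3
  simp only [not_false_eq_true, ofPred_true, Measure.restrict_apply_univ, Real.volume_Ioo] at h3
  simp at h3
  linarith

end Noise

section Translation

variable {m : ℕ}

/-- Translation is continuous in `L¹`. -/
theorem exists_integral_abs_translate_sub_le {q : (Fin m → ℝ) → ℝ} (hq : Integrable q volume)
    {ε : ℝ} (hε : 0 < ε) :
    ∃ δ > 0, ∀ b : Fin m → ℝ, ‖b‖ ≤ δ → ∫ x, |q (b + x) - q x| ≤ ε := by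
  have : Fact ((1 : ℝ≥0∞) ≠ ⊤) := ⟨ENNReal.one_ne_top⟩
  have hq1 : MemLp q 1 (volume : Measure (Fin m → ℝ)) := memLp_one_iff_integrable.2 hq
  have hcont : Continuous fun b : Fin m → ℝ => DomAddAct.mk b +ᵥ hq1.toLp q :=
    DomAddAct.continuous_mk.vadd continuous_const
  obtain ⟨δ, hδ, h⟩ := Metric.continuous_iff.1 hcont 0 ε hε
  refine ⟨δ / 2, half_pos hδ, fun b hb => ?_⟩
  have h1 := h b (by rw [dist_zero_right]; linarith)
  rw [DomAddAct.mk_vadd_toLp, DomAddAct.mk_vadd_toLp, dist_eq_norm, ← MemLp.toLp_sub,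
    L1.norm_eq_integral_norm] at h1
  refine le_trans (le_of_eq (integral_congr_ae ?_)) h1.le
  filter_upwards [MemLp.coeFn_toLp ((hq1.comp_measurePreserving (measurePreserving_vadd b _)).sub
    (hq1.comp_measurePreserving (measurePreserving_vadd (0 : Fin m → ℝ) _)))] with x hx
  rw [Real.norm_eq_abs]
  refine Eq.trans ?_ (congrArg abs hx.symm)
  simp

/-- Translates of an absolutely continuous law are close in total variation. -/
theorem exists_abs_integral_translate_sub_le {N : Measure (Fin m → ℝ)} [IsProbabilityMeasure N]
    (hN : N ≪ volume) {ε : ℝ} (hε : 0 < ε) :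
    ∃ δ > 0, ∀ a b : Fin m → ℝ, ‖a - b‖ ≤ δ → ∀ (ψ : (Fin m → ℝ) → ℝ) (M : ℝ), Measurable ψ →
      (∀ w, |ψ w| ≤ M) → |∫ ω, ψ (a + ω) ∂N - ∫ ω, ψ (b + ω) ∂N| ≤ ε * M := by
  set q : (Fin m → ℝ) → ℝ := fun ω => (N.rnDeriv volume ω).toReal with hq
  have hqi : Integrable q volume := Measure.integrable_toReal_rnDeriv
  obtain ⟨δ, hδ, h⟩ := exists_integral_abs_translate_sub_le hqi hε
  refine ⟨δ, hδ, fun a b hab ψ M hψ hM => ?_⟩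
  have hM0 : 0 ≤ M := (abs_nonneg _).trans (hM 0)
  have hint : ∀ c : Fin m → ℝ, Integrable (fun w => q (c + w) * ψ w) volume := fun c =>
    (hqi.comp_add_left c).mul_bdd hψ.aestronglyMeasurable (Eventually.of_forall hM)
  have h1 : ∀ c : Fin m → ℝ, ∫ ω, ψ (c + ω) ∂N = ∫ w, q (-c + w) * ψ w := by
    intro c
    rw [← integral_rnDeriv_smul hN, ← integral_add_left_eq_self (fun w => q (-c + w) * ψ w) c]
    simp [hq]
  have h2 : ∫ w, |q (-a + w) - q (-b + w)| ≤ ε := by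
    have := h (b - a) (by rwa [← norm_neg, neg_sub])
    rw [← integral_add_left_eq_self (fun w => |q (-a + w) - q (-b + w)|) b]
    refine le_of_eq_of_le (integral_congr_ae (Eventually.of_forall fun w => ?_)) this
    simp only
    congr 3
    · abel
    · abel
  rw [h1, h1, ← integral_sub (hint _) (hint _)]
  calc |∫ w, (q (-a + w) * ψ w - q (-b + w) * ψ w)|
      ≤ ∫ w, |q (-a + w) - q (-b + w)| * M := by
        rw [← Real.norm_eq_abs]
        refine norm_integral_le_of_norm_le
          (((hqi.comp_add_left _).sub (hqi.comp_add_left _)).abs.mul_const M)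
          (Eventually.of_forall fun w => ?_)
        rw [← sub_mul, Real.norm_eq_abs, abs_mul]
        exact mul_le_mul_of_nonneg_left (hM w) (abs_nonneg _)
    _ ≤ ε * M := by
        rw [integral_mul_const]
        gcongr

end Translation

section Windows

/-- For two points of `[-1,1]` at least one of two windows of noise does not increase their
distance. -/
theorem abs_mod2_sub_le_or {a b : ℝ} (ha : a ∈ Icc (-1 : ℝ) 1) (hb : b ∈ Icc (-1 : ℝ) 1) :
    (∀ η ∈ Ioo (0 : ℝ) (1 / 2), |mod2 (a + η) - mod2 (b + η)| ≤ |a - b|) ∨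
      (∀ η ∈ Ioo (-(1 / 2) : ℝ) 0, |mod2 (a + η) - mod2 (b + η)| ≤ |a - b|) := by
  wlog hab : a ≤ b generalizing a b
  · simp only [abs_sub_comm a b, fun η => abs_sub_comm (mod2 (a + η)) (mod2 (b + η))]
    exact this hb ha (le_of_not_ge hab)
  have hid : ∀ r ∈ Ioc (-1 : ℝ) 1, mod2 r = r := fun r hr => by
    have := mod2_eq_of_sub_mem (r := r) (k := 0) (by simpa using hr)
    simpa using this
  rcases le_or_gt 1 (b - a) with h1 | h1
  · left
    intro η _
    obtain ⟨k, hk⟩ := exists_mod2_eq (a + η)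
    obtain ⟨l, hl⟩ := exists_mod2_eq (b + η)
    have h2 := mod2_mem (a + η)
    have h3 := mod2_mem (b + η)
    have h4 : mod2 (b + η) - mod2 (a + η) = (b - a) - 2 * ((l - k : ℤ) : ℝ) := by
      rw [hk, hl]; push_cast; ring
    have h5 : |mod2 (b + η) - mod2 (a + η)| < 2 := by
      rw [abs_lt]; constructor <;> linarith [h2.1, h2.2, h3.1, h3.2]
    rw [abs_sub_comm, abs_sub_comm a b, h4]
    rw [h4, abs_lt] at h5
    have hba : b - a ≤ 2 := by linarith [ha.1, hb.2]
    rw [abs_of_nonneg (by linarith : (0 : ℝ) ≤ b - a)]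
    have h6 : (l - k : ℤ) < 2 := by
      have : ((l - k : ℤ) : ℝ) < 2 := by linarith
      exact_mod_cast this
    have h7 : (-1 : ℤ) < l - k := by
      have : (-1 : ℝ) < ((l - k : ℤ) : ℝ) := by linarith
      exact_mod_cast this
    obtain h8 | h8 : l - k = 0 ∨ l - k = 1 := by omega
    · rw [h8, abs_le]; push_cast; constructor <;> linarith
    · rw [h8, abs_le]; push_cast; constructor <;> linarith
  · rcases le_or_gt b (1 / 2) with h2 | h2
    · left
      rintro η ⟨h3, h4⟩
      rw [hid (a + η) ⟨by linarith [ha.1], by linarith⟩,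
        hid (b + η) ⟨by linarith [hb.1], by linarith⟩]
      simp
    · right
      rintro η ⟨h3, h4⟩
      rw [hid (a + η) ⟨by linarith, by linarith [ha.2]⟩,
        hid (b + η) ⟨by linarith, by linarith [hb.2]⟩]
      simp

end Windows

section Contraction

variable {d : ℕ}

/-- The point `F(z)` perturbed by the noise `ω`, reduced modulo `2`. -/
def noisyMap {m : ℕ} (F : EuclideanSpace ℝ (Fin m) → EuclideanSpace ℝ (Fin m)) (ω : Fin m → ℝ)
    (z : EuclideanSpace ℝ (Fin m)) : EuclideanSpace ℝ (Fin m) :=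
  WithLp.toLp 2 fun j => mod2 (F z j + ω j)

theorem noisyMap_mem_cube {m : ℕ} (F : EuclideanSpace ℝ (Fin m) → EuclideanSpace ℝ (Fin m))
    (ω : Fin m → ℝ) (z : EuclideanSpace ℝ (Fin m)) : noisyMap F ω z ∈ cube m :=
  fun _ => mod2_mem_Icc _

theorem measurable_noisyMap {m : ℕ}
    {F : EuclideanSpace ℝ (Fin m) → EuclideanSpace ℝ (Fin m)} (hF : Measurable F) :
    Measurable fun p : EuclideanSpace ℝ (Fin m) × (Fin m → ℝ) => noisyMap F p.2 p.1 := by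
  refine measurableEmbedding_toLp.measurable.comp (measurable_pi_lambda _ fun j => ?_)
  refine measurable_mod2.comp (Measurable.add ?_ ?_)
  · exact (EuclideanSpace.proj (𝕜 := ℝ) j).continuous.measurable.comp (hF.comp measurable_fst)
  · exact (measurable_pi_apply j).comp measurable_snd

/-- A map of the cube into itself that preserves the fibers `{z | z 0 = x}` and contracts them. -/
structure IsFiberContracting (F : EuclideanSpace ℝ (Fin (d + 1)) → EuclideanSpace ℝ (Fin (d + 1)))
    (c : ℝ) : Prop where
  measurable : Measurable F
  mem_cube : ∀ z, F z ∈ cube (d + 1)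
  base_eq : ∀ z ∈ cube (d + 1), ∀ z' ∈ cube (d + 1), z 0 = z' 0 → F z 0 = F z' 0
  norm_sub_le : ∀ z ∈ cube (d + 1), ∀ z' ∈ cube (d + 1), z 0 = z' 0 → ‖F z - F z'‖ ≤ c * ‖z - z'‖

/-- `φ` varies by at most `M` between points of the same fiber at distance at most `r`. -/
def FiberOscLE (φ : EuclideanSpace ℝ (Fin (d + 1)) → ℝ) (r M : ℝ) : Prop :=
  ∀ z ∈ cube (d + 1), ∀ z' ∈ cube (d + 1), z 0 = z' 0 → ‖z - z'‖ ≤ r → |φ z - φ z'| ≤ M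

variable {F : EuclideanSpace ℝ (Fin (d + 1)) → EuclideanSpace ℝ (Fin (d + 1))} {c : ℝ}
  {N : Measure (Fin (d + 1) → ℝ)} [IsProbabilityMeasure N]

/-- The Markov operator of the noisy map. -/
def markovOp (F : EuclideanSpace ℝ (Fin (d + 1)) → EuclideanSpace ℝ (Fin (d + 1)))
    (N : Measure (Fin (d + 1) → ℝ)) (φ : EuclideanSpace ℝ (Fin (d + 1)) → ℝ)
    (z : EuclideanSpace ℝ (Fin (d + 1))) : ℝ :=
  ∫ ω, φ (noisyMap F ω z) ∂N

theorem measurable_markovOp (hF : Measurable F) {φ : EuclideanSpace ℝ (Fin (d + 1)) → ℝ}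
    (hφ : Measurable φ) : Measurable (markovOp F N φ) :=
  ((hφ.comp (measurable_noisyMap hF)).stronglyMeasurable.integral_prod_right').measurable

theorem abs_markovOp_le {φ : EuclideanSpace ℝ (Fin (d + 1)) → ℝ} {B : ℝ} (hφ : ∀ z, |φ z| ≤ B)
    (z : EuclideanSpace ℝ (Fin (d + 1))) : |markovOp F N φ z| ≤ B := by
  have := norm_integral_le_of_norm_le_const (μ := N) (f := fun ω => φ (noisyMap F ω z)) (C := B)
    (Eventually.of_forall fun ω => hφ _)
  simpa [markovOp] using this

theorem integrable_comp_noisyMap (hF : Measurable F) {φ : EuclideanSpace ℝ (Fin (d + 1)) → ℝ}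
    (hφ : Measurable φ) {B : ℝ} (hB : ∀ z, |φ z| ≤ B) (z : EuclideanSpace ℝ (Fin (d + 1))) :
    Integrable (fun ω => φ (noisyMap F ω z)) N :=
  Integrable.of_bound (C := B)
    (hφ.comp ((measurable_noisyMap hF).comp measurable_prodMk_left)).aestronglyMeasurable
    (Eventually.of_forall fun _ => hB _)

/-- With probability at least `p`, applying the same noise does not increase distances. -/
def HasContractingNoise (N : Measure (Fin (d + 1) → ℝ)) (p : ℝ) : Prop :=
  ∀ a ∈ cube (d + 1), ∀ b ∈ cube (d + 1), ∃ S : Set (Fin (d + 1) → ℝ), MeasurableSet S ∧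
    p ≤ N.real S ∧ ∀ ω ∈ S, ∀ j, |mod2 (a j + ω j) - mod2 (b j + ω j)| ≤ |a j - b j|

theorem fiberOscLE_markovOp (hF : IsFiberContracting F c) {p : ℝ} (hp : HasContractingNoise N p)
    {φ : EuclideanSpace ℝ (Fin (d + 1)) → ℝ} (hφ : Measurable φ) {B : ℝ} (hB : ∀ z, |φ z| ≤ B)
    {r s M L : ℝ} (hr : 0 ≤ c) (hs : c * r ≤ s) (hLM : L ≤ M) (hL : FiberOscLE φ s L)
    (hM : ∀ t, FiberOscLE φ t M) :
    FiberOscLE (markovOp F N φ) r (p * L + (1 - p) * M) := by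
  intro z hz z' hz' h0 hzz'
  obtain ⟨S, hS, hpS, hSω⟩ := hp (F z) (hF.mem_cube z) (F z') (hF.mem_cube z')
  have hbase : ∀ ω, noisyMap F ω z 0 = noisyMap F ω z' 0 := fun ω => by
    simp only [noisyMap, hF.base_eq z hz z' hz' h0]
  have hi := fun z => integrable_comp_noisyMap (N := N) hF.measurable hφ hB z
  rw [markovOp, markovOp, ← integral_sub (hi z) (hi z')]
  have hbd : ∀ ω, |φ (noisyMap F ω z) - φ (noisyMap F ω z')| ≤
      M - (M - L) * S.indicator 1 ω := by
    intro ω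
    by_cases hω : ω ∈ S
    · rw [indicator_of_mem hω, Pi.one_apply]
      have : |φ (noisyMap F ω z) - φ (noisyMap F ω z')| ≤ L := by
        refine hL _ (noisyMap_mem_cube _ _ _) _ (noisyMap_mem_cube _ _ _) (hbase ω) ?_
        have h1 : ‖noisyMap F ω z - noisyMap F ω z'‖ ≤ ‖F z - F z'‖ := by
          rw [EuclideanSpace.norm_eq, EuclideanSpace.norm_eq]
          refine Real.sqrt_le_sqrt (Finset.sum_le_sum fun j _ => ?_)
          exact pow_le_pow_left₀ (norm_nonneg _) (hSω ω hω j) 2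
        refine h1.trans ((hF.norm_sub_le z hz z' hz' h0).trans (le_trans ?_ hs))
        gcongr
      linarith
    · rw [indicator_of_notMem hω, mul_zero, sub_zero]
      exact hM _ _ (noisyMap_mem_cube _ _ _) _ (noisyMap_mem_cube _ _ _) (hbase ω) le_rfl
  have hSi : Integrable (S.indicator (1 : (Fin (d + 1) → ℝ) → ℝ)) N :=
    (integrable_const (1 : ℝ)).indicator hS
  have h2 := norm_integral_le_of_norm_le (μ := N)
    (f := fun ω => φ (noisyMap F ω z) - φ (noisyMap F ω z'))
    (g := fun ω => M - (M - L) * S.indicator 1 ω)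
    ((integrable_const M).sub (hSi.const_mul (M - L))) (Eventually.of_forall hbd)
  rw [Real.norm_eq_abs] at h2
  refine h2.trans ?_
  rw [integral_sub (integrable_const M) (hSi.const_mul (M - L)), integral_const_mul,
    integral_indicator_one hS]
  simp only [integral_const, probReal_univ, smul_eq_mul, one_mul]
  have : (M - L) * p ≤ (M - L) * N.real S := mul_le_mul_of_nonneg_left hpS (by linarith)
  linarith

/-- The projection of the cube onto the zero section. -/
def zeroSection (z : EuclideanSpace ℝ (Fin (d + 1))) : EuclideanSpace ℝ (Fin (d + 1)) :=
  EuclideanSpace.single 0 (z 0)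

theorem zeroSection_mem_cube {z : EuclideanSpace ℝ (Fin (d + 1))} (hz : z ∈ cube (d + 1)) :
    zeroSection z ∈ cube (d + 1) := by
  intro j
  rw [zeroSection, PiLp.single_apply]
  split_ifs
  · exact hz 0
  · constructor <;> norm_num

theorem zeroSection_zero (z : EuclideanSpace ℝ (Fin (d + 1))) : zeroSection z 0 = z 0 := by
  rw [zeroSection, PiLp.single_apply, if_pos rfl]

theorem continuous_single_zero :
    Continuous fun x : ℝ => (EuclideanSpace.single 0 x : EuclideanSpace ℝ (Fin (d + 1))) := by
  have : (fun x : ℝ => (EuclideanSpace.single 0 x : EuclideanSpace ℝ (Fin (d + 1)))) =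
      fun x : ℝ => x • (EuclideanSpace.single 0 1 : EuclideanSpace ℝ (Fin (d + 1))) := by
    funext x
    ext j
    simp
  rw [this]
  exact continuous_id.smul continuous_const

theorem measurable_zeroSection :
    Measurable (zeroSection : EuclideanSpace ℝ (Fin (d + 1)) → _) :=
  continuous_single_zero.measurable.comp (EuclideanSpace.proj (𝕜 := ℝ) 0).continuous.measurable

theorem exists_fiberOscLE_markovOp_half (hF : IsFiberContracting F c) (hc : c ≤ 1)
    (hN : N ≪ volume) :
    ∃ δ > 0, ∀ (φ : EuclideanSpace ℝ (Fin (d + 1)) → ℝ) (B M : ℝ), Measurable φ →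
      (∀ z, |φ z| ≤ B) → (∀ t, FiberOscLE φ t M) →
      FiberOscLE (markovOp F N φ) δ (1 / 2 * M) := by
  obtain ⟨δ, hδ, h⟩ := exists_abs_integral_translate_sub_le hN (half_pos one_pos)
  refine ⟨δ, hδ, fun φ B M hφ hB hM z hz z' hz' h0 hzz' => ?_⟩
  set ψ : (Fin (d + 1) → ℝ) → ℝ := fun w =>
    φ (WithLp.toLp 2 fun j => mod2 (w j)) - φ (zeroSection (WithLp.toLp 2 fun j => mod2 (w j)))
    with hψ
  have hred : Measurable fun w : Fin (d + 1) → ℝ =>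
      (WithLp.toLp 2 fun j => mod2 (w j) : EuclideanSpace ℝ (Fin (d + 1))) :=
    measurableEmbedding_toLp.measurable.comp
      (measurable_pi_lambda _ fun j => measurable_mod2.comp (measurable_pi_apply j))
  have hψm : Measurable ψ :=
    (hφ.comp hred).sub (hφ.comp (measurable_zeroSection.comp hred))
  have hψM : ∀ w, |ψ w| ≤ M := by
    intro w
    have hw : (WithLp.toLp 2 fun j => mod2 (w j) : EuclideanSpace ℝ (Fin (d + 1))) ∈
        cube (d + 1) := fun j => mod2_mem_Icc _
    exact hM _ _ hw _ (zeroSection_mem_cube hw) (zeroSection_zero _).symm le_rfl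
  have hdist : ‖(fun j => F z j) - fun j => F z' j‖ ≤ δ := by
    have h1 : ‖F z - F z'‖ ≤ δ := by
      refine (hF.norm_sub_le z hz z' hz' h0).trans (le_trans ?_ hzz')
      exact mul_le_of_le_one_left (norm_nonneg _) hc
    refine (pi_norm_le_iff_of_nonneg hδ.le).2 fun j => ?_
    exact (PiLp.norm_apply_le (F z - F z') j).trans h1
  have key := h _ _ hdist ψ M hψm hψM
  have hsplit : ∀ y, ∫ ω, ψ ((fun j => F y j) + ω) ∂N = markovOp F N φ y -
      ∫ ω, φ (zeroSection (noisyMap F ω y)) ∂N := by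
    intro y
    rw [markovOp, ← integral_sub (integrable_comp_noisyMap hF.measurable hφ hB y)
      (integrable_comp_noisyMap (φ := fun z => φ (zeroSection z)) hF.measurable
        (hφ.comp measurable_zeroSection) (fun z => hB _) y)]
    rfl
  have hzero : ∀ ω, zeroSection (noisyMap F ω z) = zeroSection (noisyMap F ω z') := by
    intro ω
    simp only [zeroSection, noisyMap, hF.base_eq z hz z' hz' h0]
  rw [hsplit, hsplit] at key
  simp only [hzero] at key
  rwa [sub_sub_sub_cancel_right] at key

theorem fiberOscLE_markovOp_iterate (hF : IsFiberContracting F c) (hc0 : 0 ≤ c)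
    {p : ℝ} (hp : HasContractingNoise N p) (hp0 : 0 ≤ p) {δ : ℝ}
    (hδ : ∀ (φ : EuclideanSpace ℝ (Fin (d + 1)) → ℝ) (B M : ℝ), Measurable φ →
      (∀ z, |φ z| ≤ B) → (∀ t, FiberOscLE φ t M) → FiberOscLE (markovOp F N φ) δ (1 / 2 * M))
    {φ : EuclideanSpace ℝ (Fin (d + 1)) → ℝ} (hφ : Measurable φ) {B M : ℝ} (hB : ∀ z, |φ z| ≤ B)
    (hM0 : 0 ≤ M) (hM : ∀ t, FiberOscLE φ t M) (k : ℕ) :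
    Measurable ((markovOp F N)^[k + 1] φ) ∧ (∀ z, |(markovOp F N)^[k + 1] φ z| ≤ B) ∧
      (∀ t, FiberOscLE ((markovOp F N)^[k + 1] φ) t M) ∧
      ∀ r, c ^ k * r ≤ δ → FiberOscLE ((markovOp F N)^[k + 1] φ) r ((1 - p ^ k / 2) * M) := by
  have hmono : ∀ {φ : EuclideanSpace ℝ (Fin (d + 1)) → ℝ}, Measurable φ → (∀ z, |φ z| ≤ B) →
      (∀ t, FiberOscLE φ t M) → ∀ t, FiberOscLE (markovOp F N φ) t M := by
    intro φ hφ hB hM t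
    have := fiberOscLE_markovOp hF hp hφ hB (r := t) hc0 le_rfl le_rfl (hM (c * t)) hM
    rwa [← add_mul, add_sub_cancel, one_mul] at this
  induction k with
  | zero =>
    refine ⟨measurable_markovOp hF.measurable hφ, abs_markovOp_le hB, hmono hφ hB hM, ?_⟩
    intro r hr z hz z' hz' h0 hzz'
    have := hδ φ B M hφ hB hM z hz z' hz' h0 (hzz'.trans (by simpa using hr))
    refine this.trans (le_of_eq ?_)
    ring
  | succ k ih =>
    obtain ⟨h1, h2, h3, h4⟩ := ih
    rw [Function.iterate_succ_apply']
    refine ⟨measurable_markovOp hF.measurable h1, abs_markovOp_le h2, hmono h1 h2 h3, ?_⟩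
    intro r hr
    have h5 := fiberOscLE_markovOp hF hp h1 h2 (r := r) (s := c * r) (L := (1 - p ^ k / 2) * M)
      hc0 le_rfl (mul_le_of_le_one_left hM0 (by linarith [pow_nonneg hp0 k]))
      (h4 _ (by rw [← mul_assoc, ← pow_succ]; exact hr)) h3
    have h6 : p * ((1 - p ^ k / 2) * M) + (1 - p) * M = (1 - p ^ (k + 1) / 2) * M := by ring
    rwa [h6] at h5

theorem norm_sub_le_of_mem_cube {m : ℕ} {z z' : EuclideanSpace ℝ (Fin m)} (hz : z ∈ cube m)
    (hz' : z' ∈ cube m) : ‖z - z'‖ ≤ √(m * 4) := by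
  rw [EuclideanSpace.norm_eq]
  refine Real.sqrt_le_sqrt ?_
  calc _ ≤ ∑ _j : Fin m, (4 : ℝ) := by
        refine Finset.sum_le_sum fun j _ => ?_
        have h1 := hz j
        have h2 := hz' j
        rw [Real.norm_eq_abs, sq_abs, PiLp.sub_apply]
        nlinarith [h1.1, h1.2, h2.1, h2.2]
    _ = _ := by simp

/-- The Markov operator eventually equalizes observables along the fibers. -/
theorem exists_iterate_fiberOscLE (hF : IsFiberContracting F c) (hc0 : 0 ≤ c) (hc1 : c < 1)
    (hN : N ≪ volume) {p : ℝ} (hp : HasContractingNoise N p) (hp0 : 0 < p)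
    {φ : EuclideanSpace ℝ (Fin (d + 1)) → ℝ} (hφ : Measurable φ) {B : ℝ} (hB : ∀ z, |φ z| ≤ B)
    {ε : ℝ} (hε : 0 < ε) :
    ∃ n, ∀ t, FiberOscLE ((markovOp F N)^[n] φ) t ε := by
  have hp1 : p ≤ 1 := by
    obtain ⟨S, -, h, -⟩ := hp 0 (fun j => by simp) 0 (fun j => by simp)
    exact h.trans measureReal_le_one
  obtain ⟨δ, hδ, hhalf⟩ := exists_fiberOscLE_markovOp_half hF hc1.le hN
  obtain ⟨k, hk⟩ : ∃ k : ℕ, c ^ k * √((d + 1 : ℕ) * 4) ≤ δ := by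
    have h1 : Tendsto (fun k : ℕ => c ^ k * √((d + 1 : ℕ) * 4)) atTop (𝓝 (0 * √((d + 1 : ℕ) * 4))) :=
      (tendsto_pow_atTop_nhds_zero_of_lt_one hc0 hc1).mul_const _
    rw [zero_mul] at h1
    exact (h1.eventually_le_const hδ).exists
  have hB0 : 0 ≤ B := (abs_nonneg _).trans (hB 0)
  set θ := 1 - p ^ k / 2 with hθ
  have hθ1 : θ < 1 := by
    have := pow_pos hp0 k
    linarith
  have hθ0 : 0 ≤ θ := by
    have := pow_le_one₀ hp0.le hp1 (n := k)
    linarith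
  have hiter : ∀ j : ℕ, Measurable ((markovOp F N)^[(k + 1) * j] φ) ∧
      (∀ z, |(markovOp F N)^[(k + 1) * j] φ z| ≤ B) ∧
      ∀ t, FiberOscLE ((markovOp F N)^[(k + 1) * j] φ) t (θ ^ j * (2 * B)) := by
    intro j
    induction j with
    | zero =>
      refine ⟨hφ, hB, fun t z _ z' _ _ _ => ?_⟩
      have h1 := hB z
      have h2 := hB z'
      rw [abs_le] at h1 h2
      rw [pow_zero, one_mul]
      change |φ z - φ z'| ≤ _
      rw [abs_le]
      constructor <;> linarith
    | succ j ih =>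
      obtain ⟨h1, h2, h3⟩ := ih
      obtain ⟨e1, e2, -, e4⟩ := fiberOscLE_markovOp_iterate hF hc0 hp hp0.le hhalf h1 h2
        (by positivity) h3 k
      have hidx : (k + 1) * (j + 1) = (k + 1) + (k + 1) * j := by ring
      rw [hidx, Function.iterate_add_apply]
      refine ⟨e1, e2, fun t z hz z' hz' h0 _ => ?_⟩
      have := e4 _ hk z hz z' hz' h0 (norm_sub_le_of_mem_cube hz hz')
      refine this.trans (le_of_eq ?_)
      rw [pow_succ]
      ring
  have hlim : Tendsto (fun j : ℕ => θ ^ j * (2 * B)) atTop (𝓝 (0 * (2 * B))) :=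
    (tendsto_pow_atTop_nhds_zero_of_lt_one hθ0 hθ1).mul_const _
  rw [zero_mul] at hlim
  obtain ⟨j, hj⟩ := (hlim.eventually_le_const hε).exists
  exact ⟨(k + 1) * j, fun t z hz z' hz' h0 h => ((hiter j).2.2 t z hz z' hz' h0 h).trans hj⟩

theorem integral_markovOp (hF : Measurable F) {ν : Measure (EuclideanSpace ℝ (Fin (d + 1)))}
    [IsProbabilityMeasure ν] (hν : stepLaw (noisyMap F) N ν = ν)
    {φ : EuclideanSpace ℝ (Fin (d + 1)) → ℝ} (hφ : Measurable φ) {B : ℝ} (hB : ∀ z, |φ z| ≤ B) :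
    ∫ z, markovOp F N φ z ∂ν = ∫ z, φ z ∂ν := by
  conv_rhs => rw [← hν]
  have hm := measurable_noisyMap hF
  rw [stepLaw, integral_map hm.aemeasurable hφ.aestronglyMeasurable, integral_prod]
  · rfl
  · exact Integrable.of_bound (C := B) (hφ.comp hm).aestronglyMeasurable
      (Eventually.of_forall fun p => hB _)

theorem ae_mem_cube_of_stepLaw_eq (hF : Measurable F)
    {P : Measure (Fin (d + 1) → ℝ)} {ν : Measure (EuclideanSpace ℝ (Fin (d + 1)))} (hν : stepLaw (noisyMap F) P ν = ν) :
    ∀ᵐ z ∂ν, z ∈ cube (d + 1) := by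
  rw [← hν, stepLaw, ae_map_iff (p := fun z => z ∈ cube (d + 1))
    (measurable_noisyMap hF).aemeasurable measurableSet_cube]
  exact Eventually.of_forall fun p => noisyMap_mem_cube _ _ _

/-- Two stationary measures of a fiber contracting noisy map with the same projection to the base
coincide. -/
theorem eq_of_map_eq (hF : IsFiberContracting F c) (hc0 : 0 ≤ c) (hc1 : c < 1)
    (hN : N ≪ volume) {p : ℝ} (hp : HasContractingNoise N p) (hp0 : 0 < p)
    {ν ν' : Measure (EuclideanSpace ℝ (Fin (d + 1)))} [IsProbabilityMeasure ν]
    [IsProbabilityMeasure ν'] (hν : stepLaw (noisyMap F) N ν = ν)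
    (hν' : stepLaw (noisyMap F) N ν' = ν')
    (hbase : ν.map (fun z => z 0) = ν'.map fun z => z 0) : ν = ν' := by
  refine Measure.ext fun A hA => ?_
  set φ : EuclideanSpace ℝ (Fin (d + 1)) → ℝ := A.indicator 1 with hφ
  have hφm : Measurable φ := measurable_one.indicator hA
  have hφB : ∀ z, |φ z| ≤ 1 := by
    intro z
    by_cases hz : z ∈ A
    · simp [hφ, hz]
    · simp [hφ, hz]
  have hmain : ∀ ε > 0, |∫ z, φ z ∂ν - ∫ z, φ z ∂ν'| ≤ ε + ε := by
    intro ε hε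
    obtain ⟨n, hn⟩ := exists_iterate_fiberOscLE hF hc0 hc1 hN hp hp0 hφm hφB hε
    have hiter : ∀ k, Measurable ((markovOp F N)^[k] φ) ∧ ∀ z, |(markovOp F N)^[k] φ z| ≤ 1 := by
      intro k
      induction k with
      | zero => exact ⟨hφm, hφB⟩
      | succ k ih =>
        rw [Function.iterate_succ_apply']
        exact ⟨measurable_markovOp hF.measurable ih.1, abs_markovOp_le ih.2⟩
    have hinv : ∀ {ν : Measure (EuclideanSpace ℝ (Fin (d + 1)))} [IsProbabilityMeasure ν],
        stepLaw (noisyMap F) N ν = ν →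
        ∀ k, ∫ z, (markovOp F N)^[k] φ z ∂ν = ∫ z, φ z ∂ν := by
      intro ν _ h k
      induction k with
      | zero => rfl
      | succ k ih =>
        rw [Function.iterate_succ_apply', integral_markovOp hF.measurable h (hiter k).1 (hiter k).2,
          ih]
    set ψ := (markovOp F N)^[n] φ with hψ
    have hψm : Measurable ψ := (hiter n).1
    have hclose : ∀ {ν : Measure (EuclideanSpace ℝ (Fin (d + 1)))} [IsProbabilityMeasure ν],
        stepLaw (noisyMap F) N ν = ν →
        |∫ z, ψ z ∂ν - ∫ x, ψ (EuclideanSpace.single 0 x) ∂(ν.map fun z => z 0)| ≤ ε := by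
      intro ν _ h
      have h1 : ∫ x, ψ (EuclideanSpace.single 0 x) ∂(ν.map fun z => z 0) =
          ∫ z, ψ (zeroSection z) ∂ν := by
        exact integral_map (φ := fun z : EuclideanSpace ℝ (Fin (d + 1)) => z 0)
          (f := fun x => ψ (EuclideanSpace.single 0 x))
          (EuclideanSpace.proj (𝕜 := ℝ) 0).continuous.measurable.aemeasurable
          (hψm.comp continuous_single_zero.measurable).aestronglyMeasurable
      have i1 : Integrable ψ ν := Integrable.of_bound (C := 1) hψm.aestronglyMeasurable
        (Eventually.of_forall (hiter n).2)
      have i2 : Integrable (fun z => ψ (zeroSection z)) ν := Integrable.of_bound (C := 1)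
        (hψm.comp measurable_zeroSection).aestronglyMeasurable
        (Eventually.of_forall fun z => (hiter n).2 _)
      rw [h1, ← integral_sub i1 i2]
      have := norm_integral_le_of_norm_le_const (μ := ν)
        (f := fun z => ψ z - ψ (zeroSection z)) (C := ε) (by
          filter_upwards [ae_mem_cube_of_stepLaw_eq hF.measurable h] with z hz
          exact hn _ z hz _ (zeroSection_mem_cube hz) (zeroSection_zero z).symm le_rfl)
      simpa using this
    rw [← hinv hν n, ← hinv hν' n]
    have e1 := hclose hν
    have e2 := hclose hν'
    rw [hbase] at e1
    rw [abs_sub_comm] at e2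
    exact (abs_sub_le _ _ _).trans (add_le_add e1 e2)
  have hzero : ∫ z, φ z ∂ν = ∫ z, φ z ∂ν' := by
    by_contra hne
    have hpos : 0 < |∫ z, φ z ∂ν - ∫ z, φ z ∂ν'| := abs_pos.2 (sub_ne_zero.2 hne)
    have := hmain (|∫ z, φ z ∂ν - ∫ z, φ z ∂ν'| / 4) (by positivity)
    linarith
  rw [integral_indicator_one hA, integral_indicator_one hA] at hzero
  exact (ENNReal.toReal_eq_toReal_iff' (measure_ne_top _ _) (measure_ne_top _ _)).1 hzero

end Contraction

section NoiseWindows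

theorem exists_hasContractingNoise {ρ : ℝ → ℝ} (hρ : IsMotherKernel ρ) {ξ : ℝ} (hξ : 0 < ξ)
    (d : ℕ) : ∃ p > 0, HasContractingNoise (noiseLawVec (d + 1) ρ ξ) p := by
  have := isProbabilityMeasure_noiseLaw hρ hξ
  have := isProbabilityMeasure_noiseLawVec hρ hξ (d + 1)
  have hw0 : 0 < min (1 / 2) ξ := lt_min (by norm_num) hξ
  set w := min (1 / 2) ξ with hw
  have hwh : w ≤ 1 / 2 := min_le_left _ _
  have hwξ : w ≤ ξ := min_le_right _ _
  set p₀ := min (noiseLaw ρ ξ (Ioo 0 w)) (noiseLaw ρ ξ (Ioo (-w) 0)) with hp₀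
  have hpos : 0 < p₀ := lt_min
    (noiseLaw_Ioo_pos hρ hξ hw0 (by linarith) hwξ)
    (noiseLaw_Ioo_pos hρ hξ (by linarith) (by linarith) hξ.le)
  have hfin : p₀ ≠ ⊤ := ne_top_of_le_ne_top (measure_ne_top _ _) (min_le_left _ _)
  refine ⟨(p₀ ^ (d + 1)).toReal, ENNReal.toReal_pos (pow_ne_zero _ hpos.ne') (by finiteness),
    fun a ha b hb => ?_⟩
  have hwin : ∀ j, ∃ I : Set ℝ, MeasurableSet I ∧ p₀ ≤ noiseLaw ρ ξ I ∧
      ∀ η ∈ I, |mod2 (a j + η) - mod2 (b j + η)| ≤ |a j - b j| := by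
    intro j
    rcases abs_mod2_sub_le_or (ha j) (hb j) with h | h
    · exact ⟨Ioo 0 w, measurableSet_Ioo, min_le_left _ _,
        fun η hη => h η ⟨hη.1, hη.2.trans_le hwh⟩⟩
    · exact ⟨Ioo (-w) 0, measurableSet_Ioo, min_le_right _ _,
        fun η hη => h η ⟨(neg_le_neg hwh).trans_lt hη.1, hη.2⟩⟩
  choose I hIm hIp hI using hwin
  refine ⟨univ.pi I, MeasurableSet.univ_pi hIm, ?_, fun ω hω j => hI j _ (hω j trivial)⟩
  refine ENNReal.toReal_mono (measure_ne_top _ _) ?_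
  rw [noiseLawVec, Measure.pi_pi]
  calc p₀ ^ (d + 1) = ∏ _j : Fin (d + 1), p₀ := by simp
    _ ≤ _ := Finset.prod_le_prod' fun j _ => hIp j

end NoiseWindows

section BaseMap

theorem _root_.Set.OrdConnected.diff_interior_subset {I : Set ℝ} (hI : I.OrdConnected) :
    I \ interior I ⊆ {sInf I, sSup I} := by
  rintro x ⟨hx, hxi⟩
  by_cases h1 : ∀ y ∈ I, x ≤ y
  · exact Or.inl (IsLeast.csInf_eq ⟨hx, h1⟩).symm
  by_cases h2 : ∀ y ∈ I, y ≤ x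
  · exact Or.inr (IsGreatest.csSup_eq ⟨hx, h2⟩).symm
  push Not at h1 h2
  obtain ⟨a, ha, hax⟩ := h1
  obtain ⟨b, hb, hxb⟩ := h2
  exact absurd (mem_interior_iff_mem_nhds.2
    (mem_of_superset (Icc_mem_nhds hax hxb) (hI.out ha hb))) hxi

theorem IsBaseMap.exists_isOpen_contDiffAt {T : ℝ → ℝ} (hT : IsBaseMap T) :
    ∃ U : Set ℝ, IsOpen U ∧ U ⊆ Icc (-1) 1 ∧ (Icc (-1) 1 \ U).Finite ∧
      ∀ x ∈ U, ContDiffAt ℝ 1 T x := by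
  obtain ⟨k, I, hI, -, hIU, hC⟩ := hT.piecewise_smooth
  refine ⟨⋃ i, interior (I i), isOpen_iUnion fun _ => isOpen_interior, ?_, ?_, ?_⟩
  · rw [← hIU]
    exact iUnion_mono fun i => interior_subset
  · refine (finite_iUnion (f := fun i => {sInf (I i), sSup (I i)})
      fun i => (finite_singleton _).insert _).subset ?_
    rintro x ⟨hx, hxU⟩
    rw [← hIU] at hx
    obtain ⟨i, hi⟩ := mem_iUnion.1 hx
    exact mem_iUnion.2 ⟨i, (hI i).diff_interior_subset
      ⟨hi, fun h => hxU (mem_iUnion.2 ⟨i, h⟩)⟩⟩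
  · intro x hx
    obtain ⟨i, hi⟩ := mem_iUnion.1 hx
    exact (hC i).contDiffAt (isOpen_interior.mem_nhds hi)

theorem IsBaseMap.measurable_indicator {T : ℝ → ℝ} (hT : IsBaseMap T) :
    Measurable ((Icc (-1 : ℝ) 1).indicator T) := by
  classical
  obtain ⟨U, hU, hUI, hfin, hC⟩ := hT.exists_isOpen_contDiffAt
  have h1 : Measurable (U.piecewise T 0) :=
    ContinuousOn.measurable_piecewise (fun x hx => (hC x hx).continuousAt.continuousWithinAt)
      continuousOn_const hU.measurableSet
  refine h1.measurable_of_countable_ne (hfin.countable.mono fun x hx => ?_)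
  by_contra hcon
  refine hx ?_
  by_cases hxU : x ∈ U
  · rw [piecewise_eq_of_mem _ _ _ hxU, indicator_of_mem (hUI hxU)]
  · have hxI : x ∉ Icc (-1 : ℝ) 1 := fun h => hcon ⟨h, hxU⟩
    rw [piecewise_eq_of_notMem _ _ _ hxU, indicator_of_notMem hxI]
    rfl

theorem IsBaseMap.ae_differentiableAt {T : ℝ → ℝ} (hT : IsBaseMap T) :
    ∀ᵐ x ∂(volume.restrict (Icc (-1 : ℝ) 1)),
      x ∈ Ioo (-1 : ℝ) 1 ∧ DifferentiableAt ℝ T x ∧ deriv T x ≠ 0 := by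
  obtain ⟨U, -, -, hfin, hC⟩ := hT.exists_isOpen_contDiffAt
  have hnull : ∀ {s : Set ℝ}, s.Finite → ∀ᵐ x ∂(volume.restrict (Icc (-1 : ℝ) 1)), x ∉ s :=
    fun hs => ae_restrict_of_ae (measure_eq_zero_iff_ae_notMem.1 (hs.measure_zero _))
  filter_upwards [hnull hfin, hnull hT.finite_critical,
    hnull ((finite_singleton (1 : ℝ)).insert (-1)), ae_restrict_mem measurableSet_Icc]
    with x h1 h2 h3 hx
  have hxU : x ∈ U := by
    by_contra h
    exact h1 ⟨hx, h⟩
  simp only [mem_insert_iff, mem_singleton_iff, not_or] at h3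
  exact ⟨⟨lt_of_le_of_ne hx.1 (Ne.symm h3.1), lt_of_le_of_ne hx.2 h3.2⟩,
    (hC x hxU).differentiableAt one_ne_zero, fun h => h2 ⟨hx, h⟩⟩

end BaseMap

section Coordinates

variable {d : ℕ}

theorem fiberCoord_mem_cube {z : EuclideanSpace ℝ (Fin (d + 1))} (hz : z ∈ cube (d + 1)) :
    fiberCoord z ∈ cube d :=
  fun j => hz j.succ

theorem norm_sq_eq_base_add_fiber (z : EuclideanSpace ℝ (Fin (d + 1))) :
    ‖z‖ ^ 2 = |z 0| ^ 2 + ‖fiberCoord z‖ ^ 2 := by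
  rw [EuclideanSpace.norm_sq_eq, EuclideanSpace.norm_sq_eq, Fin.sum_univ_succ]
  rfl

theorem norm_fiberCoord_le (z : EuclideanSpace ℝ (Fin (d + 1))) : ‖fiberCoord z‖ ≤ ‖z‖ := by
  refine le_of_sq_le_sq ?_ (norm_nonneg z)
  rw [norm_sq_eq_base_add_fiber]
  exact le_add_of_nonneg_left (sq_nonneg _)

theorem norm_le_base_add_fiber (z : EuclideanSpace ℝ (Fin (d + 1))) :
    ‖z‖ ≤ |z 0| + ‖fiberCoord z‖ := by
  have h1 := abs_nonneg (z 0)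
  have h2 := norm_nonneg (fiberCoord z)
  refine le_of_sq_le_sq ?_ (add_nonneg h1 h2)
  rw [norm_sq_eq_base_add_fiber]
  nlinarith

/-- The inclusion of the fiber directions. -/
def fiberInclusion (d : ℕ) : EuclideanSpace ℝ (Fin d) →L[ℝ] EuclideanSpace ℝ (Fin (d + 1)) :=
  LinearMap.toContinuousLinearMap
    { toFun := fun y => WithLp.toLp 2 (Fin.cons 0 fun j => y j : Fin (d + 1) → ℝ)
      map_add' := fun y y' => by
        ext j
        refine Fin.cases ?_ (fun i => ?_) j <;> simp
      map_smul' := fun r y => by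
        ext j
        refine Fin.cases ?_ (fun i => ?_) j <;> simp }

theorem fiberInclusion_zero (y : EuclideanSpace ℝ (Fin d)) : fiberInclusion d y 0 = 0 := rfl

theorem fiberInclusion_fiberCoord {v : EuclideanSpace ℝ (Fin (d + 1))} (hv : v 0 = 0) :
    fiberInclusion d (fiberCoord v) = v := by
  ext j
  refine Fin.cases ?_ (fun i => ?_) j
  · rw [fiberInclusion_zero, hv]
  · rfl

end Coordinates

section CubeMap

variable {d : ℕ} {T : ℝ → ℝ} {G : ℝ → EuclideanSpace ℝ (Fin d) → EuclideanSpace ℝ (Fin d)}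

/-- The skew product, extended by `0` outside of the cube. -/
def cubeMap (T : ℝ → ℝ) (G : ℝ → EuclideanSpace ℝ (Fin d) → EuclideanSpace ℝ (Fin d)) :
    EuclideanSpace ℝ (Fin (d + 1)) → EuclideanSpace ℝ (Fin (d + 1)) :=
  (cube (d + 1)).indicator (skewMap T G)

theorem cubeMap_of_mem {z : EuclideanSpace ℝ (Fin (d + 1))} (hz : z ∈ cube (d + 1)) :
    cubeMap T G z = skewMap T G z :=
  indicator_of_mem hz _

theorem skewMap_zero (z : EuclideanSpace ℝ (Fin (d + 1))) : skewMap T G z 0 = T (z 0) := rfl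

theorem noisyMap_cubeMap {z : EuclideanSpace ℝ (Fin (d + 1))} (hz : z ∈ cube (d + 1))
    (ω : Fin (d + 1) → ℝ) : noisyMap (cubeMap T G) ω z = noisySkew T G ω z := by
  rw [noisyMap, cubeMap_of_mem hz, noisySkew]

theorem measurable_cubeMap (hT : IsBaseMap T) (hG : IsFiberMap G) :
    Measurable (cubeMap T G) := by
  refine measurable_of_restrict_of_restrict_compl measurableSet_cube ?_ ?_
  · have h : (cube (d + 1)).domRestrict (cubeMap T G) = fun z =>
        WithLp.toLp 2 (Fin.cons ((Icc (-1 : ℝ) 1).indicator T (z.1 0))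
          (fun j => (cube (d + 1)).domRestrict (fiberFun G) z j) : Fin (d + 1) → ℝ) := by
      funext z
      rw [domRestrict_apply, cubeMap_of_mem z.2, indicator_of_mem (z.2 0)]
      rfl
    rw [h]
    refine measurableEmbedding_toLp.measurable.comp (measurable_pi_lambda _ fun j => ?_)
    refine Fin.cases ?_ (fun i => ?_) j
    · exact hT.measurable_indicator.comp
        ((EuclideanSpace.proj (𝕜 := ℝ) 0).continuous.measurable.comp measurable_subtype_coe)
    · exact (EuclideanSpace.proj (𝕜 := ℝ) i).continuous.measurable.comp hG.measurable
  · have h : (cube (d + 1))ᶜ.domRestrict (cubeMap T G) = fun _ => 0 := by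
      funext z
      exact indicator_of_notMem z.2 _
    rw [h]
    exact measurable_const

theorem isFiberContracting_cubeMap (hT : IsBaseMap T) (hG : IsFiberMap G) {c : ℝ≥0}
    (hc : ∀ x ∈ Icc (-1 : ℝ) 1, LipschitzOnWith c (G x) (cube d)) :
    IsFiberContracting (cubeMap T G) c where
  measurable := measurable_cubeMap hT hG
  mem_cube z := by
    by_cases hz : z ∈ cube (d + 1)
    · rw [cubeMap_of_mem hz]
      intro j
      refine Fin.cases ?_ (fun i => ?_) j
      · exact hT.mapsTo (hz 0)
      · exact hG.mapsTo _ (hz 0) (fiberCoord_mem_cube hz) i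
    · rw [cubeMap, indicator_of_notMem hz]
      intro j
      simp
  base_eq z hz z' hz' h := by
    rw [cubeMap_of_mem hz, cubeMap_of_mem hz', skewMap_zero, skewMap_zero, h]
  norm_sub_le z hz z' hz' h := by
    rw [cubeMap_of_mem hz, cubeMap_of_mem hz']
    have h0 : (skewMap T G z - skewMap T G z') 0 = 0 := by
      rw [PiLp.sub_apply, skewMap_zero, skewMap_zero, h, sub_self]
    have h1 : fiberCoord (skewMap T G z - skewMap T G z') =
        G (z 0) (fiberCoord z) - G (z 0) (fiberCoord z') := by
      change G (z 0) (fiberCoord z) - G (z' 0) (fiberCoord z') = _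
      rw [h]
    refine (norm_le_base_add_fiber _).trans ?_
    rw [h0, abs_zero, zero_add, h1]
    refine ((hc _ (hz 0)).norm_sub_le (fiberCoord_mem_cube hz) (fiberCoord_mem_cube hz')).trans ?_
    exact mul_le_mul_of_nonneg_left (norm_fiberCoord_le (z - z')) c.2

theorem isStationary_noisySkew_iff (hT : IsBaseMap T) (hG : IsFiberMap G)
    {N : Measure (Fin (d + 1) → ℝ)} [IsProbabilityMeasure N]
    {ν : Measure (EuclideanSpace ℝ (Fin (d + 1)))} :
    IsStationary (noisySkew T G) N (cube (d + 1)) ν ↔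
      IsProbabilityMeasure ν ∧ stepLaw (noisyMap (cubeMap T G)) N ν = ν := by
  have heq : IsProbabilityMeasure ν → (∀ᵐ z ∂ν, z ∈ cube (d + 1)) →
      (ν.prod N).map (fun p => noisySkew T G p.2 p.1) = stepLaw (noisyMap (cubeMap T G)) N ν := by
    intro _ h
    refine Measure.map_congr ?_
    filter_upwards [Measure.quasiMeasurePreserving_fst.ae h] with p hp
    exact (noisyMap_cubeMap hp _).symm
  constructor
  · intro h
    have := h.isProbabilityMeasure
    exact ⟨this, by rw [← heq this (ae_iff.2 h.concentrated), h.map_eq]⟩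
  · rintro ⟨h1, h2⟩
    have h3 := ae_mem_cube_of_stepLaw_eq (measurable_cubeMap hT hG) h2
    exact ⟨h1, ae_iff.1 h3, (heq h1 h3).trans h2⟩

theorem isStationary_map_base (hT : IsBaseMap T) (hG : IsFiberMap G) {ρ : ℝ → ℝ}
    (hρ : IsMotherKernel ρ) {ξ : ℝ} (hξ : 0 < ξ)
    {ν : Measure (EuclideanSpace ℝ (Fin (d + 1)))} [IsProbabilityMeasure ν]
    (hν : stepLaw (noisyMap (cubeMap T G)) (noiseLawVec (d + 1) ρ ξ) ν = ν) :
    IsStationary (noisyBase T) (noiseLaw ρ ξ) (Icc (-1) 1) (ν.map fun z => z 0) := by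
  have := isProbabilityMeasure_noiseLaw hρ hξ
  have := isProbabilityMeasure_noiseLawVec hρ hξ (d + 1)
  have hcube := ae_mem_cube_of_stepLaw_eq (measurable_cubeMap hT hG) hν
  have hcoord : Measurable fun z : EuclideanSpace ℝ (Fin (d + 1)) => z 0 :=
    (EuclideanSpace.proj (𝕜 := ℝ) 0).continuous.measurable
  have hprob : IsProbabilityMeasure (ν.map fun z => z 0) :=
    Measure.isProbabilityMeasure_map hcoord.aemeasurable
  have hbase : ∀ᵐ x ∂(ν.map fun z => z 0), x ∈ Icc (-1 : ℝ) 1 := by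
    refine (ae_map_iff (p := fun x => x ∈ Icc (-1 : ℝ) 1) hcoord.aemeasurable
      measurableSet_Icc).2 ?_
    filter_upwards [hcube] with z hz using hz 0
  have hTm : Measurable fun p : ℝ × ℝ => noisyBase ((Icc (-1 : ℝ) 1).indicator T) p.2 p.1 :=
    measurable_mod2.comp ((hT.measurable_indicator.comp measurable_fst).add measurable_snd)
  refine ⟨hprob, ae_iff.1 hbase, ?_⟩
  calc ((ν.map fun z => z 0).prod (noiseLaw ρ ξ)).map (fun p => noisyBase T p.2 p.1)
      = ((ν.map fun z => z 0).prod (noiseLaw ρ ξ)).map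
          (fun p => noisyBase ((Icc (-1 : ℝ) 1).indicator T) p.2 p.1) := by
        refine Measure.map_congr ?_
        filter_upwards [Measure.quasiMeasurePreserving_fst.ae hbase] with p hp
        rw [noisyBase, noisyBase, indicator_of_mem hp]
    _ = ((ν.prod (noiseLawVec (d + 1) ρ ξ)).map
          (Prod.map (fun z => z 0) (Function.eval 0))).map
          (fun p => noisyBase ((Icc (-1 : ℝ) 1).indicator T) p.2 p.1) := by
        rw [← Measure.map_prod_map _ _ hcoord (measurable_pi_apply 0), noiseLawVec,
          (measurePreserving_eval (fun _ : Fin (d + 1) => noiseLaw ρ ξ) 0).map_eq]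
    _ = (ν.prod (noiseLawVec (d + 1) ρ ξ)).map
          (fun p => noisyMap (cubeMap T G) p.2 p.1 0) := by
        rw [Measure.map_map hTm (hcoord.prodMap (measurable_pi_apply 0))]
        refine Measure.map_congr ?_
        filter_upwards [Measure.quasiMeasurePreserving_fst.ae hcube] with p hp
        change mod2 ((Icc (-1 : ℝ) 1).indicator T (p.1 0) + p.2 0) =
          mod2 (cubeMap T G p.1 0 + p.2 0)
        rw [indicator_of_mem (hp 0), cubeMap_of_mem hp, skewMap_zero]
    _ = (stepLaw (noisyMap (cubeMap T G)) (noiseLawVec (d + 1) ρ ξ) ν).map fun z => z 0 := by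
        rw [stepLaw, Measure.map_map hcoord (measurable_noisyMap (measurable_cubeMap hT hG))]
        rfl
    _ = _ := by rw [hν]

end CubeMap

section Derivative

variable {d : ℕ} {T : ℝ → ℝ} {G : ℝ → EuclideanSpace ℝ (Fin d) → EuclideanSpace ℝ (Fin d)}

/-- A point of the open cube at which the skew product is differentiable with derivatives
invertible along the base and along the fiber. -/
structure IsRegularPoint (T : ℝ → ℝ)
    (G : ℝ → EuclideanSpace ℝ (Fin d) → EuclideanSpace ℝ (Fin d))
    (z : EuclideanSpace ℝ (Fin (d + 1))) : Prop where
  mem_Ioo : ∀ j, z j ∈ Ioo (-1 : ℝ) 1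
  differentiableAt_base : DifferentiableAt ℝ T (z 0)
  deriv_ne_zero : deriv T (z 0) ≠ 0
  differentiableAt_fiber : DifferentiableAt ℝ (fiberFun G) z
  injective_fderiv : Function.Injective (fderiv ℝ (G (z 0)) (fiberCoord z))

namespace IsRegularPoint

variable {z : EuclideanSpace ℝ (Fin (d + 1))}

theorem mem_cube (hz : IsRegularPoint T G z) : z ∈ cube (d + 1) :=
  fun j => Ioo_subset_Icc_self (hz.mem_Ioo j)

theorem hasFDerivAt_base (hz : IsRegularPoint T G z) :
    HasFDerivAt (fun z : EuclideanSpace ℝ (Fin (d + 1)) => T (z 0))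
      (deriv T (z 0) • (EuclideanSpace.proj 0 : EuclideanSpace ℝ (Fin (d + 1)) →L[ℝ] ℝ)) z :=
  hz.differentiableAt_base.hasDerivAt.comp_hasFDerivAt z
    (EuclideanSpace.proj 0 : EuclideanSpace ℝ (Fin (d + 1)) →L[ℝ] ℝ).hasFDerivAt

theorem differentiableAt (hz : IsRegularPoint T G z) : DifferentiableAt ℝ (skewMap T G) z := by
  refine differentiableAt_euclidean.2 fun j => ?_
  refine Fin.cases ?_ (fun i => ?_) j
  · exact hz.hasFDerivAt_base.differentiableAt
  · exact differentiableAt_euclidean.1 hz.differentiableAt_fiber i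

theorem fderiv_zero (hz : IsRegularPoint T G z) (v : EuclideanSpace ℝ (Fin (d + 1))) :
    fderiv ℝ (skewMap T G) z v 0 = deriv T (z 0) * v 0 := by
  have h1 := (EuclideanSpace.proj 0 : EuclideanSpace ℝ (Fin (d + 1)) →L[ℝ] ℝ).hasFDerivAt.comp z
    hz.differentiableAt.hasFDerivAt
  exact DFunLike.congr_fun (h1.unique hz.hasFDerivAt_base) v

theorem fiberCoord_fderiv (hz : IsRegularPoint T G z) (v : EuclideanSpace ℝ (Fin (d + 1))) :
    fiberCoord (fderiv ℝ (skewMap T G) z v) = fderiv ℝ (fiberFun G) z v := by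
  ext i
  have h1 := (EuclideanSpace.proj i.succ : EuclideanSpace ℝ (Fin (d + 1)) →L[ℝ] ℝ).hasFDerivAt.comp
    z hz.differentiableAt.hasFDerivAt
  have h2 := (EuclideanSpace.proj i : EuclideanSpace ℝ (Fin d) →L[ℝ] ℝ).hasFDerivAt.comp
    z hz.differentiableAt_fiber.hasFDerivAt
  exact DFunLike.congr_fun (h1.unique h2) v

theorem fderiv_fiber_comp (hz : IsRegularPoint T G z) :
    fderiv ℝ (G (z 0)) (fiberCoord z) = (fderiv ℝ (fiberFun G) z).comp (fiberInclusion d) := by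
  have h1 : HasFDerivAt (fun y => z + fiberInclusion d (y - fiberCoord z)) (fiberInclusion d)
      (fiberCoord z) :=
    ((fiberInclusion d).hasFDerivAt.comp _ ((hasFDerivAt_id _).sub_const _)).const_add z
  have h2 : z + fiberInclusion d (fiberCoord z - fiberCoord z) = z := by simp
  have h3 : HasFDerivAt (fiberFun G) (fderiv ℝ (fiberFun G) z)
      (z + fiberInclusion d (fiberCoord z - fiberCoord z)) := by
    rw [h2]
    exact hz.differentiableAt_fiber.hasFDerivAt
  have h4 := h3.comp (fiberCoord z) h1
  have h5 : (fiberFun G ∘ fun y => z + fiberInclusion d (y - fiberCoord z)) = G (z 0) := by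
    funext y
    have e1 : baseCoord (z + fiberInclusion d (y - fiberCoord z)) = z 0 := by
      rw [baseCoord, PiLp.add_apply, fiberInclusion_zero, add_zero]
    have e2 : fiberCoord (z + fiberInclusion d (y - fiberCoord z)) = y := by
      ext j
      change z j.succ + (y j - z j.succ) = y j
      ring
    rw [Function.comp_apply, fiberFun, e1, e2]
  rw [h5] at h4
  exact h4.fderiv

theorem injective_fderiv_skewMap (hz : IsRegularPoint T G z) :
    Function.Injective (fderiv ℝ (skewMap T G) z) := by
  refine (injective_iff_map_eq_zero _).2 fun v hv => ?_
  have h0 : v 0 = 0 := by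
    have := hz.fderiv_zero v
    rw [hv, PiLp.zero_apply] at this
    exact (mul_eq_zero.1 this.symm).resolve_left hz.deriv_ne_zero
  have h1 : fderiv ℝ (G (z 0)) (fiberCoord z) (fiberCoord v) = 0 := by
    rw [hz.fderiv_fiber_comp, ContinuousLinearMap.comp_apply, fiberInclusion_fiberCoord h0,
      ← hz.fiberCoord_fderiv, hv]
    rfl
  have h2 : fiberCoord v = 0 := hz.injective_fderiv (h1.trans (map_zero _).symm)
  rw [← fiberInclusion_fiberCoord h0, h2, map_zero]

theorem norm_fderiv_le (hz : IsRegularPoint T G z) :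
    ‖fderiv ℝ (skewMap T G) z‖ ≤ |deriv T (z 0)| + ‖fderiv ℝ (fiberFun G) z‖ := by
  refine ContinuousLinearMap.opNorm_le_bound _ (by positivity) fun v => ?_
  refine (norm_le_base_add_fiber _).trans ?_
  rw [hz.fderiv_zero, hz.fiberCoord_fderiv, abs_mul, add_mul]
  refine add_le_add ?_ (ContinuousLinearMap.le_opNorm _ _)
  exact mul_le_mul_of_nonneg_left (PiLp.norm_apply_le v 0) (abs_nonneg _)

/-- Reduction modulo `2` is a translation near the points that it maps to the open cube. -/
theorem hasFDerivAt_noisySkew (hz : IsRegularPoint T G z) {ω : Fin (d + 1) → ℝ}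
    (hω : ∀ j, noisySkew T G ω z j ∈ Ioo (-1 : ℝ) 1) :
    HasFDerivAt (noisySkew T G ω) (fderiv ℝ (skewMap T G) z) z := by
  choose k hk using fun j => exists_mod2_eq (skewMap T G z j + ω j)
  have h1 : HasFDerivAt (fun u => skewMap T G u +
      (WithLp.toLp 2 fun j => ω j - 2 * k j : EuclideanSpace ℝ (Fin (d + 1))))
      (fderiv ℝ (skewMap T G) z) z :=
    hz.differentiableAt.hasFDerivAt.add_const _
  refine h1.congr_of_eventuallyEq ?_
  have h2 : ∀ j, ∀ᶠ u in 𝓝 z, skewMap T G u j + ω j - 2 * k j ∈ Ioo (-1 : ℝ) 1 := by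
    intro j
    have h3 : ContinuousAt (fun u => skewMap T G u j + ω j - 2 * k j) z :=
      (((EuclideanSpace.proj (𝕜 := ℝ) j).continuous.continuousAt.comp
        hz.differentiableAt.continuousAt).add continuousAt_const).sub continuousAt_const
    refine h3.eventually_mem (isOpen_Ioo.mem_nhds ?_)
    have := hω j
    rw [noisySkew] at this
    change mod2 (skewMap T G z j + ω j) ∈ _ at this
    rwa [hk] at this
  filter_upwards [eventually_all.2 h2] with u hu
  ext j
  change mod2 (skewMap T G u j + ω j) = skewMap T G u j + (ω j - 2 * k j)
  rw [mod2_eq_of_sub_mem (Ioo_subset_Ioc_self (hu j))]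
  ring

end IsRegularPoint

theorem isLocalDiffeomorphAt_injective_fderiv {E E' : Type*} [NormedAddCommGroup E]
    [NormedSpace ℝ E] [NormedAddCommGroup E'] [NormedSpace ℝ E'] {f : E → E'} {x : E}
    (h : IsLocalDiffeomorphAt 𝓘(ℝ, E) 𝓘(ℝ, E') 1 f x) : Function.Injective (fderiv ℝ f x) := by
  rw [← mfderiv_eq_fderiv]
  exact (h.mfderivToContinuousLinearEquiv one_ne_zero).injective

theorem mem_interior_cube {m : ℕ} {y : EuclideanSpace ℝ (Fin m)}
    (hy : ∀ j, y j ∈ Ioo (-1 : ℝ) 1) : y ∈ interior (cube m) := by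
  refine mem_interior_iff_mem_nhds.2 ?_
  have h : ∀ j, ∀ᶠ u : EuclideanSpace ℝ (Fin m) in 𝓝 y, u j ∈ Ioo (-1 : ℝ) 1 := fun j =>
    (EuclideanSpace.proj (𝕜 := ℝ) j).continuous.continuousAt.eventually_mem
      (isOpen_Ioo.mem_nhds (hy j))
  filter_upwards [eventually_all.2 h] with u hu j using Ioo_subset_Icc_self (hu j)

theorem ae_isRegularPoint (hT : IsBaseMap T) (hG : IsFiberMap G) :
    ∀ᵐ z ∂(volume.restrict (cube (d + 1))), IsRegularPoint T G z := by
  obtain ⟨k, A, hA, -, hAU, hC⟩ := hG.piecewise_smooth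
  have h1 : ∀ᵐ z ∂(volume.restrict (cube (d + 1))), ∀ i, z ∉ frontier (A i) :=
    ae_restrict_of_ae (ae_all_iff.2 fun i => measure_eq_zero_iff_ae_notMem.1 (hA i).2.2)
  have h2 : ∀ᵐ z ∂(volume.restrict (cube (d + 1))), ∀ j, z j ∈ Ioo (-1 : ℝ) 1 :=
    ae_all_iff.2 fun j => ae_restrict_cube_of_ae (hT.ae_differentiableAt.mono fun x hx => hx.1) j
  filter_upwards [h1, h2, ae_restrict_cube_of_ae hT.ae_differentiableAt 0,
    ae_restrict_cube_of_ae hG.local_diffeo 0, ae_restrict_mem measurableSet_cube]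
    with z hz1 hz2 hz3 hz4 hz5
  refine ⟨hz2, hz3.2.1, hz3.2.2, ?_, ?_⟩
  · rw [← hAU] at hz5
    obtain ⟨i, hi⟩ := mem_iUnion.1 hz5
    have hint : z ∈ interior (A i) := by
      by_contra h
      exact hz1 i ⟨subset_closure hi, h⟩
    exact ((hC i).contDiffAt (isOpen_interior.mem_nhds hint)).differentiableAt one_ne_zero
  · exact isLocalDiffeomorphAt_injective_fderiv
      (hz4 ⟨fiberCoord z, mem_interior_cube fun j => hz2 j.succ⟩)

theorem integrable_posLog_norm_fderiv (hT : IsBaseMap T) (hG : IsFiberMap G) :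
    IntegrableOn (fun z => Real.posLog ‖fderiv ℝ (skewMap T G) z‖) (cube (d + 1)) volume := by
  have hbase : IntegrableOn (fun x => Real.posLog (deriv T x)) (Icc (-1 : ℝ) 1) volume := by
    refine hT.integrable_log.pos_part.congr (Eventually.of_forall fun x => ?_)
    simp only [Real.log_abs]
    rw [Real.posLog_apply, max_comm]
  have hb : IntegrableOn (fun z => Real.log 2 + Real.posLog (deriv T (z 0)) +
      Real.posLog ‖fderiv ℝ (fiberFun G) z‖) (cube (d + 1)) volume :=
    ((integrable_const _).add (integrable_comp_coord hbase 0)).add hG.integrable_posLog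
  refine hb.mono' ?_ ?_
  · exact (Real.continuous_posLog.measurable.comp (measurable_fderiv ℝ _).norm).aestronglyMeasurable
  · filter_upwards [ae_isRegularPoint hT hG] with z hz
    rw [Real.norm_of_nonneg Real.posLog_nonneg, ← Real.posLog_abs (deriv T (z 0))]
    exact (Real.posLog_le_posLog (norm_nonneg _) hz.norm_fderiv_le).trans Real.posLog_add

theorem randomIterate_eq_orbit {z : EuclideanSpace ℝ (Fin (d + 1))} (hz : z ∈ cube (d + 1))
    (ω : ℕ → Fin (d + 1) → ℝ) (n : ℕ) :
    randomIterate T G ω n z = orbit (noisyMap (cubeMap T G)) z ω n := by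
  induction n with
  | zero => rfl
  | succ n ih =>
    have h : orbit (noisyMap (cubeMap T G)) z ω n ∈ cube (d + 1) := by
      cases n with
      | zero => exact hz
      | succ n => exact noisyMap_mem_cube _ _ _
    rw [randomIterate, Function.comp_apply, ih, orbit, noisyMap_cubeMap h]

theorem hasFDerivAt_randomIterate {z : EuclideanSpace ℝ (Fin (d + 1))} {ω : ℕ → Fin (d + 1) → ℝ}
    (h : ∀ n, IsRegularPoint T G (orbit (noisyMap (cubeMap T G)) z ω n)) (n : ℕ) :
    HasFDerivAt (randomIterate T G ω n)
      (cocycle (noisyMap (cubeMap T G)) (fderiv ℝ (skewMap T G)) (z, ω) n) z := by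
  have hz : z ∈ cube (d + 1) := (h 0).mem_cube
  induction n with
  | zero => exact hasFDerivAt_id z
  | succ n ih =>
    have h1 : HasFDerivAt (noisySkew T G (ω n))
        (fderiv ℝ (skewMap T G) (orbit (noisyMap (cubeMap T G)) z ω n))
        (randomIterate T G ω n z) := by
      rw [randomIterate_eq_orbit hz]
      refine (h n).hasFDerivAt_noisySkew ?_
      rw [← noisyMap_cubeMap (h n).mem_cube]
      exact (h (n + 1)).mem_Ioo
    exact h1.comp z ih

theorem lyapQuotient_eq {z : EuclideanSpace ℝ (Fin (d + 1))} {ω : ℕ → Fin (d + 1) → ℝ}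
    (h : ∀ n, IsRegularPoint T G (orbit (noisyMap (cubeMap T G)) z ω n)) (i : Fin (d + 1))
    (n : ℕ) :
    lyapQuotient T G i z ω n = ((Real.log
      ((cocycle (noisyMap (cubeMap T G)) (fderiv ℝ (skewMap T G)) (z, ω)
        n).toLinearMap.singularValues i) / n : ℝ) : EReal) := by
  have hinj := injective_cocycle (A := fderiv ℝ (skewMap T G)) (p := (z, ω))
    (fun n => (h n).injective_fderiv_skewMap) n
  have hpos := singularValues_pos_of_injective (A := (cocycle (noisyMap (cubeMap T G))
    (fderiv ℝ (skewMap T G)) (z, ω) n).toLinearMap) hinj i.2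
  rw [lyapQuotient, (hasFDerivAt_randomIterate h n).fderiv, ENNReal.log_ofReal_of_pos hpos,
    ← EReal.coe_mul]
  congr 1
  ring

end Derivative

end NoisySkew

end

theorem mainTheorem5 (d : ℕ) (hd : 1 ≤ d) (T : ℝ → ℝ)
    (G : ℝ → EuclideanSpace ℝ (Fin d) → EuclideanSpace ℝ (Fin d)) (ρ : ℝ → ℝ)
    (hT : NoisySkew.IsBaseMap T) (hG : NoisySkew.IsFiberMap G)
    (hF : NoisySkew.FiberContraction G) (hρ : NoisySkew.IsMotherKernel ρ)
    (ξ : ℝ) (hξ : 0 < ξ)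
    (hμ : ∃ μ : Measure ℝ,
      NoisySkew.IsStationary (NoisySkew.noisyBase T) (NoisySkew.noiseLaw ρ ξ) (Icc (-1) 1) μ ∧
      ∀ μ' : Measure ℝ,
        NoisySkew.IsStationary (NoisySkew.noisyBase T) (NoisySkew.noiseLaw ρ ξ) (Icc (-1) 1) μ' →
          μ' = μ) :
    ∃ ν : Measure (EuclideanSpace ℝ (Fin (d + 1))),
      (NoisySkew.IsStationary (NoisySkew.noisySkew T G) (NoisySkew.noiseLawVec (d + 1) ρ ξ)
          (NoisySkew.cube (d + 1)) ν ∧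
        ∀ ν' : Measure (EuclideanSpace ℝ (Fin (d + 1))),
          NoisySkew.IsStationary (NoisySkew.noisySkew T G) (NoisySkew.noiseLawVec (d + 1) ρ ξ)
            (NoisySkew.cube (d + 1)) ν' → ν' = ν) ∧
      ∃ χ : Fin (d + 1) → EReal,
        (∀ i, χ i < ⊤) ∧
        (∀ᵐ z ∂ν, ∀ᵐ ω ∂(NoisySkew.noiseSeqLaw (d + 1) ρ ξ), ∀ i : Fin (d + 1),
          Tendsto (NoisySkew.lyapQuotient T G i z ω) atTop (𝓝 (χ i))) ∧
        (∀ᵐ z ∂(volume.restrict (NoisySkew.cube (d + 1))),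
          ∀ᵐ ω ∂(NoisySkew.noiseSeqLaw (d + 1) ρ ξ),
            Tendsto (NoisySkew.lyapQuotient T G 0 z ω) atTop (𝓝 (χ 0))) := by
  open NoisySkew in
  obtain ⟨c, -, hc1, hc⟩ := hF
  have := isProbabilityMeasure_noiseLawVec hρ hξ (d + 1)
  have hFc := isFiberContracting_cubeMap hT hG hc
  have hfm := measurable_noisyMap hFc.measurable
  obtain ⟨C, hC⟩ := exists_map_mod2_noiseLawVec_le hρ hξ (d + 1)
  have hle : ∀ z, (noiseLawVec (d + 1) ρ ξ).map (fun ω => noisyMap (cubeMap T G) ω z) ≤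
      C • volume.restrict (cube (d + 1)) := fun z => hC _ (hFc.mem_cube z)
  obtain ⟨p, hp0, hp⟩ := exists_hasContractingNoise hρ hξ d
  obtain ⟨ν, hν1, hν2, -⟩ := exists_stationary_lintegral_eq hfm hle 0
  have huniq : ∀ ν', IsProbabilityMeasure ν' →
      stepLaw (noisyMap (cubeMap T G)) (noiseLawVec (d + 1) ρ ξ) ν' = ν' → ν' = ν := by
    intro ν' h1 h2
    obtain ⟨μ, -, hμ⟩ := hμ
    exact eq_of_map_eq hFc c.2 hc1 (noiseLawVec_absolutelyContinuous hρ hξ (d + 1)) hp hp0 h2 hν2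
      ((hμ _ (isStationary_map_base hT hG hρ hξ h2)).trans
        (hμ _ (isStationary_map_base hT hG hρ hξ hν2)).symm)
  have hreg := ae_isRegularPoint hT hG
  have hregC : ∀ᵐ z ∂(C • volume.restrict (cube (d + 1))), IsRegularPoint T G z :=
    (Measure.smul_absolutelyContinuous (c := C)).ae_le hreg
  have hint : Integrable (fun z => Real.posLog ‖fderiv ℝ (skewMap T G) z‖)
      (C • volume.restrict (cube (d + 1))) :=
    Integrable.smul_measure_nnreal (integrable_posLog_norm_fderiv hT hG)
  obtain ⟨χ, hχ, hlim⟩ := exists_lyapunov_exponents hfm (measurable_fderiv ℝ (skewMap T G)) hle hν2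
    huniq (hregC.mono fun z hz => hz.injective_fderiv_skewMap) hint
  have hmain : ∀ z, IsRegularPoint T G z → ∀ᵐ ω ∂(noiseSeqLaw (d + 1) ρ ξ), ∀ i : Fin (d + 1),
      Tendsto (lyapQuotient T G i z ω) atTop (𝓝 (χ i)) := by
    intro z hz
    filter_upwards [hlim z hz.injective_fderiv_skewMap, forall_ae_orbit_succ_mem hfm hle hregC z]
      with ω h1 h2 i
    have h3 : ∀ n, IsRegularPoint T G (orbit (noisyMap (cubeMap T G)) z ω n) := by
      intro n
      cases n with
      | zero => exact hz
      | succ n => exact h2 n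
    exact (h1 i).congr fun n => (lyapQuotient_eq h3 i n).symm
  refine ⟨ν, ⟨(isStationary_noisySkew_iff hT hG).2 ⟨hν1, hν2⟩, fun ν' h => ?_⟩, χ, hχ, ?_, ?_⟩
  · obtain ⟨h1, h2⟩ := (isStationary_noisySkew_iff hT hG).1 h
    exact huniq ν' h1 h2
  · have h1 : ν ≤ C • volume.restrict (cube (d + 1)) := by
      rw [← hν2]
      exact stepLaw_le hfm hle ν
    filter_upwards [(Measure.absolutelyContinuous_of_le h1).ae_le hregC] with z hz
    exact hmain z hz
  · filter_upwards [hreg] with z hz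
    filter_upwards [hmain z hz] with ω h
    exact h 0
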